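/- Let $\Omega=(0,1)^2$ and $k\ge 1$. Let $\mathbf a=(a^{ij})_{i,j=1,2}$, $\mathbf b=(b^1,b^2)$ and $c$ be coefficients in $W^{2,\infty}(\Omega)$, identified with their continuous representatives on $\bar\Omega$, and put $$A(u,v)=\iint_\Omega\left(\nabla v^T\mathbf a\nabla u+(\mathbf b\cdot\nabla u)\,v+c\,uv\right)dx\,dy,\qquad A^*(u,v)=A(v,u),\qquad u,v\in H^1_0(\Omega).$$ For $N\ge 1$ let $h=1/(2N)$, let $\Omega_h$ be the uniform mesh of $\bar\Omega$ into $N\times N$ closed square cells $e$ of side $2h$, let $V^h_0$ be the space of continuous functions on $\bar\Omega$ that vanish on $\partial\Omega$ and whose restriction to every cell is in $Q^k$ (polynomials of degree at most $k$ in each variable), and let $A_h(u,v)$ be obtained from $A(u,v)$ by replacing the integral over each cell by the $(k+1)\times(k+1)$ tensor product Gauss-Lobatto quadrature, with the gradients taken from inside the cell; $A_h^*(u,v)=A_h(v,u)$. Let $(\cdot,\cdot)$ be the inner product of $L^2(\Omega)$, let $\|\cdot\|_m$ be the norm of $H^m(\Omega)$, and for $v_h\in V_0^h$ let $\|v_h\|_2=\big(\sum_e\|v_h\|_{H^2(e)}^2\big)^{1/2}$.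 Assume (i) (elliptic regularity) there is a constant $C_R$ such that whenever $f\in L^2(\Omega)$ and $w\in H^1_0(\Omega)$ satisfy $A^*(w,v)=(f,v)$ for all $v\in H_0^1(\Omega)$, then $w\in H^2(\Omega)$ and $\|w\|_2\le C_R\|f\|_0$; (ii) ($V^h$-ellipticity) there is a constant $C_1>0$, independent of $h$, such that $C_1\|v_h\|_1^2\le A_h(v_h,v_h)$ for all $v_h\in V^h_0$ and all $h=1/(2N)$, $N\geq 1$. Then there is a constant $C$, independent of $h$, such that for every $h=1/(2N)$, $N\ge1$, every $\theta_h\in V^h_0$, every solution $w\in H_0^1(\Omega)$ of $A^*(w,v)=(\theta_h,v)$ for all $v\in H^1_0(\Omega)$, and every solution $w_h\in V_0^h$ of $A_h^*(w_h,v_h)=(\theta_h,v_h)$ for all $v_h\in V_0^h$, $$\|w-w_h\|_1\le C\,h\,\|w\|_2\qquad\text{and}\qquad\|w_h\|_2\le C\,\|\theta_h\|_0 .$$ -/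

import Mathlib

open MeasureTheory
open scoped ContDiff Matrix ENNReal

noncomputable section

/-! ### Sobolev spaces on open subsets of the plane -/

/-- The classical partial derivative `∂ₓ φ`. -/
def partialX (φ : ℝ × ℝ → ℝ) : ℝ × ℝ → ℝ := fun p => fderiv ℝ φ p (1, 0)

/-- The classical partial derivative `∂ᵧ φ`. -/
def partialY (φ : ℝ × ℝ → ℝ) : ℝ × ℝ → ℝ := fun p => fderiv ℝ φ p (0, 1)

/-- Test functions on `U`: smooth functions with compact support contained in `U`. -/
def IsTestFunction (U : Set (ℝ × ℝ)) (φ : ℝ × ℝ → ℝ) : Prop :=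
  ContDiff ℝ ∞ φ ∧ HasCompactSupport φ ∧ tsupport φ ⊆ U

/-- `g` is the weak derivative `∂ₓⁱ ∂ᵧʲ u` on the open set `U`. -/
def IsWeakDeriv (U : Set (ℝ × ℝ)) (i j : ℕ) (u g : ℝ × ℝ → ℝ) : Prop :=
  LocallyIntegrableOn u U ∧ LocallyIntegrableOn g U ∧
    ∀ φ : ℝ × ℝ → ℝ, IsTestFunction U φ →
      ∫ p in U, u p * (partialX^[i] (partialY^[j] φ)) p = (-1) ^ (i + j) * ∫ p in U, g p * φ p

open Classical in
/-- A representative of the weak derivative `∂ₓⁱ ∂ᵧʲ u` on `U` (it is unique almost everywhere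
on `U`); by convention `0` if there is none. -/
def weakDeriv (U : Set (ℝ × ℝ)) (i j : ℕ) (u : ℝ × ℝ → ℝ) : ℝ × ℝ → ℝ :=
  if H : ∃ g, IsWeakDeriv U i j u g then H.choose else 0

/-- Membership in the Sobolev space `W^{m,p}(U)`. -/
def MemSobolev (U : Set (ℝ × ℝ)) (m : ℕ) (p : ℝ≥0∞) (u : ℝ × ℝ → ℝ) : Prop :=
  ∀ i j : ℕ, i + j ≤ m → ∃ g, IsWeakDeriv U i j u g ∧ MemLp g p (volume.restrict U)

/-- The norm `‖u‖_{m,2,U} = (∑_{i+j ≤ m} ∬_U |∂ₓⁱ ∂ᵧʲ u|²)^{1/2}` of `H^m(U)`, for `u ∈ H^m(U)`. -/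
def sobolevNorm (U : Set (ℝ × ℝ)) (m : ℕ) (u : ℝ × ℝ → ℝ) : ℝ :=
  Real.sqrt (∑ r ∈ Finset.range (m + 1), ∑ ij ∈ Finset.HasAntidiagonal.antidiagonal r,
    ∫ p in U, (weakDeriv U ij.1 ij.2 u p) ^ 2)

/-- Membership in `H₀¹(U)`, the closure of the test functions in `H¹(U)`. -/
def MemH10 (U : Set (ℝ × ℝ)) (u : ℝ × ℝ → ℝ) : Prop :=
  MemSobolev U 1 2 u ∧
    ∀ ε > 0, ∃ φ, IsTestFunction U φ ∧ sobolevNorm U 1 (u - φ) < ε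

/-! ### The elliptic problem on the unit square -/

/-- The domain `Ω = (0,1) × (0,1)`. -/
def unitSquare : Set (ℝ × ℝ) := Set.Ioo 0 1 ×ˢ Set.Ioo 0 1

/-- The coefficients of the operator `-∇ · (a ∇u) + b · ∇u + c u`. -/
structure EllipticCoeffs where
  a : ℝ × ℝ → Matrix (Fin 2) (Fin 2) ℝ
  b : ℝ × ℝ → Fin 2 → ℝ
  c : ℝ × ℝ → ℝ

/-- `f ∈ W^{2,∞}(Ω)`, represented (so that point values on the closed square make sense) by its
representative that is continuous on the closed square. -/
def IsW2Infty (f : ℝ × ℝ → ℝ) : Prop :=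
  ContinuousOn f (closure unitSquare) ∧ MemSobolev unitSquare 2 ∞ f

/-- All coefficients are in `W^{2,∞}(Ω)`. -/
def EllipticCoeffs.InW2Infty (κ : EllipticCoeffs) : Prop :=
  (∀ i j, IsW2Infty fun p => κ.a p i j) ∧ (∀ i, IsW2Infty fun p => κ.b p i) ∧ IsW2Infty κ.c

/-- The integrand `∇vᵀ a ∇u + (b · ∇u) v + c u v` at the point `p`, where `u`, `v` have the values
`y`, `z` and the gradients `gy`, `gz`. -/
def EllipticCoeffs.integrand (κ : EllipticCoeffs) (p : ℝ × ℝ) (y z : ℝ) (gy gz : Fin 2 → ℝ) : ℝ :=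
  gz ⬝ᵥ (κ.a p *ᵥ gy) + (κ.b p ⬝ᵥ gy) * z + κ.c p * y * z

/-- The weak gradient on `Ω`. -/
def weakGrad (u : ℝ × ℝ → ℝ) (p : ℝ × ℝ) : Fin 2 → ℝ :=
  ![weakDeriv unitSquare 1 0 u p, weakDeriv unitSquare 0 1 u p]

/-- The bilinear form `A(u,v)`. -/
def EllipticCoeffs.form (κ : EllipticCoeffs) (u v : ℝ × ℝ → ℝ) : ℝ :=
  ∫ p in unitSquare, κ.integrand p (u p) (v p) (weakGrad u p) (weakGrad v p)

/-- The adjoint bilinear form `A*(u,v) = A(v,u)`. -/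
def EllipticCoeffs.adjointForm (κ : EllipticCoeffs) (u v : ℝ × ℝ → ℝ) : ℝ := κ.form v u

/-- `w ∈ H₀¹(Ω)` solves the dual problem `A*(w,v) = (f,v)` for all `v ∈ H₀¹(Ω)`. -/
def EllipticCoeffs.IsDualSolution (κ : EllipticCoeffs) (f w : ℝ × ℝ → ℝ) : Prop :=
  MemH10 unitSquare w ∧
    ∀ v, MemH10 unitSquare v → κ.adjointForm w v = ∫ p in unitSquare, f p * v p

/-- Elliptic regularity of the dual problem: solutions with right-hand side `f ∈ L²(Ω)` are in
`H²(Ω)` and satisfy `‖w‖₂ ≤ C ‖f‖₀`. -/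
def EllipticCoeffs.EllipticRegularity (κ : EllipticCoeffs) : Prop :=
  ∃ C : ℝ, ∀ f w : ℝ × ℝ → ℝ, MemLp f 2 (volume.restrict unitSquare) → κ.IsDualSolution f w →
    MemSobolev unitSquare 2 2 w ∧ sobolevNorm unitSquare 2 w ≤ C * sobolevNorm unitSquare 0 f

/-! ### The mesh and the finite element spaces -/

/-- The half width `h` of the cells of the uniform `N × N` mesh of the unit square. -/
def meshSize (N : ℕ) : ℝ := 1 / (2 * N)

/-- The center of the cell with index `e`. -/
def cellCenter {N : ℕ} (e : Fin N × Fin N) : ℝ × ℝ :=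
  ((2 * (e.1 : ℝ) + 1) * meshSize N, (2 * (e.2 : ℝ) + 1) * meshSize N)

/-- The closed cell `[x_e - h, x_e + h] × [y_e - h, y_e + h]`. -/
def meshCell {N : ℕ} (e : Fin N × Fin N) : Set (ℝ × ℝ) :=
  Set.Icc ((cellCenter e).1 - meshSize N) ((cellCenter e).1 + meshSize N) ×ˢ
    Set.Icc ((cellCenter e).2 - meshSize N) ((cellCenter e).2 + meshSize N)

/-- Membership in `V^h`: continuous on the closed square, and in `Q^k(e)` on every cell `e`.
Values outside of the closed square are irrelevant. -/
def MemVh (k N : ℕ) (v : ℝ × ℝ → ℝ) : Prop :=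
  ContinuousOn v (closure unitSquare) ∧
    ∀ e : Fin N × Fin N, ∃ q : ℕ → ℕ → ℝ, ∀ p ∈ meshCell e,
      v p = ∑ i ∈ Finset.range (k + 1), ∑ j ∈ Finset.range (k + 1), q i j * p.1 ^ i * p.2 ^ j

/-- Membership in `V₀^h`. -/
def MemVh0 (k N : ℕ) (v : ℝ × ℝ → ℝ) : Prop :=
  MemVh k N v ∧ ∀ p ∈ frontier unitSquare, v p = 0

/-- The mesh-dependent norm `‖v‖_m = (∑_e ‖v‖²_{m,2,e})^{1/2}` on `V^h`. -/
def brokenNorm (N m : ℕ) (v : ℝ × ℝ → ℝ) : ℝ :=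
  Real.sqrt (∑ e : Fin N × Fin N, sobolevNorm (interior (meshCell e)) m v ^ 2)

/-! ### Gauss-Lobatto quadrature and the discrete problem -/

/-- The `k + 1` Gauss-Lobatto points on `[-1,1]`: the roots of `d^{k-1}/dt^{k-1} (t² - 1)^k`
(equivalently `±1` and the roots of the derivative of the Legendre polynomial of degree `k`). -/
def lobattoNodes (k : ℕ) : Finset ℝ :=
  (Polynomial.derivative^[k - 1]
    ((Polynomial.X ^ 2 - 1 : Polynomial ℝ) ^ k)).roots.toFinset

/-- The Gauss-Lobatto weight of the node `s`: the integral of its Lagrange basis polynomial. -/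
def lobattoWeight (k : ℕ) (s : ℝ) : ℝ :=
  ∫ t in (-1 : ℝ)..1, (Lagrange.basis (lobattoNodes k) id s).eval t

/-- The `(k+1) × (k+1)` Gauss-Lobatto approximation of `∬_e F`. -/
def cellQuadrature (k : ℕ) {N : ℕ} (e : Fin N × Fin N) (F : ℝ × ℝ → ℝ) : ℝ :=
  meshSize N ^ 2 * ∑ s ∈ lobattoNodes k, ∑ t ∈ lobattoNodes k,
    lobattoWeight k s * lobattoWeight k t * F (cellCenter e + meshSize N • (s, t))

/-- The gradient of the restriction of `v` to the closed cell `e`; it is one-sided at the boundary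
of `e`, where the gradients from two adjacent cells may differ. -/
def cellGrad {N : ℕ} (e : Fin N × Fin N) (v : ℝ × ℝ → ℝ) (p : ℝ × ℝ) : Fin 2 → ℝ :=
  ![fderivWithin ℝ v (meshCell e) p (1, 0), fderivWithin ℝ v (meshCell e) p (0, 1)]

/-- The bilinear form `A_h(u,v)`, in which the integral over every cell is replaced by
`(k+1) × (k+1)` Gauss-Lobatto quadrature. -/
def EllipticCoeffs.discreteForm (κ : EllipticCoeffs) (k N : ℕ) (u v : ℝ × ℝ → ℝ) : ℝ :=
  ∑ e : Fin N × Fin N, cellQuadrature k e fun p =>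
    κ.integrand p (u p) (v p) (cellGrad e u p) (cellGrad e v p)

/-- The adjoint discrete form `A_h*(u,v) = A_h(v,u)`. -/
def EllipticCoeffs.discreteAdjointForm (κ : EllipticCoeffs) (k N : ℕ) (u v : ℝ × ℝ → ℝ) : ℝ :=
  κ.discreteForm k N v u

/-- `V^h`-ellipticity of `A_h`, with a constant that does not depend on the mesh. -/
def EllipticCoeffs.VhElliptic (κ : EllipticCoeffs) (k : ℕ) : Prop :=
  ∃ C > 0, ∀ N : ℕ, 1 ≤ N → ∀ v, MemVh0 k N v →
    C * sobolevNorm unitSquare 1 v ^ 2 ≤ κ.discreteForm k N v v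

/-- `w_h ∈ V₀^h` solves `A_h*(w_h,v_h) = (θ,v_h)` for all `v_h ∈ V₀^h`. -/
def EllipticCoeffs.IsDiscreteDualSolution (κ : EllipticCoeffs) (k N : ℕ)
    (θ wh : ℝ × ℝ → ℝ) : Prop :=
  MemVh0 k N wh ∧
    ∀ vh, MemVh0 k N vh →
      κ.discreteAdjointForm k N wh vh = ∫ p in unitSquare, θ p * vh p

end

/-!
Write `A` for the bilinear form, `A_h` for its version with quadrature, `w` for the solution of the
dual problem and `w_h` for the discrete solution. The discrete solution is compared with an
interpolant `v_h` of `w`. For `χ = v_h - w_h` the `V^h`-ellipticity and the two dual problems,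
which give `A_h(χ, w_h) = (θ_h, χ) = A(χ, w)`, yield

`C₁ ‖χ‖₁² ≤ A_h(χ, χ) = (A_h(χ, v_h) - A(χ, v_h)) - A(χ, w - v_h)`.

Each of the two terms on the right is of order `h ‖w‖₂ ‖χ‖₁`: the first one by the consistency of
the quadrature (`EllipticCoeffs.exists_consistency_bound`), the second one by the boundedness of
`A` (`EllipticCoeffs.exists_form_bound`) and the interpolation estimate (`exists_interpolant`).
This is the first assertion. For the second one, an inverse inequality (`exists_brokenNorm_le`)
turns `‖χ‖₁ ≤ C h ‖w‖₂` into a bound of the broken `H²` norm of `χ`, hence of `w_h`, by `‖w‖₂`, and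
elliptic regularity bounds `‖w‖₂` by `‖θ_h‖₀`.

*Quadrature.* All terms of the bilinear form have the shape `∬ a r s` on a cell, with a coefficient
`a` and polynomials `r`, `s` of class `Q^k`. The quadrature is interpolatory and hence exact on
`Q^k`; this needs that there are `k + 1` Gauss-Lobatto nodes (`card_lobattoNodes`, by Rolle's
theorem), and the stability of the quadrature that they lie in `[-1,1]`
(`abs_le_one_of_mem_lobattoNodes`, by the Gauss-Lucas theorem). So the error does not change if the
constant `a(c) r(c)`, with `c` the center of the cell, is subtracted from `a r`, and what remains
is of order `h` by the Lipschitz continuity of `a` (`IsW2Infty.exists_bound`) and the mean value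
inequality for `r`; see `exists_quadrature_error_bound`. Here `r` comes from `v_h`, so that its
derivatives are controlled by the broken `H²` norm.

*Interpolation.* A function in `H²` has no point values without an embedding theorem. These are
avoided with an integral representation: for `w ∈ H² ∩ H₀¹` the derivative `w_x` is the primitive
of `w_xy` in the direction of `y`, and `w_y` the one in the direction of `x`, because `w_x` and
`w_y` vanish on the horizontal and on the vertical sides, respectively
(`MemH10.weakDeriv_eq_prim`). The interpolant is the primitive in both variables of the cell
averages of `w_xy` (`bilinearInterpolant`). It is continuous, bilinear on each cell and zero on the
boundary, and the errors of its derivatives are bounded on each cell by `w_xx`, `w_xy` and `w_yy`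
(`integral_sub_interpolant_sq_le`). The Poincaré inequality (`MemH10.integral_sq_le`) bounds the
error itself.

*Conformity.* Discrete functions have to be admissible in the dual problem, i.e. they must be
limits of test functions in the `H¹` norm; these are obtained by extension by zero, dilation and
mollification (`MemVh0.memH10`).
-/

/-! ### Weak derivatives -/

section WeakDerivatives

variable {U : Set (ℝ × ℝ)}

lemma partialX_contDiff {f : ℝ × ℝ → ℝ} (hf : ContDiff ℝ ∞ f) : ContDiff ℝ ∞ (partialX f) :=
  (hf.fderiv_right (m := ∞) (by simp)).clm_apply contDiff_const

lemma partialY_contDiff {f : ℝ × ℝ → ℝ} (hf : ContDiff ℝ ∞ f) : ContDiff ℝ ∞ (partialY f) :=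
  (hf.fderiv_right (m := ∞) (by simp)).clm_apply contDiff_const

lemma tsupport_partialX_subset (f : ℝ × ℝ → ℝ) : tsupport (partialX f) ⊆ tsupport f :=
  tsupport_fderiv_apply_subset ℝ (1, 0)

lemma tsupport_partialY_subset (f : ℝ × ℝ → ℝ) : tsupport (partialY f) ⊆ tsupport f :=
  tsupport_fderiv_apply_subset ℝ (0, 1)

lemma IsTestFunction.partialX {φ : ℝ × ℝ → ℝ} (h : IsTestFunction U φ) :
    IsTestFunction U (partialX φ) :=
  ⟨partialX_contDiff h.1, h.2.1.of_isClosed_subset (isClosed_tsupport _)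
    (tsupport_partialX_subset φ), (tsupport_partialX_subset φ).trans h.2.2⟩

lemma IsTestFunction.partialY {φ : ℝ × ℝ → ℝ} (h : IsTestFunction U φ) :
    IsTestFunction U (partialY φ) :=
  ⟨partialY_contDiff h.1, h.2.1.of_isClosed_subset (isClosed_tsupport _)
    (tsupport_partialY_subset φ), (tsupport_partialY_subset φ).trans h.2.2⟩

lemma IsTestFunction.iterate_partial {φ : ℝ × ℝ → ℝ} (h : IsTestFunction U φ) (i j : ℕ) :
    IsTestFunction U (_root_.partialX^[i] (_root_.partialY^[j] φ)) := by
  have h1 : IsTestFunction U (_root_.partialY^[j] φ) := by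
    induction j with
    | zero => exact h
    | succ n ih => rw [Function.iterate_succ_apply']; exact ih.partialY
  induction i with
  | zero => exact h1
  | succ n ih => rw [Function.iterate_succ_apply']; exact ih.partialX

lemma IsTestFunction.continuous {φ : ℝ × ℝ → ℝ} (h : IsTestFunction U φ) : Continuous φ :=
  h.1.continuous

lemma integrableOn_mul_testFunction {u φ : ℝ × ℝ → ℝ} (hu : LocallyIntegrableOn u U)
    (hφ : IsTestFunction U φ) : IntegrableOn (fun p => u p * φ p) U := by
  have hK : IsCompact (tsupport φ) := hφ.2.1
  have h1 : IntegrableOn u (tsupport φ) := hu.integrableOn_compact_subset hφ.2.2 hK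
  have h2 : IntegrableOn (fun p => u p * φ p) (tsupport φ) :=
    h1.mul_continuousOn hφ.continuous.continuousOn hK
  have h3 : Integrable (fun p => u p * φ p) := by
    rw [← integrableOn_iff_integrable_of_support_subset (s := tsupport φ)]
    · exact h2
    · intro p hp
      by_contra hc
      exact hp (by simp [image_eq_zero_of_notMem_tsupport hc])
  exact h3.integrableOn

/-- Weak derivatives are unique almost everywhere. -/
lemma IsWeakDeriv.ae_eq (hU : IsOpen U) {i j : ℕ} {u g g' : ℝ × ℝ → ℝ}
    (h : IsWeakDeriv U i j u g) (h' : IsWeakDeriv U i j u g') :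
    g =ᵐ[volume.restrict U] g' := by
  have key : ∀ᵐ x, x ∈ U → (g - g') x = 0 := by
    refine hU.ae_eq_zero_of_integral_contDiff_smul_eq_zero (h.2.1.sub h'.2.1) ?_
    intro φ h1 h2 h3
    have hφ : IsTestFunction U φ := ⟨h1, h2, h3⟩
    have e1 : ∫ p, φ p • (g - g') p = ∫ p in U, φ p • (g - g') p := by
      symm
      apply setIntegral_eq_integral_of_forall_compl_eq_zero
      intro p hp
      have : p ∉ tsupport φ := fun hc => hp (h3 hc)
      simp [image_eq_zero_of_notMem_tsupport this]
    have e2 : ∫ p in U, φ p • (g - g') p = (∫ p in U, g p * φ p) - ∫ p in U, g' p * φ p := by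
      rw [← integral_sub (integrableOn_mul_testFunction h.2.1 hφ)
        (integrableOn_mul_testFunction h'.2.1 hφ)]
      congr 1; ext p; simp; ring
    have e3 := (h.2.2 φ hφ).symm.trans (h'.2.2 φ hφ)
    have e4 : ((-1 : ℝ) ^ (i + j)) ≠ 0 := by positivity
    rw [e1, e2, mul_left_cancel₀ e4 e3, sub_self]
  rw [Filter.EventuallyEq, ae_restrict_iff' hU.measurableSet]
  filter_upwards [key] with x hx hxU
  exact sub_eq_zero.1 (hx hxU)

lemma IsWeakDeriv.weakDeriv_spec {i j : ℕ} {u g : ℝ × ℝ → ℝ} (h : IsWeakDeriv U i j u g) :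
    IsWeakDeriv U i j u (weakDeriv U i j u) := by
  have H : ∃ g, IsWeakDeriv U i j u g := ⟨g, h⟩
  rw [weakDeriv, dif_pos H]
  exact H.choose_spec

lemma IsWeakDeriv.weakDeriv_ae_eq (hU : IsOpen U) {i j : ℕ} {u g : ℝ × ℝ → ℝ}
    (h : IsWeakDeriv U i j u g) : weakDeriv U i j u =ᵐ[volume.restrict U] g :=
  h.weakDeriv_spec.ae_eq hU h

lemma MemSobolev.isWeakDeriv {m : ℕ} {p : ℝ≥0∞} {u : ℝ × ℝ → ℝ} (h : MemSobolev U m p u)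
    {i j : ℕ} (hij : i + j ≤ m) : IsWeakDeriv U i j u (weakDeriv U i j u) := by
  obtain ⟨g, hg, -⟩ := h i j hij
  exact hg.weakDeriv_spec

lemma MemSobolev.memLp_weakDeriv (hU : IsOpen U) {m : ℕ} {p : ℝ≥0∞} {u : ℝ × ℝ → ℝ}
    (h : MemSobolev U m p u) {i j : ℕ} (hij : i + j ≤ m) :
    MemLp (weakDeriv U i j u) p (volume.restrict U) := by
  obtain ⟨g, hg, hgp⟩ := h i j hij
  exact hgp.ae_eq (hg.weakDeriv_ae_eq hU).symm

lemma isWeakDeriv_zero_zero {u : ℝ × ℝ → ℝ} (hu : LocallyIntegrableOn u U) :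
    IsWeakDeriv U 0 0 u u := ⟨hu, hu, fun φ _ => by simp⟩

lemma MemSobolev.locallyIntegrableOn {m : ℕ} {p : ℝ≥0∞} {u : ℝ × ℝ → ℝ}
    (h : MemSobolev U m p u) : LocallyIntegrableOn u U := by
  obtain ⟨g, hg, -⟩ := h 0 0 (by simp)
  exact hg.1

lemma MemSobolev.memLp (hU : IsOpen U) {m : ℕ} {p : ℝ≥0∞} {u : ℝ × ℝ → ℝ}
    (h : MemSobolev U m p u) : MemLp u p (volume.restrict U) :=
  (h.memLp_weakDeriv hU (i := 0) (j := 0) (by simp)).ae_eq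
    ((isWeakDeriv_zero_zero h.locallyIntegrableOn).weakDeriv_ae_eq hU)

lemma IsWeakDeriv.sub {i j : ℕ} {u v g g' : ℝ × ℝ → ℝ}
    (h : IsWeakDeriv U i j u g) (h' : IsWeakDeriv U i j v g') :
    IsWeakDeriv U i j (u - v) (g - g') := by
  refine ⟨h.1.sub h'.1, h.2.1.sub h'.2.1, fun φ hφ => ?_⟩
  have hψ := hφ.iterate_partial i j
  simp only [Pi.sub_apply, sub_mul]
  rw [integral_sub (integrableOn_mul_testFunction h.1 hψ) (integrableOn_mul_testFunction h'.1 hψ),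
    integral_sub (integrableOn_mul_testFunction h.2.1 hφ)
      (integrableOn_mul_testFunction h'.2.1 hφ), h.2.2 φ hφ, h'.2.2 φ hφ, mul_sub]

/-- Weak derivatives depend only on the classes modulo equality almost everywhere. -/
lemma IsWeakDeriv.congr {i j : ℕ} {u v g g' : ℝ × ℝ → ℝ}
    (h : IsWeakDeriv U i j u g) (huv : u =ᵐ[volume.restrict U] v)
    (hg : g =ᵐ[volume.restrict U] g') : IsWeakDeriv U i j v g' := by
  have loc : ∀ {f f' : ℝ × ℝ → ℝ}, LocallyIntegrableOn f U → f =ᵐ[volume.restrict U] f' →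
      LocallyIntegrableOn f' U := by
    intro f f' hf hff p hp
    obtain ⟨s, hs, hi⟩ := hf p hp
    refine ⟨s ∩ U, Filter.inter_mem hs self_mem_nhdsWithin, ?_⟩
    refine (hi.mono_set Set.inter_subset_left).congr ?_
    exact ae_mono (Measure.restrict_mono Set.inter_subset_right le_rfl) hff
  refine ⟨loc h.1 huv, loc h.2.1 hg, fun φ hφ => ?_⟩
  have e1 : ∫ p in U, v p * partialX^[i] (partialY^[j] φ) p
      = ∫ p in U, u p * partialX^[i] (partialY^[j] φ) p := by
    refine integral_congr_ae ?_
    filter_upwards [huv] with p hp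
    rw [hp]
  have e2 : ∫ p in U, g' p * φ p = ∫ p in U, g p * φ p := by
    refine integral_congr_ae ?_
    filter_upwards [hg] with p hp
    rw [hp]
  rw [e1, e2, h.2.2 φ hφ]

/-- The weak derivative `∂ₓ` of the weak derivative `∂ₓⁱ∂ᵧʲ u` is `∂ₓⁱ⁺¹∂ᵧʲ u`. The hypothesis
`hcomm` says that the new `∂ₓ` may be moved past `∂ᵧʲ` on test functions. -/
lemma IsWeakDeriv.weak_partialX {i j : ℕ} {u g g' : ℝ × ℝ → ℝ} (h : IsWeakDeriv U i j u g)
    (h' : IsWeakDeriv U (i + 1) j u g') (hcomm : ∀ φ : ℝ × ℝ → ℝ, IsTestFunction U φ →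
      partialX^[i] (partialY^[j] (partialX φ)) = partialX^[i + 1] (partialY^[j] φ)) :
    IsWeakDeriv U 1 0 g g' := by
  refine ⟨h.2.1, h'.2.1, fun φ hφ => ?_⟩
  have h1 := h.2.2 _ hφ.partialX
  have h2 := h'.2.2 φ hφ
  rw [hcomm φ hφ, h2] at h1
  simp only [Function.iterate_one, Function.iterate_zero, id]
  have e : ((-1 : ℝ) ^ (i + j)) ≠ 0 := by positivity
  apply mul_left_cancel₀ e
  rw [← h1]; ring

lemma IsWeakDeriv.weak_partialY {i j : ℕ} {u g g' : ℝ × ℝ → ℝ} (h : IsWeakDeriv U i j u g)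
    (h' : IsWeakDeriv U i (j + 1) u g') : IsWeakDeriv U 0 1 g g' := by
  refine ⟨h.2.1, h'.2.1, fun φ hφ => ?_⟩
  have h1 := h.2.2 _ hφ.partialY
  have h2 := h'.2.2 φ hφ
  rw [← Function.iterate_succ_apply, h2] at h1
  simp only [Function.iterate_one, Function.iterate_zero, id]
  have e : ((-1 : ℝ) ^ (i + j)) ≠ 0 := by positivity
  apply mul_left_cancel₀ e
  rw [← h1]; ring

lemma partialX_partialY_comm {f : ℝ × ℝ → ℝ} (hf : ContDiff ℝ ∞ f) :
    partialY (partialX f) = partialX (partialY f) := by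
  ext p
  have hd : DifferentiableAt ℝ (fderiv ℝ f) p :=
    (hf.fderiv_right (m := ∞) (by simp)).differentiable (by simp) p
  have hs : IsSymmSndFDerivAt ℝ f p := hf.contDiffAt.isSymmSndFDerivAt
    (by simpa using WithTop.coe_le_coe.2 (le_top : (2 : ℕ∞) ≤ ⊤))
  unfold partialX partialY
  rw [fderiv_clm_apply hd (differentiableAt_const _),
    fderiv_clm_apply hd (differentiableAt_const _)]
  simp [hs.eq]

end WeakDerivatives

/-! ### Weak derivatives of smooth functions -/

section ClassicalDerivatives

variable {U : Set (ℝ × ℝ)}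

lemma setIntegral_eq_integral_of_tsupport_subset {φ f : ℝ × ℝ → ℝ} (h : tsupport φ ⊆ U) :
    ∫ p in U, f p * φ p = ∫ p, f p * φ p := by
  apply setIntegral_eq_integral_of_forall_compl_eq_zero
  intro p hp
  have : p ∉ tsupport φ := fun hc => hp (h hc)
  simp [image_eq_zero_of_notMem_tsupport this]

lemma integral_mul_partialX {f φ : ℝ × ℝ → ℝ} (hf : ContDiff ℝ ∞ f) (hφ : IsTestFunction U φ) :
    ∫ p in U, f p * partialX φ p = - ∫ p in U, partialX f p * φ p := by
  rw [setIntegral_eq_integral_of_tsupport_subset hφ.2.2,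
    setIntegral_eq_integral_of_tsupport_subset hφ.partialX.2.2]
  refine integral_mul_fderiv_eq_neg_fderiv_mul_of_integrable ?_ ?_ ?_ ?_ ?_
  · exact ((partialX_contDiff hf).continuous.mul hφ.continuous).integrable_of_hasCompactSupport
      hφ.2.1.mul_left
  · exact (hf.continuous.mul hφ.partialX.continuous).integrable_of_hasCompactSupport
      hφ.partialX.2.1.mul_left
  · exact (hf.continuous.mul hφ.continuous).integrable_of_hasCompactSupport hφ.2.1.mul_left
  · exact fun x _ => hf.differentiable (by simp) x
  · exact fun x _ => hφ.1.differentiable (by simp) x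

lemma integral_mul_partialY {f φ : ℝ × ℝ → ℝ} (hf : ContDiff ℝ ∞ f) (hφ : IsTestFunction U φ) :
    ∫ p in U, f p * partialY φ p = - ∫ p in U, partialY f p * φ p := by
  rw [setIntegral_eq_integral_of_tsupport_subset hφ.2.2,
    setIntegral_eq_integral_of_tsupport_subset hφ.partialY.2.2]
  refine integral_mul_fderiv_eq_neg_fderiv_mul_of_integrable ?_ ?_ ?_ ?_ ?_
  · exact ((partialY_contDiff hf).continuous.mul hφ.continuous).integrable_of_hasCompactSupport
      hφ.2.1.mul_left
  · exact (hf.continuous.mul hφ.partialY.continuous).integrable_of_hasCompactSupport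
      hφ.partialY.2.1.mul_left
  · exact (hf.continuous.mul hφ.continuous).integrable_of_hasCompactSupport hφ.2.1.mul_left
  · exact fun x _ => hf.differentiable (by simp) x
  · exact fun x _ => hφ.1.differentiable (by simp) x

lemma partialX_iterate_contDiff {f : ℝ × ℝ → ℝ} (hf : ContDiff ℝ ∞ f) (i : ℕ) :
    ContDiff ℝ ∞ (partialX^[i] f) := by
  induction i with
  | zero => exact hf
  | succ n ih => rw [Function.iterate_succ_apply']; exact partialX_contDiff ih

lemma partialY_iterate_contDiff {f : ℝ × ℝ → ℝ} (hf : ContDiff ℝ ∞ f) (i : ℕ) :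
    ContDiff ℝ ∞ (partialY^[i] f) := by
  induction i with
  | zero => exact hf
  | succ n ih => rw [Function.iterate_succ_apply']; exact partialY_contDiff ih

lemma integral_mul_partialX_iterate {f φ : ℝ × ℝ → ℝ} (hf : ContDiff ℝ ∞ f)
    (hφ : IsTestFunction U φ) (i : ℕ) :
    ∫ p in U, f p * partialX^[i] φ p = (-1) ^ i * ∫ p in U, partialX^[i] f p * φ p := by
  induction i generalizing f with
  | zero => simp
  | succ n ih =>
    rw [Function.iterate_succ_apply',
      integral_mul_partialX hf (by simpa using hφ.iterate_partial n 0),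
      ih (partialX_contDiff hf), ← Function.iterate_succ_apply, pow_succ]
    ring

lemma integral_mul_partialY_iterate {f φ : ℝ × ℝ → ℝ} (hf : ContDiff ℝ ∞ f)
    (hφ : IsTestFunction U φ) (i : ℕ) :
    ∫ p in U, f p * partialY^[i] φ p = (-1) ^ i * ∫ p in U, partialY^[i] f p * φ p := by
  induction i generalizing f with
  | zero => simp
  | succ n ih =>
    rw [Function.iterate_succ_apply',
      integral_mul_partialY hf (by simpa using hφ.iterate_partial 0 n),
      ih (partialY_contDiff hf), ← Function.iterate_succ_apply, pow_succ]
    ring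

/-- For smooth functions, the weak derivatives are the classical ones. -/
lemma ContDiff.isWeakDeriv {f : ℝ × ℝ → ℝ} (hf : ContDiff ℝ ∞ f) (i j : ℕ) :
    IsWeakDeriv U i j f (partialY^[j] (partialX^[i] f)) := by
  have hc := (partialY_iterate_contDiff (partialX_iterate_contDiff hf i) j).continuous
  refine ⟨hf.continuous.locallyIntegrable.locallyIntegrableOn U,
    hc.locallyIntegrable.locallyIntegrableOn U, fun φ hφ => ?_⟩
  rw [integral_mul_partialX_iterate hf (by simpa using hφ.iterate_partial 0 j),
    integral_mul_partialY_iterate (partialX_iterate_contDiff hf i) hφ, pow_add, mul_assoc]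

end ClassicalDerivatives

/-! ### Sobolev norms -/

section Norms

variable {U : Set (ℝ × ℝ)}

lemma sobolevNorm_nonneg (m : ℕ) (u : ℝ × ℝ → ℝ) : 0 ≤ sobolevNorm U m u := Real.sqrt_nonneg _

lemma sobolevNorm_sq (m : ℕ) (u : ℝ × ℝ → ℝ) : sobolevNorm U m u ^ 2 =
    ∑ r ∈ Finset.range (m + 1), ∑ ij ∈ Finset.HasAntidiagonal.antidiagonal r,
      ∫ p in U, (weakDeriv U ij.1 ij.2 u p) ^ 2 := by
  rw [sobolevNorm, Real.sq_sqrt]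
  exact Finset.sum_nonneg fun _ _ => Finset.sum_nonneg fun _ _ =>
    integral_nonneg fun _ => sq_nonneg _

lemma integral_weakDeriv_sq (hU : IsOpen U) {i j : ℕ} {u g : ℝ × ℝ → ℝ}
    (h : IsWeakDeriv U i j u g) : ∫ p in U, weakDeriv U i j u p ^ 2 = ∫ p in U, g p ^ 2 := by
  refine integral_congr_ae ?_
  filter_upwards [h.weakDeriv_ae_eq hU] with p hp
  rw [hp]

lemma sobolevNorm_one_sq (hU : IsOpen U) {u ux uy : ℝ × ℝ → ℝ}
    (hx : IsWeakDeriv U 1 0 u ux) (hy : IsWeakDeriv U 0 1 u uy) :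
    sobolevNorm U 1 u ^ 2 =
      (∫ p in U, u p ^ 2) + (∫ p in U, ux p ^ 2) + ∫ p in U, uy p ^ 2 := by
  rw [sobolevNorm_sq, ← integral_weakDeriv_sq hU (isWeakDeriv_zero_zero hx.1),
    ← integral_weakDeriv_sq hU hx, ← integral_weakDeriv_sq hU hy]
  simp [Finset.sum_range_succ, Finset.Nat.antidiagonal_succ]
  ring

lemma sobolevNorm_two_sq (hU : IsOpen U) {u ux uy uxx uxy uyy : ℝ × ℝ → ℝ}
    (hx : IsWeakDeriv U 1 0 u ux) (hy : IsWeakDeriv U 0 1 u uy)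
    (hxx : IsWeakDeriv U 2 0 u uxx) (hxy : IsWeakDeriv U 1 1 u uxy)
    (hyy : IsWeakDeriv U 0 2 u uyy) :
    sobolevNorm U 2 u ^ 2 =
      (∫ p in U, u p ^ 2) + (∫ p in U, ux p ^ 2) + (∫ p in U, uy p ^ 2) +
        (∫ p in U, uxx p ^ 2) + (∫ p in U, uxy p ^ 2) + ∫ p in U, uyy p ^ 2 := by
  rw [sobolevNorm_sq, ← integral_weakDeriv_sq hU (isWeakDeriv_zero_zero hx.1),
    ← integral_weakDeriv_sq hU hx, ← integral_weakDeriv_sq hU hy, ← integral_weakDeriv_sq hU hxx,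
    ← integral_weakDeriv_sq hU hxy, ← integral_weakDeriv_sq hU hyy]
  simp [Finset.sum_range_succ, Finset.Nat.antidiagonal_succ]
  ring

end Norms

/-! ### Tensor product polynomials -/

section TensorPolynomials

/-- The function `∑_{i,j ≤ k} q i j xⁱ yʲ` of tensor product degree at most `k`. -/
def tensorPoly (k : ℕ) (q : ℕ → ℕ → ℝ) (p : ℝ × ℝ) : ℝ :=
  ∑ i ∈ Finset.range (k + 1), ∑ j ∈ Finset.range (k + 1), q i j * p.1 ^ i * p.2 ^ j

/-- `f` is a polynomial function on the plane of degree at most `k` in each variable. -/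
def IsTensorPoly (k : ℕ) (f : ℝ × ℝ → ℝ) : Prop := ∃ q, f = tensorPoly k q

variable {k : ℕ} {f g : ℝ × ℝ → ℝ}

lemma IsTensorPoly.add (hf : IsTensorPoly k f) (hg : IsTensorPoly k g) :
    IsTensorPoly k (f + g) := by
  obtain ⟨q, rfl⟩ := hf
  obtain ⟨r, rfl⟩ := hg
  refine ⟨q + r, ?_⟩
  ext p
  simp [tensorPoly, add_mul, Finset.sum_add_distrib]

lemma IsTensorPoly.const_smul (hf : IsTensorPoly k f) (a : ℝ) : IsTensorPoly k (a • f) := by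
  obtain ⟨q, rfl⟩ := hf
  refine ⟨a • q, ?_⟩
  ext p
  simp [tensorPoly, Finset.mul_sum, mul_assoc]

lemma IsTensorPoly.sub (hf : IsTensorPoly k f) (hg : IsTensorPoly k g) :
    IsTensorPoly k (f - g) := by
  simpa [sub_eq_add_neg] using hf.add (hg.const_smul (-1))

lemma isTensorPoly_zero : IsTensorPoly k 0 := ⟨0, by ext p; simp [tensorPoly]⟩

lemma IsTensorPoly.sum {ι : Type*} {s : Finset ι} {F : ι → ℝ × ℝ → ℝ}
    (h : ∀ i ∈ s, IsTensorPoly k (F i)) : IsTensorPoly k (∑ i ∈ s, F i) := by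
  classical
  induction s using Finset.induction_on with
  | empty => simpa using isTensorPoly_zero
  | insert a s ha ih =>
    rw [Finset.sum_insert ha]
    exact (h a (by simp)).add (ih fun i hi => h i (by simp [hi]))

open Polynomial in
lemma isTensorPoly_eval_mul_eval {P R : ℝ[X]} (hP : P.natDegree ≤ k) (hR : R.natDegree ≤ k) :
    IsTensorPoly k fun p => P.eval p.1 * R.eval p.2 := by
  refine ⟨fun i j => P.coeff i * R.coeff j, ?_⟩
  ext p
  rw [tensorPoly, Polynomial.eval_eq_sum_range' (Nat.lt_succ_of_le hP),
    Polynomial.eval_eq_sum_range' (Nat.lt_succ_of_le hR), Finset.sum_mul_sum]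
  refine Finset.sum_congr rfl fun i _ => Finset.sum_congr rfl fun j _ => by ring

open Polynomial in
/-- Tensor product polynomials are sums of products of polynomials in one variable. -/
lemma IsTensorPoly.induction {C : (ℝ × ℝ → ℝ) → Prop} (hf : IsTensorPoly k f)
    (prod : ∀ P R : ℝ[X], P.natDegree ≤ k → R.natDegree ≤ k →
      C fun p => P.eval p.1 * R.eval p.2)
    (sum : ∀ (F : ℕ → ℝ × ℝ → ℝ), (∀ i ∈ Finset.range (k + 1), C (F i)) →
      C (∑ i ∈ Finset.range (k + 1), F i)) : C f := by
  obtain ⟨q, rfl⟩ := hf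
  have e : tensorPoly k q = ∑ i ∈ Finset.range (k + 1), fun p : ℝ × ℝ =>
      (X ^ i : ℝ[X]).eval p.1 *
        (∑ j ∈ Finset.range (k + 1), Polynomial.C (q i j) * X ^ j : ℝ[X]).eval p.2 := by
    ext p
    simp only [tensorPoly, Finset.sum_apply, eval_pow, eval_X, eval_finsetSum, eval_mul, eval_C,
      Finset.mul_sum]
    refine Finset.sum_congr rfl fun i _ => Finset.sum_congr rfl fun j _ => by ring
  rw [e]
  refine sum _ fun i hi => prod _ _ ?_ ?_
  · rw [natDegree_X_pow]; exact Nat.lt_succ_iff.1 (Finset.mem_range.1 hi)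
  · refine natDegree_sum_le_of_forall_le _ _ fun j hj => ?_
    exact (natDegree_C_mul_X_pow_le _ _).trans (Nat.lt_succ_iff.1 (Finset.mem_range.1 hj))

lemma tensorPoly_contDiff (q : ℕ → ℕ → ℝ) : ContDiff ℝ ∞ (tensorPoly k q) := by
  unfold tensorPoly
  fun_prop

lemma IsTensorPoly.contDiff (hf : IsTensorPoly k f) : ContDiff ℝ ∞ f := by
  obtain ⟨q, rfl⟩ := hf
  exact tensorPoly_contDiff q

lemma IsTensorPoly.continuous (hf : IsTensorPoly k f) : Continuous f := hf.contDiff.continuous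

open Polynomial in
lemma IsTensorPoly.comp_affine (hf : IsTensorPoly k f) (c : ℝ × ℝ) (h : ℝ) :
    IsTensorPoly k fun ξ => f (c + h • ξ) := by
  refine hf.induction (C := fun f => IsTensorPoly k fun ξ => f (c + h • ξ)) ?_ ?_
  · intro P R hP hR
    have hd : ∀ (Q : ℝ[X]) (a : ℝ), Q.natDegree ≤ k →
        (Q.comp (Polynomial.C h * X + Polynomial.C a)).natDegree ≤ k := by
      intro Q a hQ
      refine natDegree_comp_le.trans ?_
      have := natDegree_linear_le (a := h) (b := a)
      nlinarith
    have := isTensorPoly_eval_mul_eval (hd P c.1 hP) (hd R c.2 hR)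
    simpa [add_comm] using this
  · intro F hF
    have e : (fun ξ => (∑ i ∈ Finset.range (k + 1), F i) (c + h • ξ)) =
      ∑ i ∈ Finset.range (k + 1), fun ξ => F i (c + h • ξ) := by ext ξ; simp
    rw [e]
    exact IsTensorPoly.sum hF

open Polynomial in
lemma partialX_eval_mul_eval (P R : ℝ[X]) :
    partialX (fun p => P.eval p.1 * R.eval p.2) = fun p => P.derivative.eval p.1 * R.eval p.2 := by
  ext p
  have h1 : HasFDerivAt (fun p : ℝ × ℝ => P.eval p.1)
      ((P.derivative.eval p.1) • ContinuousLinearMap.fst ℝ ℝ ℝ) p :=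
    (P.hasDerivAt p.1).comp_hasFDerivAt p hasFDerivAt_fst
  have h2 : HasFDerivAt (fun p : ℝ × ℝ => R.eval p.2)
      ((R.derivative.eval p.2) • ContinuousLinearMap.snd ℝ ℝ ℝ) p :=
    (R.hasDerivAt p.2).comp_hasFDerivAt p hasFDerivAt_snd
  have h3 : HasFDerivAt (fun p : ℝ × ℝ => P.eval p.1 * R.eval p.2) _ p := h1.mul h2
  rw [partialX, h3.fderiv]
  simp [mul_comm]

open Polynomial in
lemma partialY_eval_mul_eval (P R : ℝ[X]) :
    partialY (fun p => P.eval p.1 * R.eval p.2) = fun p => P.eval p.1 * R.derivative.eval p.2 := by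
  ext p
  have h1 : HasFDerivAt (fun p : ℝ × ℝ => P.eval p.1)
      ((P.derivative.eval p.1) • ContinuousLinearMap.fst ℝ ℝ ℝ) p :=
    (P.hasDerivAt p.1).comp_hasFDerivAt p hasFDerivAt_fst
  have h2 : HasFDerivAt (fun p : ℝ × ℝ => R.eval p.2)
      ((R.derivative.eval p.2) • ContinuousLinearMap.snd ℝ ℝ ℝ) p :=
    (R.hasDerivAt p.2).comp_hasFDerivAt p hasFDerivAt_snd
  have h3 : HasFDerivAt (fun p : ℝ × ℝ => P.eval p.1 * R.eval p.2) _ p := h1.mul h2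
  rw [partialY, h3.fderiv]
  simp

lemma partialX_sub {f g : ℝ × ℝ → ℝ} (hf : ContDiff ℝ ∞ f) (hg : ContDiff ℝ ∞ g) :
    partialX (f - g) = partialX f - partialX g := by
  ext p
  simp [partialX, fderiv_sub (hf.differentiable (by simp) p) (hg.differentiable (by simp) p)]

lemma partialY_sub {f g : ℝ × ℝ → ℝ} (hf : ContDiff ℝ ∞ f) (hg : ContDiff ℝ ∞ g) :
    partialY (f - g) = partialY f - partialY g := by
  ext p
  simp [partialY, fderiv_sub (hf.differentiable (by simp) p) (hg.differentiable (by simp) p)]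

lemma partialX_sum {ι : Type*} (s : Finset ι) {F : ι → ℝ × ℝ → ℝ}
    (hF : ∀ i ∈ s, ContDiff ℝ ∞ (F i)) : partialX (∑ i ∈ s, F i) = ∑ i ∈ s, partialX (F i) := by
  ext p
  simp [partialX, fderiv_sum fun i hi => (hF i hi).differentiable (by simp) p]

lemma partialY_sum {ι : Type*} (s : Finset ι) {F : ι → ℝ × ℝ → ℝ}
    (hF : ∀ i ∈ s, ContDiff ℝ ∞ (F i)) : partialY (∑ i ∈ s, F i) = ∑ i ∈ s, partialY (F i) := by
  ext p
  simp [partialY, fderiv_sum fun i hi => (hF i hi).differentiable (by simp) p]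

open Polynomial in
lemma IsTensorPoly.partialX (hf : IsTensorPoly k f) : IsTensorPoly k (partialX f) := by
  refine (hf.induction (C := fun f => IsTensorPoly k f ∧ IsTensorPoly k (_root_.partialX f))
    ?_ ?_).2
  · intro P R hP hR
    refine ⟨isTensorPoly_eval_mul_eval hP hR, ?_⟩
    rw [partialX_eval_mul_eval]
    exact isTensorPoly_eval_mul_eval ((natDegree_derivative_le P).trans (by omega)) hR
  · intro F hF
    refine ⟨IsTensorPoly.sum fun i hi => (hF i hi).1, ?_⟩
    rw [partialX_sum _ fun i hi => (hF i hi).1.contDiff]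
    exact IsTensorPoly.sum fun i hi => (hF i hi).2

open Polynomial in
lemma IsTensorPoly.partialY (hf : IsTensorPoly k f) : IsTensorPoly k (partialY f) := by
  refine (hf.induction (C := fun f => IsTensorPoly k f ∧ IsTensorPoly k (_root_.partialY f))
    ?_ ?_).2
  · intro P R hP hR
    refine ⟨isTensorPoly_eval_mul_eval hP hR, ?_⟩
    rw [partialY_eval_mul_eval]
    exact isTensorPoly_eval_mul_eval hP ((natDegree_derivative_le R).trans (by omega))
  · intro F hF
    refine ⟨IsTensorPoly.sum fun i hi => (hF i hi).1, ?_⟩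
    rw [partialY_sum _ fun i hi => (hF i hi).1.contDiff]
    exact IsTensorPoly.sum fun i hi => (hF i hi).2

open Polynomial in
/-- A tensor product polynomial that vanishes on `(-1,1)²` has zero coefficients. -/
lemma tensorPoly_eq_zero {q : ℕ → ℕ → ℝ}
    (h : ∀ x ∈ Set.Ioo (-1 : ℝ) 1, ∀ y ∈ Set.Ioo (-1 : ℝ) 1, tensorPoly k q (x, y) = 0) :
    ∀ i < k + 1, ∀ j < k + 1, q i j = 0 := by
  have hinf : (Set.Ioo (-1 : ℝ) 1).Infinite := Set.Ioo_infinite (by norm_num)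
  have poly : ∀ a : ℕ → ℝ, (∀ t ∈ Set.Ioo (-1 : ℝ) 1, ∑ i ∈ Finset.range (k + 1), a i * t ^ i = 0) →
      ∀ i < k + 1, a i = 0 := by
    intro a ha i hi
    let P : ℝ[X] := ∑ i ∈ Finset.range (k + 1), Polynomial.C (a i) * X ^ i
    have hP : P = 0 := by
      refine eq_zero_of_infinite_isRoot P (hinf.mono fun t ht => ?_)
      simpa [P, IsRoot.def, eval_finsetSum] using ha t ht
    have := congrArg (fun Q => coeff Q i) hP
    simpa [P, coeff_C_mul, coeff_X_pow, Finset.sum_ite_eq, hi] using this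
  intro i hi j hj
  refine poly (q i) (fun y hy => ?_) j hj
  refine poly (fun i => ∑ j ∈ Finset.range (k + 1), q i j * y ^ j) (fun x hx => ?_) i hi
  rw [← h x hx y hy, tensorPoly]
  refine Finset.sum_congr rfl fun i _ => ?_
  rw [Finset.sum_mul]
  exact Finset.sum_congr rfl fun j _ => by ring

end TensorPolynomials

/-! ### Inverse inequalities on squares -/

section Squares

/-- The open square with center `c` and half width `h`. -/
def openSquare (c : ℝ × ℝ) (h : ℝ) : Set (ℝ × ℝ) :=
  Set.Ioo (c.1 - h) (c.1 + h) ×ˢ Set.Ioo (c.2 - h) (c.2 + h)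

/-- The closed square with center `c` and half width `h`. -/
def closedSquare (c : ℝ × ℝ) (h : ℝ) : Set (ℝ × ℝ) :=
  Set.Icc (c.1 - h) (c.1 + h) ×ˢ Set.Icc (c.2 - h) (c.2 + h)

lemma isOpen_openSquare (c : ℝ × ℝ) (h : ℝ) : IsOpen (openSquare c h) :=
  isOpen_Ioo.prod isOpen_Ioo

lemma isCompact_closedSquare (c : ℝ × ℝ) (h : ℝ) : IsCompact (closedSquare c h) :=
  isCompact_Icc.prod isCompact_Icc

lemma openSquare_subset_closedSquare (c : ℝ × ℝ) (h : ℝ) : openSquare c h ⊆ closedSquare c h :=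
  Set.prod_mono Set.Ioo_subset_Icc_self Set.Ioo_subset_Icc_self

lemma openSquare_ae_eq_closedSquare (c : ℝ × ℝ) (h : ℝ) :
    openSquare c h =ᵐ[volume] closedSquare c h :=
  Measure.set_prod_ae_eq Ioo_ae_eq_Icc Ioo_ae_eq_Icc

lemma volume_openSquare (c : ℝ × ℝ) {h : ℝ} (hh : 0 ≤ h) :
    volume.real (openSquare c h) = 4 * h ^ 2 := by
  rw [measureReal_def, openSquare, Measure.volume_eq_prod, Measure.prod_prod, Real.volume_Ioo,
    Real.volume_Ioo, ENNReal.toReal_mul, ENNReal.toReal_ofReal (by linarith),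
    ENNReal.toReal_ofReal (by linarith)]
  ring

lemma volume_openSquare_lt_top (c : ℝ × ℝ) (h : ℝ) : volume (openSquare c h) < ⊤ :=
  (measure_mono (openSquare_subset_closedSquare c h)).trans_lt
    (isCompact_closedSquare c h).measure_lt_top

lemma mem_closedSquare_add_smul {c ξ : ℝ × ℝ} {h : ℝ} (hh : 0 ≤ h)
    (h1 : |ξ.1| ≤ 1) (h2 : |ξ.2| ≤ 1) : c + h • ξ ∈ closedSquare c h := by
  rw [abs_le] at h1 h2
  simp only [closedSquare, Set.mem_prod, Set.mem_Icc, Prod.fst_add, Prod.snd_add, Prod.smul_fst,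
    Prod.smul_snd, smul_eq_mul]
  refine ⟨⟨?_, ?_⟩, ?_, ?_⟩ <;> nlinarith

lemma exists_eq_add_smul_of_mem_closedSquare {c p : ℝ × ℝ} {h : ℝ} (hh : 0 < h)
    (hp : p ∈ closedSquare c h) : ∃ ξ : ℝ × ℝ, |ξ.1| ≤ 1 ∧ |ξ.2| ≤ 1 ∧ p = c + h • ξ := by
  simp only [closedSquare, Set.mem_prod, Set.mem_Icc] at hp
  refine ⟨h⁻¹ • (p - c), ?_, ?_, ?_⟩
  · simp only [Prod.smul_fst, Prod.fst_sub, smul_eq_mul, abs_mul, abs_inv, abs_of_pos hh]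
    rw [inv_mul_le_one₀ hh, abs_le]
    constructor <;> linarith
  · simp only [Prod.smul_snd, Prod.snd_sub, smul_eq_mul, abs_mul, abs_inv, abs_of_pos hh]
    rw [inv_mul_le_one₀ hh, abs_le]
    constructor <;> linarith
  · rw [smul_inv_smul₀ hh.ne']; abel

lemma add_smul_mem_openSquare_iff {c ξ : ℝ × ℝ} {h : ℝ} (hh : 0 < h) :
    c + h • ξ ∈ openSquare c h ↔ ξ ∈ openSquare 0 1 := by
  simp only [openSquare, Set.mem_prod, Set.mem_Ioo, Prod.fst_add, Prod.snd_add, Prod.smul_fst,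
    Prod.smul_snd, smul_eq_mul, Prod.fst_zero, Prod.snd_zero]
  constructor
  · rintro ⟨⟨h1, h2⟩, h3, h4⟩
    refine ⟨⟨?_, ?_⟩, ?_, ?_⟩ <;> nlinarith
  · rintro ⟨⟨h1, h2⟩, h3, h4⟩
    refine ⟨⟨?_, ?_⟩, ?_, ?_⟩ <;> nlinarith

/-- Change of variables from a square to the reference square `(-1,1)²`. -/
lemma setIntegral_openSquare (c : ℝ × ℝ) {h : ℝ} (hh : 0 < h) (F : ℝ × ℝ → ℝ) :
    ∫ p in openSquare c h, F p = h ^ 2 * ∫ ξ in openSquare 0 1, F (c + h • ξ) := by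
  rw [← integral_indicator (isOpen_openSquare c h).measurableSet,
    ← integral_indicator (isOpen_openSquare 0 1).measurableSet]
  set G := (openSquare c h).indicator F with hG
  have e : (openSquare 0 1).indicator (fun ξ => F (c + h • ξ)) = fun ξ => G (c + h • ξ) := by
    ext ξ
    by_cases hξ : ξ ∈ openSquare 0 1
    · rw [Set.indicator_of_mem hξ, hG,
        Set.indicator_of_mem ((add_smul_mem_openSquare_iff hh).2 hξ)]
    · rw [Set.indicator_of_notMem hξ, hG,
        Set.indicator_of_notMem (fun hc => hξ ((add_smul_mem_openSquare_iff hh).1 hc))]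
  rw [e, Measure.integral_comp_smul volume (fun p => G (c + p)) h, integral_add_left_eq_self]
  simp only [Module.finrank_prod, Module.finrank_self, smul_eq_mul, abs_inv]
  rw [abs_of_pos (by positivity)]
  field_simp

variable {k : ℕ}

/-- Coefficient vectors of tensor product polynomials, extended by zero. -/
def coeffExt (k : ℕ) (a : Fin (k + 1) → Fin (k + 1) → ℝ) (i j : ℕ) : ℝ :=
  if h : i < k + 1 ∧ j < k + 1 then a ⟨i, h.1⟩ ⟨j, h.2⟩ else 0

lemma tensorPoly_coeffExt (q : ℕ → ℕ → ℝ) :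
    tensorPoly k (coeffExt k fun i j => q i j) = tensorPoly k q := by
  ext p
  refine Finset.sum_congr rfl fun i hi => Finset.sum_congr rfl fun j hj => ?_
  rw [coeffExt, dif_pos ⟨Finset.mem_range.1 hi, Finset.mem_range.1 hj⟩]

lemma abs_coeffExt_le (a : Fin (k + 1) → Fin (k + 1) → ℝ) (i j : ℕ) : |coeffExt k a i j| ≤ ‖a‖ := by
  unfold coeffExt
  split_ifs with h
  · exact (norm_le_pi_norm (a ⟨i, h.1⟩) ⟨j, h.2⟩).trans (norm_le_pi_norm a ⟨i, h.1⟩)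
  · simp

/-- On the finite-dimensional space of coefficients the `L²` norm over the reference square
dominates the maximum norm: the square of the `L²` norm is a continuous function of the coefficients
that is positive on the compact unit sphere, and homogeneous of degree two. -/
lemma exists_norm_sq_le_integral_tensorPoly (k : ℕ) : ∃ δ > 0,
    ∀ a : Fin (k + 1) → Fin (k + 1) → ℝ,
      δ * ‖a‖ ^ 2 ≤ ∫ p in openSquare 0 1, tensorPoly k (coeffExt k a) p ^ 2 := by
  let E := Fin (k + 1) → Fin (k + 1) → ℝ
  have hcont : Continuous fun x : E × (ℝ × ℝ) => tensorPoly k (coeffExt k x.1) x.2 := by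
    unfold tensorPoly
    refine continuous_finsetSum _ fun i hi => continuous_finsetSum _ fun j hj => ?_
    simp only [coeffExt, Finset.mem_range.1 hi, Finset.mem_range.1 hj, and_self, dite_true]
    fun_prop
  let Q : E → ℝ := fun a => ∫ p in closedSquare 0 1, tensorPoly k (coeffExt k a) p ^ 2
  have hQc : Continuous Q :=
    continuous_parametric_integral_of_continuous
      (f := fun a p => tensorPoly k (coeffExt k a) p ^ 2)
      (by exact hcont.pow 2) (isCompact_closedSquare 0 1)
  have hQe : ∀ a, Q a = ∫ p in openSquare 0 1, tensorPoly k (coeffExt k a) p ^ 2 := fun a =>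
    (setIntegral_congr_set (openSquare_ae_eq_closedSquare 0 1)).symm
  -- A polynomial with vanishing `L²` norm is zero on the open square, by continuity.
  have hQpos : ∀ a : E, a ≠ 0 → 0 < Q a := by
    intro a ha
    refine lt_of_le_of_ne (integral_nonneg fun _ => sq_nonneg _) fun h0 => ha ?_
    rw [hQe] at h0
    have hc : Continuous fun p => tensorPoly k (coeffExt k a) p ^ 2 :=
      (tensorPoly_contDiff _).continuous.pow 2
    have hint : IntegrableOn (fun p => tensorPoly k (coeffExt k a) p ^ 2) (openSquare 0 1) :=
      (hc.continuousOn.integrableOn_compact (isCompact_closedSquare 0 1)).mono_set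
        (openSquare_subset_closedSquare 0 1)
    have hz := (setIntegral_eq_zero_iff_of_nonneg_ae
      (Filter.Eventually.of_forall fun _ => sq_nonneg _) hint).1 h0.symm
    have hz' := Measure.eqOn_open_of_ae_eq hz (isOpen_openSquare 0 1) hc.continuousOn
      continuousOn_const
    have := tensorPoly_eq_zero (k := k) (q := coeffExt k a) (fun x hx y hy => by
      have := hz' (x := (x, y)) ⟨by simpa using hx, by simpa using hy⟩
      simpa using this)
    ext i j
    have h2 := this i i.2 j j.2
    rwa [coeffExt, dif_pos ⟨i.2, j.2⟩] at h2
  have hhom : ∀ (t : ℝ) (a : E), Q (t • a) = t ^ 2 * Q a := by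
    intro t a
    simp only [Q]
    rw [← integral_const_mul]
    congr 1
    ext p
    rw [← mul_pow]
    congr 1
    simp only [tensorPoly, Finset.mul_sum, coeffExt]
    refine Finset.sum_congr rfl fun i hi => Finset.sum_congr rfl fun j hj => ?_
    split_ifs
    · rw [show ∀ i j, (t • a) i j = t * a i j from fun _ _ => rfl]; ring
    · ring
  obtain ⟨b, hb, hmin⟩ := (isCompact_sphere (0 : E) 1).exists_isMinOn
    (NormedSpace.sphere_nonempty.2 zero_le_one) hQc.continuousOn
  have hb0 : b ≠ 0 := by
    rintro rfl
    simp at hb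
  refine ⟨Q b, hQpos b hb0, fun a => ?_⟩
  rw [← hQe]
  by_cases ha : a = 0
  · subst ha
    simpa using integral_nonneg (μ := volume.restrict (closedSquare 0 1)) fun p =>
      sq_nonneg (tensorPoly k (coeffExt k 0) p)
  have hn : 0 < ‖a‖ := norm_pos_iff.2 ha
  have h1 : Q b ≤ Q (‖a‖⁻¹ • a) := hmin (by simp [norm_smul, hn.ne'])
  rw [hhom] at h1
  calc Q b * ‖a‖ ^ 2 ≤ (‖a‖⁻¹ ^ 2 * Q a) * ‖a‖ ^ 2 := by gcongr
    _ = Q a := by field_simp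

lemma abs_tensorPoly_le (a : Fin (k + 1) → Fin (k + 1) → ℝ) {ξ : ℝ × ℝ} (h1 : |ξ.1| ≤ 1)
    (h2 : |ξ.2| ≤ 1) : |tensorPoly k (coeffExt k a) ξ| ≤ (k + 1) ^ 2 * ‖a‖ := by
  have hb : ∀ i ∈ Finset.range (k + 1), ∀ j ∈ Finset.range (k + 1),
      |coeffExt k a i j * ξ.1 ^ i * ξ.2 ^ j| ≤ ‖a‖ := by
    intro i _ j _
    rw [abs_mul, abs_mul, abs_pow, abs_pow]
    have e1 := pow_le_one₀ (abs_nonneg ξ.1) h1 (n := i)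
    have e2 := pow_le_one₀ (abs_nonneg ξ.2) h2 (n := j)
    calc _ ≤ ‖a‖ * 1 * 1 := by gcongr; exact abs_coeffExt_le a i j
      _ = ‖a‖ := by ring
  calc |tensorPoly k (coeffExt k a) ξ|
      ≤ ∑ i ∈ Finset.range (k + 1), ∑ j ∈ Finset.range (k + 1), ‖a‖ :=
        (Finset.abs_sum_le_sum_abs _ _).trans (Finset.sum_le_sum fun i hi =>
          (Finset.abs_sum_le_sum_abs _ _).trans (Finset.sum_le_sum fun j hj => hb i hi j hj))
    _ = (k + 1) ^ 2 * ‖a‖ := by simp; ring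

open Polynomial in
lemma partialX_tensorPoly (q : ℕ → ℕ → ℝ) (ξ : ℝ × ℝ) :
    partialX (tensorPoly k q) ξ = ∑ i ∈ Finset.range (k + 1), ∑ j ∈ Finset.range (k + 1),
      q i j * (i * ξ.1 ^ (i - 1)) * ξ.2 ^ j := by
  have e : tensorPoly k q = ∑ i ∈ Finset.range (k + 1), ∑ j ∈ Finset.range (k + 1),
      fun p : ℝ × ℝ =>
        (Polynomial.C (q i j) * X ^ i : ℝ[X]).eval p.1 * (X ^ j : ℝ[X]).eval p.2 := by
    ext p; simp [tensorPoly]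
  have hs : ∀ P R : ℝ[X], ContDiff ℝ ∞ fun p : ℝ × ℝ => P.eval p.1 * R.eval p.2 := fun P R =>
    (isTensorPoly_eval_mul_eval (le_max_left P.natDegree R.natDegree)
      (le_max_right P.natDegree R.natDegree)).contDiff
  have hs' : ∀ i ∈ Finset.range (k + 1), ContDiff ℝ ∞ (∑ j ∈ Finset.range (k + 1),
      fun p : ℝ × ℝ =>
        (Polynomial.C (q i j) * X ^ i : ℝ[X]).eval p.1 * (X ^ j : ℝ[X]).eval p.2) := by
    intro i _
    convert ContDiff.sum (fun j (_ : j ∈ Finset.range (k + 1)) =>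
      hs (Polynomial.C (q i j) * X ^ i) (X ^ j)) using 1
    ext p; simp
  rw [e, partialX_sum _ hs']
  simp only [Finset.sum_apply]
  refine Finset.sum_congr rfl fun i _ => ?_
  rw [partialX_sum _ fun j _ => hs _ _]
  simp only [Finset.sum_apply, partialX_eval_mul_eval]
  refine Finset.sum_congr rfl fun j _ => by simp [derivative_X_pow]

lemma abs_partialX_tensorPoly_le (a : Fin (k + 1) → Fin (k + 1) → ℝ) {ξ : ℝ × ℝ} (h1 : |ξ.1| ≤ 1)
    (h2 : |ξ.2| ≤ 1) : |partialX (tensorPoly k (coeffExt k a)) ξ| ≤ (k + 1) ^ 3 * ‖a‖ := by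
  have hb : ∀ i ∈ Finset.range (k + 1), ∀ j ∈ Finset.range (k + 1),
      |coeffExt k a i j * (i * ξ.1 ^ (i - 1)) * ξ.2 ^ j| ≤ (k + 1) * ‖a‖ := by
    intro i hi j _
    rw [abs_mul, abs_mul, abs_mul, abs_pow, abs_pow, Nat.abs_cast]
    have e1 := pow_le_one₀ (abs_nonneg ξ.1) h1 (n := i - 1)
    have e2 := pow_le_one₀ (abs_nonneg ξ.2) h2 (n := j)
    have e3 : (i : ℝ) ≤ k + 1 := by exact_mod_cast (Finset.mem_range.1 hi).le
    calc _ ≤ ‖a‖ * ((k + 1) * 1) * 1 := by gcongr; exact abs_coeffExt_le a i j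
      _ = (k + 1) * ‖a‖ := by ring
  rw [partialX_tensorPoly]
  calc _ ≤ ∑ i ∈ Finset.range (k + 1), ∑ j ∈ Finset.range (k + 1), (k + 1) * ‖a‖ :=
        (Finset.abs_sum_le_sum_abs _ _).trans (Finset.sum_le_sum fun i hi =>
          (Finset.abs_sum_le_sum_abs _ _).trans (Finset.sum_le_sum fun j hj => hb i hi j hj))
    _ = (k + 1) ^ 3 * ‖a‖ := by simp; ring

lemma partialX_comp_swap (f : ℝ × ℝ → ℝ) (p : ℝ × ℝ) :
    partialX (f ∘ Prod.swap) p = partialY f p.swap := by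
  have e : f ∘ Prod.swap = f ∘ (ContinuousLinearEquiv.prodComm ℝ ℝ ℝ) := by ext p; simp
  unfold partialX partialY
  rw [e, ContinuousLinearEquiv.comp_right_fderiv]
  simp

lemma partialY_comp_swap (f : ℝ × ℝ → ℝ) (p : ℝ × ℝ) :
    partialY (f ∘ Prod.swap) p = partialX f p.swap := by
  have e : f ∘ Prod.swap = f ∘ (ContinuousLinearEquiv.prodComm ℝ ℝ ℝ) := by ext p; simp
  unfold partialX partialY
  rw [e, ContinuousLinearEquiv.comp_right_fderiv]
  simp

lemma IsTensorPoly.comp_swap {f : ℝ × ℝ → ℝ} (hf : IsTensorPoly k f) :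
    IsTensorPoly k (f ∘ Prod.swap) := by
  obtain ⟨q, rfl⟩ := hf
  refine ⟨fun i j => q j i, ?_⟩
  ext p
  simp only [tensorPoly, Function.comp, Prod.fst_swap, Prod.snd_swap]
  rw [Finset.sum_comm]
  exact Finset.sum_congr rfl fun i _ => Finset.sum_congr rfl fun j _ => by ring

lemma IsTensorPoly.exists_coeffExt {f : ℝ × ℝ → ℝ} (hf : IsTensorPoly k f) :
    ∃ a, f = tensorPoly k (coeffExt k a) := by
  obtain ⟨q, rfl⟩ := hf
  exact ⟨_, (tensorPoly_coeffExt q).symm⟩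

lemma setIntegral_comp_swap (s t : Set ℝ) (F : ℝ × ℝ → ℝ) :
    ∫ p in s ×ˢ t, F p.swap = ∫ p in t ×ˢ s, F p := by
  have h := Measure.measurePreserving_swap (μ := (volume : Measure ℝ)) (ν := (volume : Measure ℝ))
  have h2 := h.setIntegral_preimage_emb MeasurableEquiv.prodComm.measurableEmbedding F (t ×ˢ s)
  rw [Set.preimage_swap_prod] at h2
  exact h2

/-- Inverse inequalities on the reference square, by the equivalence of norms on the
finite-dimensional space of tensor product polynomials. -/
lemma exists_reference_bound (k : ℕ) : ∃ K > 0, ∀ f : ℝ × ℝ → ℝ, IsTensorPoly k f →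
    ∀ ξ : ℝ × ℝ, |ξ.1| ≤ 1 → |ξ.2| ≤ 1 →
      |f ξ| ≤ K * √(∫ p in openSquare 0 1, f p ^ 2) ∧
      |partialX f ξ| ≤ K * √(∫ p in openSquare 0 1, f p ^ 2) := by
  obtain ⟨δ, hδ, H⟩ := exists_norm_sq_le_integral_tensorPoly k
  refine ⟨(k + 1) ^ 3 * √δ⁻¹, by positivity, fun f hf ξ h1 h2 => ?_⟩
  obtain ⟨a, rfl⟩ := hf.exists_coeffExt
  set I := ∫ p in openSquare 0 1, tensorPoly k (coeffExt k a) p ^ 2 with hI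
  have ha : ‖a‖ ≤ √δ⁻¹ * √I := by
    rw [← Real.sqrt_mul (by positivity)]
    apply Real.le_sqrt_of_sq_le
    rw [inv_mul_eq_div, le_div_iff₀ hδ, mul_comm]
    exact H a
  constructor
  · calc _ ≤ ((k : ℝ) + 1) ^ 2 * ‖a‖ := abs_tensorPoly_le a h1 h2
      _ ≤ ((k : ℝ) + 1) ^ 3 * (√δ⁻¹ * √I) := by
        gcongr
        · linarith [(Nat.cast_nonneg k : (0 : ℝ) ≤ k)]
        · norm_num
      _ = _ := by ring
  · calc _ ≤ ((k : ℝ) + 1) ^ 3 * ‖a‖ := abs_partialX_tensorPoly_le a h1 h2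
      _ ≤ ((k : ℝ) + 1) ^ 3 * (√δ⁻¹ * √I) := by gcongr
      _ = _ := by ring

lemma partialX_comp_affine {f : ℝ × ℝ → ℝ} (hf : ContDiff ℝ ∞ f) (c : ℝ × ℝ) (h : ℝ) (ξ : ℝ × ℝ) :
    partialX (fun ξ => f (c + h • ξ)) ξ = h * partialX f (c + h • ξ) := by
  have h1 : HasFDerivAt (fun ξ : ℝ × ℝ => c + h • ξ) (h • ContinuousLinearMap.id ℝ (ℝ × ℝ)) ξ :=
    ((hasFDerivAt_id ξ).const_smul h).const_add c
  have h2 := (hf.differentiable (by simp) (c + h • ξ)).hasFDerivAt.comp ξ h1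
  have h3 : HasFDerivAt (fun ξ => f (c + h • ξ)) _ ξ := h2
  rw [partialX, h3.fderiv]
  simp [partialX]

/-- Inverse inequalities on squares, by scaling to the reference square. -/
lemma exists_inverse_bound (k : ℕ) : ∃ K > 0, ∀ f : ℝ × ℝ → ℝ, IsTensorPoly k f →
    ∀ (c : ℝ × ℝ) (h : ℝ), 0 < h → ∀ p ∈ closedSquare c h,
      |f p| ≤ K / h * √(∫ p in openSquare c h, f p ^ 2) ∧
      |partialX f p| ≤ K / h ^ 2 * √(∫ p in openSquare c h, f p ^ 2) ∧
      |partialY f p| ≤ K / h ^ 2 * √(∫ p in openSquare c h, f p ^ 2) := by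
  obtain ⟨K, hK, H⟩ := exists_reference_bound k
  have main : ∀ f : ℝ × ℝ → ℝ, IsTensorPoly k f →
    ∀ (c : ℝ × ℝ) (h : ℝ), 0 < h → ∀ p ∈ closedSquare c h,
      |f p| ≤ K / h * √(∫ p in openSquare c h, f p ^ 2) ∧
      |partialX f p| ≤ K / h ^ 2 * √(∫ p in openSquare c h, f p ^ 2) := by
    intro f hf c h hh p hp
    obtain ⟨ξ, h1, h2, rfl⟩ := exists_eq_add_smul_of_mem_closedSquare hh hp
    obtain ⟨e1, e2⟩ := H _ (hf.comp_affine c h) ξ h1 h2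
    rw [partialX_comp_affine hf.contDiff, abs_mul, abs_of_pos hh] at e2
    rw [setIntegral_openSquare c hh, Real.sqrt_mul (by positivity), Real.sqrt_sq hh.le]
    set I := √(∫ ξ in openSquare 0 1, f (c + h • ξ) ^ 2)
    constructor
    · calc _ ≤ K * I := e1
        _ = _ := by field_simp
    · rw [show K / h ^ 2 * (h * I) = K * I / h by field_simp, le_div_iff₀ hh, mul_comm]
      exact e2
  refine ⟨K, hK, fun f hf c h hh p hp => ⟨(main f hf c h hh p hp).1, (main f hf c h hh p hp).2, ?_⟩⟩
  -- The bound for `∂ᵧ` follows by exchanging the variables.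
  have h2 := (main _ hf.comp_swap c.swap h hh p.swap ⟨hp.2, hp.1⟩).2
  rw [partialX_comp_swap, Prod.swap_swap] at h2
  have e : ∫ p in openSquare c.swap h, (f ∘ Prod.swap) p ^ 2 = ∫ p in openSquare c h, f p ^ 2 :=
    setIntegral_comp_swap _ _ fun p => f p ^ 2
  rwa [e] at h2

end Squares

/-! ### Gauss-Lobatto quadrature -/

section Lobatto

open Polynomial

variable {k : ℕ}

lemma natDegree_lobatto_iterate (k j : ℕ) (hj : j ≤ 2 * k) :
    (derivative^[j] ((X ^ 2 - 1 : ℝ[X]) ^ k)).natDegree = 2 * k - j := by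
  induction j with
  | zero =>
    have : (X ^ 2 - 1 : ℝ[X]) = X ^ 2 - C 1 := by simp
    rw [Function.iterate_zero, id, this, natDegree_pow, natDegree_X_pow_sub_C]; omega
  | succ n ih =>
    rw [Function.iterate_succ_apply', natDegree_derivative, ih (by omega)]
    omega

lemma isRoot_lobatto_iterate {j : ℕ} (hj : j < k) {a : ℝ} (ha : a = 1 ∨ a = -1) :
    (derivative^[j] ((X ^ 2 - 1 : ℝ[X]) ^ k)).IsRoot a := by
  have h1 : (X - C a) ^ k ∣ (X ^ 2 - 1 : ℝ[X]) ^ k := by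
    refine pow_dvd_pow_of_dvd ?_ k
    rw [dvd_iff_isRoot]
    rcases ha with rfl | rfl <;> simp
  have h2 := pow_sub_dvd_iterate_derivative_of_pow_dvd j h1
  exact dvd_iff_isRoot.1 ((dvd_pow_self _ (by omega)).trans h2)

/-- By Rolle's theorem every differentiation produces roots between the old ones, while `±1` remain
roots because of their multiplicity. -/
lemma le_card_roots_lobatto_iterate {j : ℕ} (hj : j < k) :
    j + 2 ≤ (derivative^[j] ((X ^ 2 - 1 : ℝ[X]) ^ k)).roots.toFinset.card := by
  have hne : ∀ j < k, derivative^[j] ((X ^ 2 - 1 : ℝ[X]) ^ k) ≠ 0 := by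
    intro j hj h0
    have := natDegree_lobatto_iterate k j (by omega)
    rw [h0, natDegree_zero] at this
    omega
  have hpair : ∀ j < k, ({1, -1} : Finset ℝ) ⊆
      (derivative^[j] ((X ^ 2 - 1 : ℝ[X]) ^ k)).roots.toFinset := by
    intro j hj a ha
    rw [Multiset.mem_toFinset, mem_roots (hne j hj)]
    exact isRoot_lobatto_iterate hj (by simpa using ha)
  have hpc : ({1, -1} : Finset ℝ).card = 2 := Finset.card_pair (by norm_num)
  induction j with
  | zero => simpa [hpc] using Finset.card_le_card (hpair 0 hj)
  | succ n ih =>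
    have h1 := ih (by omega)
    set P := derivative^[n] ((X ^ 2 - 1 : ℝ[X]) ^ k) with hP
    have h2 := P.card_roots_toFinset_le_card_roots_derivative_sdiff_roots_succ
    have h3 := hpair (n + 1) hj
    have h4 := hpair n (by omega)
    rw [Function.iterate_succ_apply', ← hP] at h3 ⊢
    -- The roots that Rolle adds are no roots of `P`, hence different from `±1`.
    have h5 : (derivative P).roots.toFinset \ P.roots.toFinset ∪ {1, -1} ⊆
        (derivative P).roots.toFinset := Finset.union_subset Finset.sdiff_subset h3
    have h6 : Disjoint ((derivative P).roots.toFinset \ P.roots.toFinset) {1, -1} :=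
      Finset.disjoint_of_subset_right h4 Finset.sdiff_disjoint
    have h7 := Finset.card_le_card h5
    rw [Finset.card_union_of_disjoint h6, hpc] at h7
    omega

/-- There are `k + 1` Gauss-Lobatto nodes: not more by the degree, not fewer by Rolle. -/
lemma card_lobattoNodes (hk : 1 ≤ k) : (lobattoNodes k).card = k + 1 := by
  apply le_antisymm
  · refine (Multiset.toFinset_card_le _).trans ((card_roots' _).trans ?_)
    rw [natDegree_lobatto_iterate k (k - 1) (by omega)]
    omega
  · have := le_card_roots_lobatto_iterate (k := k) (j := k - 1) (by omega)
    rw [lobattoNodes]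
    omega

/-- By the Gauss-Lucas theorem the roots of the derivatives of `(t² - 1)ᵏ` stay in the convex strip
`-1 ≤ re z ≤ 1`. -/
lemma re_mem_Icc_of_isRoot_iterate (j : ℕ) (hj : j < 2 * k) {z : ℂ}
    (hz : (derivative^[j] ((X ^ 2 - 1 : ℂ[X]) ^ k)).IsRoot z) : z.re ∈ Set.Icc (-1 : ℝ) 1 := by
  have hdeg : ∀ j, j ≤ 2 * k → (derivative^[j] ((X ^ 2 - 1 : ℂ[X]) ^ k)).natDegree = 2 * k - j := by
    intro j hj
    induction j with
    | zero =>
      have : (X ^ 2 - 1 : ℂ[X]) = X ^ 2 - C 1 := by simp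
      rw [Function.iterate_zero, id, this, natDegree_pow, natDegree_X_pow_sub_C]; omega
    | succ n ih =>
      rw [Function.iterate_succ_apply', natDegree_derivative, ih (by omega)]
      omega
  induction j generalizing z with
  | zero =>
    have h1 : (z - 1) * (z + 1) = 0 := by
      have : (z ^ 2 - 1) ^ k = 0 := by simpa using hz
      have := pow_eq_zero_iff (n := k) (by omega) |>.1 this
      linear_combination this
    rcases mul_eq_zero.1 h1 with h | h
    · rw [sub_eq_zero.1 h]; simp
    · rw [eq_neg_of_add_eq_zero_left h]; simp
  | succ n ih =>
    set P := derivative^[n] ((X ^ 2 - 1 : ℂ[X]) ^ k) with hP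
    rw [Function.iterate_succ_apply', ← hP] at hz
    have hPn : P.natDegree = 2 * k - n := hdeg n (by omega)
    have hPd : P.derivative ≠ 0 := by
      intro h0
      have := hdeg (n + 1) (by omega)
      rw [Function.iterate_succ_apply', ← hP, h0, natDegree_zero] at this
      omega
    have h1 := rootSet_derivative_subset_convexHull_rootSet (P := P)
      (natDegree_pos_iff_degree_pos.1 (by omega))
    have h2 : z ∈ P.derivative.rootSet ℂ := by
      rw [mem_rootSet]
      exact ⟨hPd, by simpa using hz⟩
    have hconv : Convex ℝ {z : ℂ | z.re ∈ Set.Icc (-1 : ℝ) 1} :=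
      (convex_Icc (-1 : ℝ) 1).linear_preimage Complex.reLm
    refine convexHull_min ?_ hconv (h1 h2)
    intro w hw
    rw [mem_rootSet] at hw
    exact ih (by omega) (by simpa using hw.2)

lemma abs_le_one_of_mem_lobattoNodes (hk : 1 ≤ k) {s : ℝ} (hs : s ∈ lobattoNodes k) : |s| ≤ 1 := by
  rw [lobattoNodes, Multiset.mem_toFinset] at hs
  have h1 := isRoot_of_mem_roots hs
  have h2 : (derivative^[k - 1] ((X ^ 2 - 1 : ℂ[X]) ^ k)).IsRoot (s : ℂ) := by
    have e : derivative^[k - 1] ((X ^ 2 - 1 : ℂ[X]) ^ k)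
        = (derivative^[k - 1] ((X ^ 2 - 1 : ℝ[X]) ^ k)).map (algebraMap ℝ ℂ) := by
      rw [← iterate_derivative_map]
      simp
    rw [e]
    exact h1.map
  have h3 := re_mem_Icc_of_isRoot_iterate (k - 1) (by omega) h2
  rw [abs_le]
  exact ⟨by simpa using h3.1, by simpa using h3.2⟩

/-- The quadrature in one variable is exact on polynomials of degree at most `k`, because the
weights are the integrals of the Lagrange basis polynomials of the `k + 1` nodes. -/
lemma sum_lobattoWeight_mul_eval (hk : 1 ≤ k) {P : ℝ[X]} (hP : P.natDegree ≤ k) :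
    ∑ s ∈ lobattoNodes k, lobattoWeight k s * P.eval s = ∫ t in (-1 : ℝ)..1, P.eval t := by
  have h1 : P = Lagrange.interpolate (lobattoNodes k) id fun s => P.eval s := by
    refine Lagrange.eq_interpolate (v := id) Function.injective_id.injOn ?_
    rw [card_lobattoNodes hk]
    exact (degree_le_natDegree).trans_lt (by exact_mod_cast Nat.lt_succ_of_le hP)
  conv_rhs => rw [h1]
  simp only [Lagrange.interpolate_apply, eval_finsetSum, eval_mul, eval_C]
  rw [intervalIntegral.integral_finsetSum]
  · refine Finset.sum_congr rfl fun s _ => ?_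
    rw [intervalIntegral.integral_const_mul, lobattoWeight, mul_comm]
  · intro s _
    exact (continuous_const.mul (Polynomial.continuous _)).intervalIntegrable _ _

end Lobatto

section Quadrature

variable {k : ℕ}

/-- The tensor product Gauss-Lobatto quadrature on the square with center `c` and half width `h`. -/
noncomputable def squareQuadrature (k : ℕ) (c : ℝ × ℝ) (h : ℝ) (F : ℝ × ℝ → ℝ) : ℝ :=
  h ^ 2 * ∑ s ∈ lobattoNodes k, ∑ t ∈ lobattoNodes k,
    lobattoWeight k s * lobattoWeight k t * F (c + h • (s, t))

lemma squareQuadrature_sum {ι : Type*} (S : Finset ι) (c : ℝ × ℝ) (h : ℝ)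
    (F : ι → ℝ × ℝ → ℝ) : squareQuadrature k c h (fun p => ∑ i ∈ S, F i p) =
      ∑ i ∈ S, squareQuadrature k c h (F i) := by
  simp only [squareQuadrature, Finset.mul_sum]
  rw [Finset.sum_comm]
  conv_rhs => rw [Finset.sum_comm]
  rw [Finset.sum_comm]
  refine Finset.sum_congr rfl fun s _ => ?_
  rw [Finset.sum_comm]

lemma squareQuadrature_sub (c : ℝ × ℝ) (h : ℝ) (F G : ℝ × ℝ → ℝ) :
    squareQuadrature k c h (F - G) = squareQuadrature k c h F - squareQuadrature k c h G := by
  simp only [squareQuadrature, Pi.sub_apply, mul_sub, Finset.sum_sub_distrib]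

lemma squareQuadrature_const_mul (c : ℝ × ℝ) (h a : ℝ) (F : ℝ × ℝ → ℝ) :
    squareQuadrature k c h (fun p => a * F p) = a * squareQuadrature k c h F := by
  simp only [squareQuadrature, Finset.mul_sum]
  refine Finset.sum_congr rfl fun i _ => Finset.sum_congr rfl fun j _ => by ring

lemma squareQuadrature_congr (hk : 1 ≤ k) {c : ℝ × ℝ} {h : ℝ} (hh : 0 ≤ h) {F G : ℝ × ℝ → ℝ}
    (H : ∀ p ∈ closedSquare c h, F p = G p) :
    squareQuadrature k c h F = squareQuadrature k c h G := by
  rw [squareQuadrature, squareQuadrature]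
  congr 1
  refine Finset.sum_congr rfl fun s hs => Finset.sum_congr rfl fun t ht => ?_
  rw [H _ (mem_closedSquare_add_smul hh (abs_le_one_of_mem_lobattoNodes hk hs)
    (abs_le_one_of_mem_lobattoNodes hk ht))]

lemma integrableOn_openSquare {c : ℝ × ℝ} {h : ℝ} {F : ℝ × ℝ → ℝ}
    (hF : ContinuousOn F (closedSquare c h)) : IntegrableOn F (openSquare c h) :=
  (hF.integrableOn_compact (isCompact_closedSquare c h)).mono_set
    (openSquare_subset_closedSquare c h)

/-- The quadrature is exact on tensor product polynomials, since it is interpolatory. -/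
lemma squareQuadrature_eq_integral (hk : 1 ≤ k) {f : ℝ × ℝ → ℝ} (hf : IsTensorPoly k f)
    (c : ℝ × ℝ) {h : ℝ} (hh : 0 < h) :
    squareQuadrature k c h f = ∫ p in openSquare c h, f p := by
  -- On the reference square, for products of polynomials in one variable and for their sums.
  have ref : ∀ f, IsTensorPoly k f → IsTensorPoly k f ∧
      squareQuadrature k 0 1 f = ∫ p in openSquare 0 1, f p := by
    intro f hf
    refine hf.induction (C := fun f => IsTensorPoly k f ∧
      squareQuadrature k 0 1 f = ∫ p in openSquare 0 1, f p) ?_ ?_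
    · intro P R hP hR
      refine ⟨isTensorPoly_eval_mul_eval hP hR, ?_⟩
      have e : openSquare 0 1 = Set.Ioo (-1 : ℝ) 1 ×ˢ Set.Ioo (-1 : ℝ) 1 := by simp [openSquare]
      rw [e, Measure.volume_eq_prod, setIntegral_prod_mul (fun x => P.eval x) fun y => R.eval y,
        ← integral_Ioc_eq_integral_Ioo, ← integral_Ioc_eq_integral_Ioo,
        ← intervalIntegral.integral_of_le (by norm_num),
        ← intervalIntegral.integral_of_le (by norm_num),
        ← sum_lobattoWeight_mul_eval hk hP, ← sum_lobattoWeight_mul_eval hk hR,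
        Finset.sum_mul_sum, squareQuadrature, one_pow, one_mul]
      refine Finset.sum_congr rfl fun s _ => Finset.sum_congr rfl fun t _ => ?_
      simp only [zero_add, one_smul]
      ring
    · intro F hF
      refine ⟨IsTensorPoly.sum fun i hi => (hF i hi).1, ?_⟩
      have e : (∑ i ∈ Finset.range (k + 1), F i) = fun p => ∑ i ∈ Finset.range (k + 1), F i p := by
        ext p; simp
      rw [e, squareQuadrature_sum, integral_finsetSum]
      · exact Finset.sum_congr rfl fun i hi => (hF i hi).2
      · exact fun i hi => integrableOn_openSquare (hF i hi).1.continuous.continuousOn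
  rw [setIntegral_openSquare c hh, ← (ref _ (hf.comp_affine c h)).2]
  simp [squareQuadrature]

lemma abs_squareQuadrature_le (hk : 1 ≤ k) {c : ℝ × ℝ} {h B : ℝ} (hh : 0 ≤ h) {F : ℝ × ℝ → ℝ}
    (hF : ∀ p ∈ closedSquare c h, |F p| ≤ B) :
    |squareQuadrature k c h F| ≤ h ^ 2 * ((∑ s ∈ lobattoNodes k, |lobattoWeight k s|) ^ 2 * B) := by
  rw [squareQuadrature, abs_mul, abs_of_nonneg (sq_nonneg h)]
  gcongr
  rw [sq, Finset.sum_mul_sum, Finset.sum_mul]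
  refine (Finset.abs_sum_le_sum_abs _ _).trans (Finset.sum_le_sum fun s hs => ?_)
  rw [Finset.sum_mul]
  refine (Finset.abs_sum_le_sum_abs _ _).trans (Finset.sum_le_sum fun t ht => ?_)
  rw [abs_mul, abs_mul]
  gcongr
  exact hF _ (mem_closedSquare_add_smul hh (abs_le_one_of_mem_lobattoNodes hk hs)
    (abs_le_one_of_mem_lobattoNodes hk ht))

lemma abs_setIntegral_openSquare_le {c : ℝ × ℝ} {h B : ℝ} (hh : 0 ≤ h) {F : ℝ × ℝ → ℝ}
    (hF : ∀ p ∈ closedSquare c h, |F p| ≤ B) :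
    |∫ p in openSquare c h, F p| ≤ 4 * h ^ 2 * B := by
  have := norm_setIntegral_le_of_norm_le_const (volume_openSquare_lt_top c h) (f := F) (C := B)
    fun p hp => hF p (openSquare_subset_closedSquare c h hp)
  rwa [volume_openSquare c hh, Real.norm_eq_abs, mul_comm] at this

lemma convex_closedSquare (c : ℝ × ℝ) (h : ℝ) : Convex ℝ (closedSquare c h) :=
  (convex_Icc _ _).prod (convex_Icc _ _)

/-- The mean value inequality on a square, in terms of the partial derivatives. -/
lemma abs_sub_le_of_partials_le {f : ℝ × ℝ → ℝ} (hf : ContDiff ℝ ∞ f) {c : ℝ × ℝ} {h B : ℝ}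
    (hh : 0 ≤ h) (hx : ∀ p ∈ closedSquare c h, |partialX f p| ≤ B)
    (hy : ∀ p ∈ closedSquare c h, |partialY f p| ≤ B) {p : ℝ × ℝ} (hp : p ∈ closedSquare c h) :
    |f p - f c| ≤ 2 * B * h := by
  have hc : c ∈ closedSquare c h := by
    simpa using mem_closedSquare_add_smul (c := c) (ξ := 0) hh (by simp) (by simp)
  have hB : 0 ≤ B := (abs_nonneg _).trans (hx c hc)
  have hd : ∀ q ∈ closedSquare c h, ‖fderiv ℝ f q‖ ≤ 2 * B := by
    intro q hq
    refine ContinuousLinearMap.opNorm_le_bound _ (by positivity) fun v => ?_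
    have e : fderiv ℝ f q v = v.1 * partialX f q + v.2 * partialY f q := by
      have : v = v.1 • ((1 : ℝ), (0 : ℝ)) + v.2 • ((0 : ℝ), (1 : ℝ)) := by ext <;> simp
      conv_lhs => rw [this]
      rw [map_add, map_smul, map_smul]
      simp [partialX, partialY]
    rw [e, Real.norm_eq_abs]
    have h1 : |v.1| ≤ ‖v‖ := norm_fst_le v
    have h2 : |v.2| ≤ ‖v‖ := norm_snd_le v
    calc _ ≤ |v.1| * |partialX f q| + |v.2| * |partialY f q| := by
          rw [← abs_mul, ← abs_mul]; exact abs_add_le _ _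
      _ ≤ ‖v‖ * B + ‖v‖ * B := by
          gcongr
          · exact hx q hq
          · exact hy q hq
      _ = 2 * B * ‖v‖ := by ring
  have h1 := (convex_closedSquare c h).norm_image_sub_le_of_norm_fderiv_le
    (fun q _ => hf.differentiable (by simp) q) hd hc hp
  have h2 : ‖p - c‖ ≤ h := by
    rw [Prod.norm_def]
    simp only [closedSquare, Set.mem_prod, Set.mem_Icc] at hp
    refine max_le ?_ ?_ <;> rw [Real.norm_eq_abs, abs_le] <;> simp <;> constructor <;> linarith
  calc _ ≤ 2 * B * ‖p - c‖ := h1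
    _ ≤ _ := by gcongr

/-- Error of the quadrature for a product `a r s` with a Lipschitz weight `a` and polynomials
`r`, `s`: the constant `a(c) r(c)` may be subtracted from `a r`, because the quadrature integrates
`s` exactly, and the remaining factor is of size `h`. -/
lemma exists_quadrature_error_bound (hk : 1 ≤ k) : ∃ C > 0, ∀ (c : ℝ × ℝ) (h : ℝ), 0 < h →
    ∀ (a r s : ℝ × ℝ → ℝ) (M : ℝ), ContinuousOn a (closedSquare c h) →
      (∀ p ∈ closedSquare c h, |a p| ≤ M) → (∀ p ∈ closedSquare c h, |a p - a c| ≤ M * h) →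
      IsTensorPoly k r → IsTensorPoly k s →
      |(∫ p in openSquare c h, a p * r p * s p) - squareQuadrature k c h fun p => a p * r p * s p| ≤
        C * M * h * (√(∫ p in openSquare c h, r p ^ 2) +
          √(∫ p in openSquare c h, partialX r p ^ 2) + √(∫ p in openSquare c h, partialY r p ^ 2)) *
          √(∫ p in openSquare c h, s p ^ 2) := by
  obtain ⟨K, hK, H⟩ := exists_inverse_bound k
  set W := (∑ s ∈ lobattoNodes k, |lobattoWeight k s|) ^ 2 with hW
  have hW0 : 0 ≤ W := sq_nonneg _
  refine ⟨(4 + W) * (2 * K ^ 2), by positivity, ?_⟩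
  intro c h hh a r s M ha haM haL hr hs
  set R0 := √(∫ p in openSquare c h, r p ^ 2)
  set R1 := √(∫ p in openSquare c h, partialX r p ^ 2)
  set R2 := √(∫ p in openSquare c h, partialY r p ^ 2)
  set S := √(∫ p in openSquare c h, s p ^ 2)
  have hR0 : 0 ≤ R0 := Real.sqrt_nonneg _
  have hR1 : 0 ≤ R1 := Real.sqrt_nonneg _
  have hR2 : 0 ≤ R2 := Real.sqrt_nonneg _
  have hS : 0 ≤ S := Real.sqrt_nonneg _
  have hc : c ∈ closedSquare c h := by
    simpa using mem_closedSquare_add_smul (c := c) (ξ := 0) hh.le (by simp) (by simp)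
  have hM : 0 ≤ M := (abs_nonneg _).trans (haM c hc)
  -- The error is the same for the integrand `F`, which is small pointwise.
  let F : ℝ × ℝ → ℝ := fun p => (a p * r p - a c * r c) * s p
  have hFb : ∀ p ∈ closedSquare c h,
      |F p| ≤ (M * (K * (R0 + 2 * (R1 + R2)))) * (K / h * S) := by
    intro p hp
    have hr0 := (H r hr c h hh p hp).1
    have hs0 := (H s hs c h hh p hp).1
    have hd := abs_sub_le_of_partials_le hr.contDiff hh.le (B := K / h * (R1 + R2))
      (fun q hq => ((H _ hr.partialX c h hh q hq).1).trans (by gcongr; linarith))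
      (fun q hq => ((H _ hr.partialY c h hh q hq).1).trans (by gcongr; linarith)) hp
    have h1 : |a p * r p - a c * r c| ≤ M * (K * (R0 + 2 * (R1 + R2))) := by
      calc |a p * r p - a c * r c| = |(a p - a c) * r p + a c * (r p - r c)| := by ring_nf
        _ ≤ |a p - a c| * |r p| + |a c| * |r p - r c| := by
          rw [← abs_mul, ← abs_mul]; exact abs_add_le _ _
        _ ≤ (M * h) * (K / h * R0) + M * (2 * (K / h * (R1 + R2)) * h) := by
          gcongr
          · exact haL p hp
          · exact haM c hc
        _ = _ := by field_simp
    rw [abs_mul]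
    gcongr
  have hFi : (∫ p in openSquare c h, F p) =
      (∫ p in openSquare c h, a p * r p * s p) - a c * r c * ∫ p in openSquare c h, s p := by
    rw [← integral_const_mul, ← integral_sub]
    · congr 1; ext p; simp only [F]; ring
    · exact integrableOn_openSquare
        ((ha.mul hr.continuous.continuousOn).mul hs.continuous.continuousOn)
    · exact integrableOn_openSquare (continuous_const.mul hs.continuous).continuousOn
  have hFq : squareQuadrature k c h F =
      (squareQuadrature k c h fun p => a p * r p * s p) -
        a c * r c * ∫ p in openSquare c h, s p := by
    rw [← squareQuadrature_eq_integral hk hs c hh, ← squareQuadrature_const_mul,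
      ← squareQuadrature_sub]
    congr 1; ext p; simp only [F, Pi.sub_apply]; ring
  have e : (∫ p in openSquare c h, a p * r p * s p) -
      (squareQuadrature k c h fun p => a p * r p * s p) =
      (∫ p in openSquare c h, F p) - squareQuadrature k c h F := by
    rw [hFi, hFq]; ring
  rw [e]
  calc _ ≤ |∫ p in openSquare c h, F p| + |squareQuadrature k c h F| := abs_sub _ _
    _ ≤ 4 * h ^ 2 * ((M * (K * (R0 + 2 * (R1 + R2)))) * (K / h * S)) +
        h ^ 2 * (W * ((M * (K * (R0 + 2 * (R1 + R2)))) * (K / h * S))) :=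
      add_le_add (abs_setIntegral_openSquare_le hh.le hFb) (abs_squareQuadrature_le hk hh.le hFb)
    _ = (4 + W) * K ^ 2 * M * h * (R0 + 2 * (R1 + R2)) * S := by field_simp
    _ ≤ (4 + W) * K ^ 2 * M * h * (2 * (R0 + R1 + R2)) * S := by gcongr; linarith
    _ = _ := by ring

end Quadrature

/-! ### The mesh -/

section Mesh

lemma isOpen_unitSquare : IsOpen unitSquare := isOpen_Ioo.prod isOpen_Ioo

lemma closure_unitSquare : closure unitSquare = Set.Icc (0 : ℝ) 1 ×ˢ Set.Icc (0 : ℝ) 1 := by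
  rw [unitSquare, closure_prod_eq, closure_Ioo (by norm_num)]

lemma isCompact_closure_unitSquare : IsCompact (closure unitSquare) := by
  rw [closure_unitSquare]; exact isCompact_Icc.prod isCompact_Icc

lemma unitSquare_eq_openSquare : unitSquare = openSquare (1 / 2, 1 / 2) (1 / 2) := by
  norm_num [unitSquare, openSquare]

lemma volume_unitSquare_lt_top : volume unitSquare < ⊤ := by
  rw [unitSquare_eq_openSquare]; exact volume_openSquare_lt_top _ _

instance : IsFiniteMeasure (volume.restrict unitSquare) := ⟨by
  rw [Measure.restrict_apply_univ]; exact volume_unitSquare_lt_top⟩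

lemma mem_frontier_unitSquare {p : ℝ × ℝ} : p ∈ frontier unitSquare ↔
    p ∈ Set.Icc (0 : ℝ) 1 ×ˢ Set.Icc (0 : ℝ) 1 ∧ (p.1 = 0 ∨ p.1 = 1 ∨ p.2 = 0 ∨ p.2 = 1) := by
  rw [frontier, isOpen_unitSquare.interior_eq, closure_unitSquare, Set.mem_sdiff]
  refine and_congr_right fun hp => ?_
  obtain ⟨⟨h1, h2⟩, h3, h4⟩ := hp
  simp only [unitSquare, Set.mem_prod, Set.mem_Ioo, not_and_or, not_lt]
  constructor
  · rintro ((h | h) | h | h)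
    · exact Or.inl (le_antisymm h h1)
    · exact Or.inr (Or.inl (le_antisymm h2 h))
    · exact Or.inr (Or.inr (Or.inl (le_antisymm h h3)))
    · exact Or.inr (Or.inr (Or.inr (le_antisymm h4 h)))
  · rintro (h | h | h | h)
    · exact Or.inl (Or.inl h.le)
    · exact Or.inl (Or.inr h.ge)
    · exact Or.inr (Or.inl h.le)
    · exact Or.inr (Or.inr h.ge)

lemma setIntegral_unitSquare_swap (F : ℝ × ℝ → ℝ) :
    ∫ p in unitSquare, F p.swap = ∫ p in unitSquare, F p := setIntegral_comp_swap _ _ F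

variable {N : ℕ}

lemma meshSize_pos (hN : 1 ≤ N) : 0 < meshSize N := by
  have : (0 : ℝ) < N := by exact_mod_cast hN
  unfold meshSize
  positivity

lemma natCast_mul_two_meshSize (hN : 1 ≤ N) : (N : ℝ) * (2 * meshSize N) = 1 := by
  have : (0 : ℝ) < N := by exact_mod_cast hN
  unfold meshSize
  field_simp

lemma meshCell_eq_prod (e : Fin N × Fin N) : meshCell e =
    Set.Icc (e.1 * (2 * meshSize N)) ((e.1 + 1) * (2 * meshSize N)) ×ˢ
      Set.Icc (e.2 * (2 * meshSize N)) ((e.2 + 1) * (2 * meshSize N)) := by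
  simp only [meshCell, cellCenter]
  congr 2 <;> ring

lemma openCell_eq_prod (e : Fin N × Fin N) : openSquare (cellCenter e) (meshSize N) =
    Set.Ioo (e.1 * (2 * meshSize N)) ((e.1 + 1) * (2 * meshSize N)) ×ˢ
      Set.Ioo (e.2 * (2 * meshSize N)) ((e.2 + 1) * (2 * meshSize N)) := by
  simp only [openSquare, cellCenter]
  congr 2 <;> ring

lemma interior_meshCell (e : Fin N × Fin N) :
    interior (meshCell e) = openSquare (cellCenter e) (meshSize N) := by
  rw [meshCell, interior_prod_eq, interior_Icc, interior_Icc, openSquare]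

lemma grid_le_one (hN : 1 ≤ N) (i : Fin N) : ((i : ℝ) + 1) * (2 * meshSize N) ≤ 1 := by
  have h1 : ((i : ℕ) : ℝ) + 1 ≤ N := by exact_mod_cast i.2
  have := meshSize_pos hN
  calc ((i : ℝ) + 1) * (2 * meshSize N) ≤ N * (2 * meshSize N) := by gcongr
    _ = 1 := natCast_mul_two_meshSize hN

lemma grid_nonneg (hN : 1 ≤ N) (i : Fin N) : 0 ≤ (i : ℝ) * (2 * meshSize N) := by
  have := meshSize_pos hN
  positivity

lemma meshCell_subset (hN : 1 ≤ N) (e : Fin N × Fin N) : meshCell e ⊆ closure unitSquare := by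
  rw [closure_unitSquare, meshCell_eq_prod]
  exact Set.prod_mono (Set.Icc_subset_Icc (grid_nonneg hN _) (grid_le_one hN _))
    (Set.Icc_subset_Icc (grid_nonneg hN _) (grid_le_one hN _))

lemma openCell_subset (hN : 1 ≤ N) (e : Fin N × Fin N) :
    openSquare (cellCenter e) (meshSize N) ⊆ unitSquare := by
  rw [openCell_eq_prod]
  exact Set.prod_mono (Set.Ioo_subset_Ioo (grid_nonneg hN _) (grid_le_one hN _))
    (Set.Ioo_subset_Ioo (grid_nonneg hN _) (grid_le_one hN _))

/-- The coordinates of the mesh lines. -/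
def gridPoints (N : ℕ) : Set ℝ := Set.range fun i : ℕ => (i : ℝ) * (2 * meshSize N)

lemma countable_gridPoints (N : ℕ) : (gridPoints N).Countable := Set.countable_range _

lemma exists_grid_Ico (hN : 1 ≤ N) {x : ℝ} (hx : x ∈ Set.Ico (0 : ℝ) 1) :
    ∃ i : Fin N, x ∈ Set.Ico ((i : ℝ) * (2 * meshSize N)) ((i + 1) * (2 * meshSize N)) := by
  have hh := meshSize_pos hN
  have hNp : (0 : ℝ) < N := by exact_mod_cast hN
  have h1 : 0 ≤ x * N := mul_nonneg hx.1 hNp.le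
  have h2 : ⌊x * N⌋₊ < N := by
    rw [Nat.floor_lt h1]
    nlinarith [hx.2]
  have e : x = x * N * (2 * meshSize N) := by rw [mul_assoc, natCast_mul_two_meshSize hN, mul_one]
  refine ⟨⟨⌊x * N⌋₊, h2⟩, ?_, ?_⟩
  · conv_rhs => rw [e]
    gcongr
    exact Nat.floor_le h1
  · conv_lhs => rw [e]
    gcongr
    exact Nat.lt_floor_add_one _

lemma exists_grid_Ioo (hN : 1 ≤ N) {x : ℝ} (hx : x ∈ Set.Ioo (0 : ℝ) 1) (hx' : x ∉ gridPoints N) :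
    ∃ i : Fin N, x ∈ Set.Ioo ((i : ℝ) * (2 * meshSize N)) ((i + 1) * (2 * meshSize N)) := by
  obtain ⟨i, hi⟩ := exists_grid_Ico hN ⟨hx.1.le, hx.2⟩
  refine ⟨i, lt_of_le_of_ne hi.1 fun h => hx' ⟨i, h⟩, hi.2⟩

lemma grid_unique (hN : 1 ≤ N) {x : ℝ} {i j : Fin N}
    (hi : x ∈ Set.Ico ((i : ℝ) * (2 * meshSize N)) ((i + 1) * (2 * meshSize N)))
    (hj : x ∈ Set.Ico ((j : ℝ) * (2 * meshSize N)) ((j + 1) * (2 * meshSize N))) : i = j := by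
  have hh : 0 < 2 * meshSize N := by linarith [meshSize_pos hN]
  have h1 : ((i : ℕ) : ℝ) < (j : ℕ) + 1 := lt_of_mul_lt_mul_right (hi.1.trans_lt hj.2) hh.le
  have h2 : ((j : ℕ) : ℝ) < (i : ℕ) + 1 := lt_of_mul_lt_mul_right (hj.1.trans_lt hi.2) hh.le
  have h3 : (i : ℕ) < j + 1 := by exact_mod_cast h1
  have h4 : (j : ℕ) < i + 1 := by exact_mod_cast h2
  ext; omega

lemma pairwise_disjoint_openCell (hN : 1 ≤ N) :
    Pairwise (Function.onFun Disjoint fun e : Fin N × Fin N =>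
      openSquare (cellCenter e) (meshSize N)) := by
  intro e e' hne
  rw [Function.onFun, Set.disjoint_left]
  intro p hp hp'
  rw [openCell_eq_prod] at hp hp'
  exact hne (Prod.ext (grid_unique hN ⟨hp.1.1.le, hp.1.2⟩ ⟨hp'.1.1.le, hp'.1.2⟩)
    (grid_unique hN ⟨hp.2.1.le, hp.2.2⟩ ⟨hp'.2.1.le, hp'.2.2⟩))

lemma ae_notMem_gridPoints (N : ℕ) :
    ∀ᵐ p : ℝ × ℝ, p.1 ∉ gridPoints N ∧ p.2 ∉ gridPoints N := by
  have h : ∀ᵐ x : ℝ, x ∉ gridPoints N := (countable_gridPoints N).ae_notMem _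
  have h1 := (Measure.quasiMeasurePreserving_fst (μ := (volume : Measure ℝ))
    (ν := (volume : Measure ℝ))).ae h
  have h2 := (Measure.quasiMeasurePreserving_snd (μ := (volume : Measure ℝ))
    (ν := (volume : Measure ℝ))).ae h
  rw [Measure.volume_eq_prod]
  filter_upwards [h1, h2] with p a b using ⟨a, b⟩

/-- Almost every point of the unit square lies in an open cell. -/
lemma ae_exists_mem_openCell (hN : 1 ≤ N) : ∀ᵐ p ∂(volume.restrict unitSquare),
    ∃ e : Fin N × Fin N, p ∈ openSquare (cellCenter e) (meshSize N) := by
  rw [ae_restrict_iff' isOpen_unitSquare.measurableSet]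
  filter_upwards [ae_notMem_gridPoints N] with p hp hpU
  obtain ⟨i, hi⟩ := exists_grid_Ioo hN hpU.1 hp.1
  obtain ⟨j, hj⟩ := exists_grid_Ioo hN hpU.2 hp.2
  exact ⟨(i, j), by rw [openCell_eq_prod]; exact ⟨hi, hj⟩⟩

lemma unitSquare_ae_eq_iUnion (hN : 1 ≤ N) : unitSquare =ᵐ[volume]
    ⋃ e : Fin N × Fin N, openSquare (cellCenter e) (meshSize N) := by
  have h := ae_exists_mem_openCell hN
  rw [ae_restrict_iff' isOpen_unitSquare.measurableSet] at h
  filter_upwards [h] with p hp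
  refine propext ⟨fun h => Set.mem_iUnion.2 (hp h), fun h => ?_⟩
  obtain ⟨e, he⟩ := Set.mem_iUnion.1 h
  exact openCell_subset hN e he

lemma setIntegral_unitSquare_eq_sum (hN : 1 ≤ N) {F : ℝ × ℝ → ℝ} (hF : IntegrableOn F unitSquare) :
    ∫ p in unitSquare, F p =
      ∑ e : Fin N × Fin N, ∫ p in openSquare (cellCenter e) (meshSize N), F p := by
  rw [setIntegral_congr_set (unitSquare_ae_eq_iUnion hN)]
  exact integral_iUnion_fintype (fun e => (isOpen_openSquare _ _).measurableSet)
    (pairwise_disjoint_openCell hN) fun e => hF.mono_set (openCell_subset hN e)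

lemma integrableOn_unitSquare_of_openCell (hN : 1 ≤ N) {F : ℝ × ℝ → ℝ}
    (hF : ∀ e : Fin N × Fin N, IntegrableOn F (openSquare (cellCenter e) (meshSize N))) :
    IntegrableOn F unitSquare := by
  have := (integrableOn_finite_iUnion (f := F) (μ := volume)).2 hF
  exact this.congr_set_ae (unitSquare_ae_eq_iUnion hN)

end Mesh

/-! ### Finite element functions -/

section FiniteElements

variable {k N : ℕ}

/-- The polynomial pieces of a finite element function. -/
def IsPieces (k : ℕ) {N : ℕ} (v : ℝ × ℝ → ℝ) (f : Fin N × Fin N → ℝ × ℝ → ℝ) : Prop :=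
  ∀ e, IsTensorPoly k (f e) ∧ ∀ p ∈ meshCell e, v p = f e p

lemma MemVh.exists_isPieces {v : ℝ × ℝ → ℝ} (hv : MemVh k N v) :
    ∃ f : Fin N × Fin N → ℝ × ℝ → ℝ, IsPieces k v f := by
  choose q hq using hv.2
  exact ⟨fun e => tensorPoly k (q e), fun e => ⟨⟨q e, rfl⟩, hq e⟩⟩

lemma IsPieces.eventuallyEq {v : ℝ × ℝ → ℝ} {f : Fin N × Fin N → ℝ × ℝ → ℝ} (h : IsPieces k v f)
    {e : Fin N × Fin N} {p : ℝ × ℝ} (hp : p ∈ openSquare (cellCenter e) (meshSize N)) :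
    v =ᶠ[nhds p] f e := by
  filter_upwards [(isOpen_openSquare _ _).mem_nhds hp] with q hq
  exact (h e).2 q (openSquare_subset_closedSquare _ _ hq)

lemma IsPieces.partialX_eq {v : ℝ × ℝ → ℝ} {f : Fin N × Fin N → ℝ × ℝ → ℝ} (h : IsPieces k v f)
    {e : Fin N × Fin N} {p : ℝ × ℝ} (hp : p ∈ openSquare (cellCenter e) (meshSize N)) :
    partialX v p = partialX (f e) p := by
  rw [partialX, partialX, (h.eventuallyEq hp).fderiv_eq]

lemma IsPieces.partialY_eq {v : ℝ × ℝ → ℝ} {f : Fin N × Fin N → ℝ × ℝ → ℝ} (h : IsPieces k v f)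
    {e : Fin N × Fin N} {p : ℝ × ℝ} (hp : p ∈ openSquare (cellCenter e) (meshSize N)) :
    partialY v p = partialY (f e) p := by
  rw [partialY, partialY, (h.eventuallyEq hp).fderiv_eq]

lemma MemVh0.comp_swap {v : ℝ × ℝ → ℝ} (hv : MemVh0 k N v) : MemVh0 k N (v ∘ Prod.swap) := by
  obtain ⟨⟨h1, h2⟩, h3⟩ := hv
  refine ⟨⟨h1.comp continuous_swap.continuousOn fun p hp => ?_, fun e => ?_⟩, fun p hp => ?_⟩
  · rw [closure_unitSquare] at hp ⊢
    exact ⟨hp.2, hp.1⟩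
  · obtain ⟨q, hq⟩ := h2 e.swap
    refine ⟨fun i j => q j i, fun p hp => ?_⟩
    rw [Function.comp, hq p.swap ⟨hp.2, hp.1⟩, Finset.sum_comm]
    refine Finset.sum_congr rfl fun i _ => Finset.sum_congr rfl fun j _ => ?_
    simp only [Prod.fst_swap, Prod.snd_swap]
    ring
  · refine h3 _ ?_
    rw [mem_frontier_unitSquare] at hp ⊢
    simp only [Set.mem_prod, Prod.fst_swap, Prod.snd_swap] at hp ⊢
    tauto

/-- A finite element function and its classical partial derivatives are bounded, off the mesh
lines for the latter. -/
lemma IsPieces.exists_bound {v : ℝ × ℝ → ℝ} {f : Fin N × Fin N → ℝ × ℝ → ℝ}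
    (h : IsPieces k v f) : ∃ B, ∀ e : Fin N × Fin N, ∀ p ∈ openSquare (cellCenter e) (meshSize N),
      |v p| ≤ B ∧ |partialX v p| ≤ B ∧ |partialY v p| ≤ B := by
  have hb : ∀ g : ℝ × ℝ → ℝ, Continuous g → ∀ e : Fin N × Fin N,
      ∃ B, ∀ p ∈ openSquare (cellCenter e) (meshSize N), |g p| ≤ B := by
    intro g hg e
    have hc := isCompact_closedSquare (cellCenter e) (meshSize N)
    obtain ⟨B, hB⟩ := hc.exists_bound_of_continuousOn hg.continuousOn
    exact ⟨B, fun p hp => hB p (openSquare_subset_closedSquare _ _ hp)⟩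
  choose B0 h0 using fun e => hb (f e) (h e).1.continuous e
  choose B1 h1 using fun e => hb (partialX (f e)) (h e).1.partialX.continuous e
  choose B2 h2 using fun e => hb (partialY (f e)) (h e).1.partialY.continuous e
  refine ⟨∑ e, (|B0 e| + |B1 e| + |B2 e|), fun e p hp => ?_⟩
  have hs : |B0 e| + |B1 e| + |B2 e| ≤ ∑ e, (|B0 e| + |B1 e| + |B2 e|) :=
    Finset.single_le_sum (f := fun e => |B0 e| + |B1 e| + |B2 e|)
      (fun e _ => by positivity) (Finset.mem_univ e)
  have a0 := abs_nonneg (B0 e)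
  have a1 := abs_nonneg (B1 e)
  have a2 := abs_nonneg (B2 e)
  rw [(h e).2 p (openSquare_subset_closedSquare _ _ hp), h.partialX_eq hp, h.partialY_eq hp]
  exact ⟨by linarith [h0 e p hp, le_abs_self (B0 e)], by linarith [h1 e p hp, le_abs_self (B1 e)],
    by linarith [h2 e p hp, le_abs_self (B2 e)]⟩

lemma IsPieces.integrableOn_mul {v : ℝ × ℝ → ℝ} {f : Fin N × Fin N → ℝ × ℝ → ℝ}
    (h : IsPieces k v f) (hN : 1 ≤ N) {g : ℝ × ℝ → ℝ} (hg : Continuous g) :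
    IntegrableOn (fun p => v p * g p) unitSquare ∧
      IntegrableOn (fun p => partialX v p * g p) unitSquare ∧
      IntegrableOn (fun p => partialY v p * g p) unitSquare := by
  refine ⟨integrableOn_unitSquare_of_openCell hN fun e => ?_,
    integrableOn_unitSquare_of_openCell hN fun e => ?_,
    integrableOn_unitSquare_of_openCell hN fun e => ?_⟩
  · refine (integrableOn_openSquare ((h e).1.continuous.mul hg).continuousOn).congr_fun
      (fun p hp => ?_) (isOpen_openSquare _ _).measurableSet
    simp only [(h e).2 p (openSquare_subset_closedSquare _ _ hp), Pi.mul_apply]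
  · refine (integrableOn_openSquare ((h e).1.partialX.continuous.mul hg).continuousOn).congr_fun
      (fun p hp => ?_) (isOpen_openSquare _ _).measurableSet
    simp only [h.partialX_eq hp, Pi.mul_apply]
  · refine (integrableOn_openSquare ((h e).1.partialY.continuous.mul hg).continuousOn).congr_fun
      (fun p hp => ?_) (isOpen_openSquare _ _).measurableSet
    simp only [h.partialY_eq hp, Pi.mul_apply]

/-- Integration by parts against any smooth function; there is no boundary term since `v` vanishes
on the boundary, and none on the mesh lines since `v` is continuous. -/
lemma MemVh0.integral_mul_partialY {v : ℝ × ℝ → ℝ} (hv : MemVh0 k N v) (hN : 1 ≤ N)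
    {φ : ℝ × ℝ → ℝ} (hφ : ContDiff ℝ ∞ φ) :
    ∫ p in unitSquare, v p * partialY φ p = - ∫ p in unitSquare, partialY v p * φ p := by
  obtain ⟨f, hf⟩ := hv.1.exists_isPieces
  have i1 := (hf.integrableOn_mul hN (partialY_contDiff hφ).continuous).1
  have i2 := (hf.integrableOn_mul hN hφ.continuous).2.2
  rw [eq_neg_iff_add_eq_zero, ← integral_add i1 i2]
  have i3 := i1.add i2
  set F : ℝ × ℝ → ℝ := fun p => v p * partialY φ p + partialY v p * φ p with hF
  have i4 : IntegrableOn F (Set.Ioo (0 : ℝ) 1 ×ˢ Set.Ioo (0 : ℝ) 1) := i3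
  rw [unitSquare, Measure.volume_eq_prod, setIntegral_prod _ i4]
  have i5 : Integrable F ((volume.restrict (Set.Ioo (0 : ℝ) 1)).prod
      (volume.restrict (Set.Ioo (0 : ℝ) 1))) := by
    rw [Measure.prod_restrict]; exact i4
  have hz : ∀ᵐ x ∂(volume.restrict (Set.Ioo (0 : ℝ) 1)),
      ∫ y in Set.Ioo (0 : ℝ) 1, F (x, y) = 0 := by
    have hg : ∀ᵐ x : ℝ ∂(volume.restrict (Set.Ioo (0 : ℝ) 1)), x ∉ gridPoints N :=
      ae_restrict_of_ae ((countable_gridPoints N).ae_notMem _)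
    filter_upwards [i5.prod_right_ae, hg, ae_restrict_mem measurableSet_Ioo] with x hxi hxg hx
    rw [← integral_Ioc_eq_integral_Ioo, ← intervalIntegral.integral_of_le zero_le_one]
    have hmem : ∀ y ∈ Set.Icc (0 : ℝ) 1, (x, y) ∈ closure unitSquare := fun y hy => by
      rw [closure_unitSquare]; exact ⟨⟨hx.1.le, hx.2.le⟩, hy⟩
    -- On a vertical line off the mesh, `v φ` is continuous, with derivative `F` off the mesh lines.
    rw [integral_eq_of_hasDerivAt_off_countable (fun y => v (x, y) * φ (x, y)) (fun y => F (x, y))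
      (countable_gridPoints N)]
    · have b0 : v (x, 0) = 0 := hv.2 _ (by
        rw [mem_frontier_unitSquare]; simp [hx.1.le, hx.2.le])
      have b1 : v (x, 1) = 0 := hv.2 _ (by
        rw [mem_frontier_unitSquare]; simp [hx.1.le, hx.2.le])
      simp [b0, b1]
    · rw [Set.uIcc_of_le zero_le_one]
      refine ContinuousOn.mul (hv.1.1.comp (by fun_prop) hmem) ?_
      exact (hφ.continuous.comp (by fun_prop)).continuousOn
    · rw [min_eq_left zero_le_one, max_eq_right zero_le_one]
      rintro y ⟨hy, hyg⟩
      obtain ⟨i, hi⟩ := exists_grid_Ioo hN hx hxg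
      obtain ⟨j, hj⟩ := exists_grid_Ioo hN hy hyg
      have hp : (x, y) ∈ openSquare (cellCenter (i, j)) (meshSize N) := by
        rw [openCell_eq_prod]; exact ⟨hi, hj⟩
      have hd : DifferentiableAt ℝ v (x, y) := (hf.eventuallyEq hp).differentiableAt_iff.2
        ((hf (i, j)).1.contDiff.differentiable (by simp) _)
      have hl : HasDerivAt (fun t : ℝ => (x, t)) ((0 : ℝ), (1 : ℝ)) y :=
        (hasDerivAt_const y x).prodMk (hasDerivAt_id y)
      have d1 : HasDerivAt (fun t => v (x, t)) (partialY v (x, y)) y :=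
        hd.hasFDerivAt.comp_hasDerivAt y hl
      have d2 : HasDerivAt (fun t => φ (x, t)) (partialY φ (x, y)) y :=
        (hφ.differentiable (by simp) _).hasFDerivAt.comp_hasDerivAt y hl
      have d3 : F (x, y) = partialY v (x, y) * φ (x, y) + v (x, y) * partialY φ (x, y) := by
        simp only [hF]; ring
      rw [d3]
      exact d1.mul d2
    · rw [intervalIntegrable_iff_integrableOn_Ioo_of_le zero_le_one]
      exact hxi
  rw [integral_congr_ae hz]
  simp

lemma MemVh0.integral_mul_partialX {v : ℝ × ℝ → ℝ} (hv : MemVh0 k N v) (hN : 1 ≤ N)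
    {φ : ℝ × ℝ → ℝ} (hφ : ContDiff ℝ ∞ φ) :
    ∫ p in unitSquare, v p * partialX φ p = - ∫ p in unitSquare, partialX v p * φ p := by
  have hs : ContDiff ℝ ∞ (φ ∘ Prod.swap) := hφ.comp (contDiff_snd.prodMk contDiff_fst)
  have h := hv.comp_swap.integral_mul_partialY hN hs
  simp only [partialY_comp_swap, Function.comp] at h
  rwa [setIntegral_unitSquare_swap fun p => v p * partialX φ p,
    setIntegral_unitSquare_swap fun p => partialX v p * φ p] at h

end FiniteElements

/-! ### Square integrable functions -/

section SquareIntegrable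

variable {α : Type*} [MeasurableSpace α] {μ : Measure α} {f g : α → ℝ}

lemma integral_sub_sq_le (hf : MemLp f 2 μ) (hg : MemLp g 2 μ) :
    ∫ x, (f x - g x) ^ 2 ∂μ ≤ 2 * ∫ x, f x ^ 2 ∂μ + 2 * ∫ x, g x ^ 2 ∂μ := by
  rw [← mul_add, ← integral_add hf.integrable_sq hg.integrable_sq, ← integral_const_mul]
  refine integral_mono (hf.sub hg).integrable_sq
    ((hf.integrable_sq.add hg.integrable_sq).const_mul 2) fun x => ?_
  simp only
  nlinarith [sq_nonneg (f x + g x)]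

lemma integral_abs_mul_le (hf : MemLp f 2 μ) (hg : MemLp g 2 μ) :
    ∫ x, |f x| * |g x| ∂μ ≤ √(∫ x, f x ^ 2 ∂μ) * √(∫ x, g x ^ 2 ∂μ) := by
  have h := integral_mul_norm_le_Lp_mul_Lq (μ := μ) (f := f) (g := g)
    (Real.HolderConjugate.two_two) (by simpa using hf) (by simpa using hg)
  simpa [Real.sqrt_eq_rpow] using h

end SquareIntegrable

/-! ### Finite element functions belong to `H₀¹` -/

section FiniteElementsH10

variable {k N : ℕ} {v : ℝ × ℝ → ℝ}

lemma MemLp.integrable_unitSquare {u : ℝ × ℝ → ℝ} (hu : MemLp u 2 (volume.restrict unitSquare)) :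
    IntegrableOn u unitSquare := hu.integrable (by norm_num)

lemma MemLp.locallyIntegrableOn_unitSquare {u : ℝ × ℝ → ℝ}
    (hu : MemLp u 2 (volume.restrict unitSquare)) : LocallyIntegrableOn u unitSquare :=
  (MemLp.integrable_unitSquare hu).locallyIntegrableOn

lemma MemVh0.memLp (hv : MemVh0 k N v) (hN : 1 ≤ N) (r : ℝ≥0∞) :
    MemLp v r (volume.restrict unitSquare) ∧ MemLp (partialX v) r (volume.restrict unitSquare) ∧
      MemLp (partialY v) r (volume.restrict unitSquare) := by
  obtain ⟨f, hf⟩ := hv.1.exists_isPieces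
  obtain ⟨B, hB⟩ := hf.exists_bound
  have i := hf.integrableOn_mul hN (g := fun _ => 1) continuous_const
  simp only [mul_one] at i
  refine ⟨MemLp.of_bound i.1.1 B ?_, MemLp.of_bound i.2.1.1 B ?_, MemLp.of_bound i.2.2.1 B ?_⟩ <;>
  · filter_upwards [ae_exists_mem_openCell hN] with p ⟨e, he⟩
    first
    | exact (hB e p he).1
    | exact (hB e p he).2.1
    | exact (hB e p he).2.2

lemma MemVh0.isWeakDeriv (hv : MemVh0 k N v) (hN : 1 ≤ N) :
    IsWeakDeriv unitSquare 1 0 v (partialX v) ∧ IsWeakDeriv unitSquare 0 1 v (partialY v) := by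
  obtain ⟨h0, h1, h2⟩ := hv.memLp hN 2
  refine ⟨⟨MemLp.locallyIntegrableOn_unitSquare h0, MemLp.locallyIntegrableOn_unitSquare h1,
    fun φ hφ => ?_⟩, ⟨MemLp.locallyIntegrableOn_unitSquare h0,
    MemLp.locallyIntegrableOn_unitSquare h2, fun φ hφ => ?_⟩⟩
  · simpa using hv.integral_mul_partialX hN hφ.1
  · simpa using hv.integral_mul_partialY hN hφ.1

lemma memSobolev_one {u ux uy : ℝ × ℝ → ℝ} {r : ℝ≥0∞} {U : Set (ℝ × ℝ)}
    (hx : IsWeakDeriv U 1 0 u ux) (hy : IsWeakDeriv U 0 1 u uy)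
    (h0 : MemLp u r (volume.restrict U)) (h1 : MemLp ux r (volume.restrict U))
    (h2 : MemLp uy r (volume.restrict U)) : MemSobolev U 1 r u := by
  intro i j hij
  have : (i = 0 ∧ j = 0) ∨ (i = 1 ∧ j = 0) ∨ (i = 0 ∧ j = 1) := by omega
  rcases this with ⟨rfl, rfl⟩ | ⟨rfl, rfl⟩ | ⟨rfl, rfl⟩
  · exact ⟨u, isWeakDeriv_zero_zero hx.1, h0⟩
  · exact ⟨ux, hx, h1⟩
  · exact ⟨uy, hy, h2⟩

lemma MemVh0.memSobolev (hv : MemVh0 k N v) (hN : 1 ≤ N) : MemSobolev unitSquare 1 2 v := by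
  obtain ⟨h0, h1, h2⟩ := hv.memLp hN 2
  obtain ⟨d1, d2⟩ := hv.isWeakDeriv hN
  exact memSobolev_one d1 d2 h0 h1 h2

open scoped Convolution

lemma partialX_convolution {V ρ : ℝ × ℝ → ℝ} (hV : LocallyIntegrable V) (hρ : ContDiff ℝ ∞ ρ)
    (hc : HasCompactSupport ρ) (q : ℝ × ℝ) :
    partialX (fun q => ∫ t, V t * ρ (q - t)) q = ∫ t, V t * partialX ρ (q - t) := by
  have h := hc.hasFDerivAt_convolution_right (ContinuousLinearMap.mul ℝ ℝ) hV
    (hρ.of_le (by simp)) q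
  have h2 := convolution_precompR_apply (ContinuousLinearMap.mul ℝ ℝ) hV (hc.fderiv ℝ)
    (hρ.continuous_fderiv (by simp)) q ((1 : ℝ), (0 : ℝ))
  rw [partialX]
  have e : (fun q => ∫ t, V t * ρ (q - t)) = V ⋆[ContinuousLinearMap.mul ℝ ℝ] ρ := rfl
  rw [e, h.fderiv, h2]
  rfl

lemma partialY_convolution {V ρ : ℝ × ℝ → ℝ} (hV : LocallyIntegrable V) (hρ : ContDiff ℝ ∞ ρ)
    (hc : HasCompactSupport ρ) (q : ℝ × ℝ) :
    partialY (fun q => ∫ t, V t * ρ (q - t)) q = ∫ t, V t * partialY ρ (q - t) := by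
  have h := hc.hasFDerivAt_convolution_right (ContinuousLinearMap.mul ℝ ℝ) hV
    (hρ.of_le (by simp)) q
  have h2 := convolution_precompR_apply (ContinuousLinearMap.mul ℝ ℝ) hV (hc.fderiv ℝ)
    (hρ.continuous_fderiv (by simp)) q ((0 : ℝ), (1 : ℝ))
  rw [partialY]
  have e : (fun q => ∫ t, V t * ρ (q - t)) = V ⋆[ContinuousLinearMap.mul ℝ ℝ] ρ := rfl
  rw [e, h.fderiv, h2]
  rfl

lemma partialX_comp_const_sub {ρ : ℝ × ℝ → ℝ} (hρ : ContDiff ℝ ∞ ρ) (q t : ℝ × ℝ) :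
    partialX (fun t => ρ (q - t)) t = - partialX ρ (q - t) := by
  have := partialX_comp_affine hρ q (-1) t
  simpa [sub_eq_add_neg] using this

lemma partialY_comp_affine {f : ℝ × ℝ → ℝ} (hf : ContDiff ℝ ∞ f) (c : ℝ × ℝ) (h : ℝ) (ξ : ℝ × ℝ) :
    partialY (fun ξ => f (c + h • ξ)) ξ = h * partialY f (c + h • ξ) := by
  have h1 : HasFDerivAt (fun ξ : ℝ × ℝ => c + h • ξ) (h • ContinuousLinearMap.id ℝ (ℝ × ℝ)) ξ :=
    ((hasFDerivAt_id ξ).const_smul h).const_add c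
  have h2 := (hf.differentiable (by simp) (c + h • ξ)).hasFDerivAt.comp ξ h1
  have h3 : HasFDerivAt (fun ξ => f (c + h • ξ)) _ ξ := h2
  rw [partialY, h3.fderiv]
  simp [partialY]

lemma partialY_comp_const_sub {ρ : ℝ × ℝ → ℝ} (hρ : ContDiff ℝ ∞ ρ) (q t : ℝ × ℝ) :
    partialY (fun t => ρ (q - t)) t = - partialY ρ (q - t) := by
  have := partialY_comp_affine hρ q (-1) t
  simpa [sub_eq_add_neg] using this

/-- Mollification of the extension by zero from the unit square. -/
noncomputable def mollify (ρ : ContDiffBump (0 : ℝ × ℝ)) (g : ℝ × ℝ → ℝ) (q : ℝ × ℝ) : ℝ :=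
  ∫ t, unitSquare.indicator g t * ρ.normed volume (q - t)

lemma contDiff_mollify (ρ : ContDiffBump (0 : ℝ × ℝ)) {g : ℝ × ℝ → ℝ}
    (hg : IntegrableOn g unitSquare) : ContDiff ℝ ∞ (mollify ρ g) := by
  have hV : LocallyIntegrable (unitSquare.indicator g) :=
    ((integrable_indicator_iff isOpen_unitSquare.measurableSet).2 hg).locallyIntegrable
  exact ρ.hasCompactSupport_normed.contDiff_convolution_right (ContinuousLinearMap.mul ℝ ℝ) hV
    ρ.contDiff_normed

lemma abs_mollify_le (ρ : ContDiffBump (0 : ℝ × ℝ)) {g : ℝ × ℝ → ℝ} {B : ℝ} (hB : 0 ≤ B)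
    (hg : ∀ᵐ p ∂(volume.restrict unitSquare), |g p| ≤ B) (q : ℝ × ℝ) : |mollify ρ g q| ≤ B := by
  have hi : ∫ t, ρ.normed volume (q - t) = 1 := by
    rw [integral_sub_left_eq_self (fun t => ρ.normed volume t), ρ.integral_normed]
  have hint : Integrable fun t => ρ.normed volume (q - t) :=
    (ρ.integrable_normed (μ := volume)).comp_sub_left q
  calc |mollify ρ g q| ≤ ∫ t, B * ρ.normed volume (q - t) := by
        rw [mollify, ← Real.norm_eq_abs]
        refine norm_integral_le_of_norm_le (hint.const_mul B) ?_
        rw [ae_restrict_iff' isOpen_unitSquare.measurableSet] at hg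
        filter_upwards [hg] with t ht
        rw [norm_mul, Real.norm_eq_abs, Real.norm_eq_abs,
          abs_of_nonneg (ρ.nonneg_normed (q - t))]
        refine mul_le_mul_of_nonneg_right ?_ (ρ.nonneg_normed (q - t))
        by_cases htU : t ∈ unitSquare
        · rw [Set.indicator_of_mem htU]; exact ht htU
        · rw [Set.indicator_of_notMem htU]; simpa using hB
    _ = B := by rw [integral_const_mul, hi, mul_one]

/-- Mollifications at moving points converge at every point of continuity. -/
lemma tendsto_mollify {ρ : ℕ → ContDiffBump (0 : ℝ × ℝ)}
    (hρ : Filter.Tendsto (fun n => (ρ n).rOut) Filter.atTop (nhds 0)) {g : ℝ × ℝ → ℝ}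
    (hg : IntegrableOn g unitSquare) {p : ℝ × ℝ} (hp : p ∈ unitSquare) (hgc : ContinuousAt g p)
    {q : ℕ → ℝ × ℝ} (hq : Filter.Tendsto q Filter.atTop (nhds p)) :
    Filter.Tendsto (fun n => mollify (ρ n) g (q n)) Filter.atTop (nhds (g p)) := by
  have hG : (unitSquare.indicator g) =ᶠ[nhds p] g := by
    filter_upwards [isOpen_unitSquare.mem_nhds hp] with t ht
    rw [Set.indicator_of_mem ht]
  have hGi := (integrable_indicator_iff isOpen_unitSquare.measurableSet).2 hg
  have hGc : Filter.Tendsto (unitSquare.indicator g) (nhds p) (nhds (g p)) :=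
    hgc.tendsto.congr' hG.symm
  have h := ContDiffBump.convolution_tendsto_right (μ := (volume : Measure (ℝ × ℝ))) (φ := ρ)
    (g := fun _ => unitSquare.indicator g) (k := q) (x₀ := p) (z₀ := g p) (l := Filter.atTop) hρ
    (Filter.Eventually.of_forall fun _ => hGi.1) (hGc.comp Filter.tendsto_snd) hq
  refine h.congr fun n => ?_
  rw [convolution_eq_swap, mollify]
  congr 1
  ext t
  simp [mul_comm]

lemma integral_indicator_unitSquare_mul (f g : ℝ × ℝ → ℝ) :
    ∫ t, unitSquare.indicator f t * g t = ∫ t in unitSquare, f t * g t := by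
  rw [← integral_indicator isOpen_unitSquare.measurableSet]
  congr 1; ext t
  by_cases ht : t ∈ unitSquare <;> simp [ht]

/-- Mollification of the extension by zero commutes with differentiation, because `v` vanishes on
the boundary. -/
lemma MemVh0.partialX_mollify (hv : MemVh0 k N v) (hN : 1 ≤ N) (ρ : ContDiffBump (0 : ℝ × ℝ)) :
    partialX (mollify ρ v) = mollify ρ (partialX v) := by
  have hm := isOpen_unitSquare.measurableSet
  have hi := MemLp.integrable_unitSquare (hv.memLp hN 2).1
  have hs : ContDiff ℝ ∞ (ρ.normed (volume : Measure (ℝ × ℝ))) := ρ.contDiff_normed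
  ext q
  unfold mollify
  rw [partialX_convolution ((integrable_indicator_iff hm).2 hi).locallyIntegrable hs
    ρ.hasCompactSupport_normed,
    integral_indicator_unitSquare_mul v fun t => partialX (ρ.normed volume) (q - t),
    integral_indicator_unitSquare_mul (partialX v) fun t => ρ.normed volume (q - t)]
  have h := hv.integral_mul_partialX hN (φ := fun t => ρ.normed volume (q - t))
    (hs.comp (contDiff_const.sub contDiff_id))
  simp only [partialX_comp_const_sub hs, mul_neg, integral_neg, neg_inj] at h
  exact h

lemma MemVh0.partialY_mollify (hv : MemVh0 k N v) (hN : 1 ≤ N) (ρ : ContDiffBump (0 : ℝ × ℝ)) :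
    partialY (mollify ρ v) = mollify ρ (partialY v) := by
  have hm := isOpen_unitSquare.measurableSet
  have hi := MemLp.integrable_unitSquare (hv.memLp hN 2).1
  have hs : ContDiff ℝ ∞ (ρ.normed (volume : Measure (ℝ × ℝ))) := ρ.contDiff_normed
  ext q
  unfold mollify
  rw [partialY_convolution ((integrable_indicator_iff hm).2 hi).locallyIntegrable hs
    ρ.hasCompactSupport_normed,
    integral_indicator_unitSquare_mul v fun t => partialY (ρ.normed volume) (q - t),
    integral_indicator_unitSquare_mul (partialY v) fun t => ρ.normed volume (q - t)]
  have h := hv.integral_mul_partialY hN (φ := fun t => ρ.normed volume (q - t))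
    (hs.comp (contDiff_const.sub contDiff_id))
  simp only [partialY_comp_const_sub hs, mul_neg, integral_neg, neg_inj] at h
  exact h

/-- The center of the unit square. -/
noncomputable def squareCenter : ℝ × ℝ := (1 / 2, 1 / 2)

lemma unitSquare_eq_ball : unitSquare = Metric.ball squareCenter (1 / 2) := by
  rw [squareCenter, ← ball_prod_same, Real.ball_eq_Ioo, unitSquare]
  norm_num

lemma mollify_eq_zero {ρ : ContDiffBump (0 : ℝ × ℝ)} {g : ℝ × ℝ → ℝ} {q : ℝ × ℝ}
    (hq : 1 / 2 + ρ.rOut ≤ dist q squareCenter) : mollify ρ g q = 0 := by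
  rw [mollify]
  refine integral_eq_zero_of_ae (Filter.Eventually.of_forall fun t => ?_)
  by_cases ht : t ∈ unitSquare
  · have h1 : dist t squareCenter < 1 / 2 := by rwa [unitSquare_eq_ball, Metric.mem_ball] at ht
    have h2 : q - t ∉ Function.support (ρ.normed (volume : Measure (ℝ × ℝ))) := by
      rw [ρ.support_normed_eq, Metric.mem_ball, dist_zero_right, ← dist_eq_norm, not_lt]
      linarith [dist_triangle q t squareCenter]
    simp [Function.notMem_support.1 h2]
  · simp [ht]

/-- The dilation about the center of the square with factor `1 + 4r`. It moves a neighbourhood of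
the boundary of the square to points that have a distance of at least `r` from the square. -/
noncomputable def dilate (r : ℝ) (p : ℝ × ℝ) : ℝ × ℝ := (-(4 * r)) • squareCenter + (1 + 4 * r) • p

lemma dist_dilate {r : ℝ} (hr : 0 ≤ r) (p : ℝ × ℝ) :
    dist (dilate r p) squareCenter = (1 + 4 * r) * dist p squareCenter := by
  have e : dilate r p - squareCenter = (1 + 4 * r) • (p - squareCenter) := by
    rw [dilate]; module
  rw [dist_eq_norm, dist_eq_norm, e, norm_smul, Real.norm_eq_abs, abs_of_nonneg (by linarith)]

lemma isTestFunction_mollify_dilate (ρ : ContDiffBump (0 : ℝ × ℝ)) {g : ℝ × ℝ → ℝ}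
    (hg : IntegrableOn g unitSquare) :
    IsTestFunction unitSquare fun p => mollify ρ g (dilate ρ.rOut p) := by
  have hr := ρ.rOut_pos
  set s := (1 / 2 + ρ.rOut) / (1 + 4 * ρ.rOut) with hs
  have hs2 : s < 1 / 2 := by rw [hs, div_lt_iff₀ (by linarith)]; linarith
  have hsub : tsupport (fun p => mollify ρ g (dilate ρ.rOut p)) ⊆
      Metric.closedBall squareCenter s := by
    refine closure_minimal (fun p hp => ?_) Metric.isClosed_closedBall
    rw [Metric.mem_closedBall]
    by_contra hc
    refine hp (mollify_eq_zero ?_)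
    rw [dist_dilate hr.le, ← div_le_iff₀' (by linarith)]
    exact (not_le.1 hc).le
  refine ⟨(contDiff_mollify ρ hg).comp (by unfold dilate; fun_prop), ?_, ?_⟩
  · exact (isCompact_closedBall _ _).of_isClosed_subset (isClosed_tsupport _) hsub
  · refine hsub.trans ?_
    rw [unitSquare_eq_ball]
    exact Metric.closedBall_subset_ball hs2

/-- Dominated convergence for the mollified dilations. -/
lemma tendsto_integral_mollify_sq {ρ : ℕ → ContDiffBump (0 : ℝ × ℝ)}
    (hρ : Filter.Tendsto (fun n => (ρ n).rOut) Filter.atTop (nhds 0)) {g : ℝ × ℝ → ℝ}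
    (hg : IntegrableOn g unitSquare) {B : ℝ} (hB : 0 ≤ B)
    (hgB : ∀ᵐ p ∂(volume.restrict unitSquare), |g p| ≤ B)
    (hgc : ∀ᵐ p ∂(volume.restrict unitSquare), ContinuousAt g p)
    {a : ℕ → ℝ} (ha : Filter.Tendsto a Filter.atTop (nhds 1)) (ha5 : ∀ n, |a n| ≤ 5) :
    Filter.Tendsto (fun n => ∫ p in unitSquare,
      (g p - a n * mollify (ρ n) g (dilate (ρ n).rOut p)) ^ 2) Filter.atTop (nhds 0) := by
  have h0 : ∫ p in unitSquare, (0 : ℝ) = 0 := by simp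
  rw [← h0]
  refine tendsto_integral_of_dominated_convergence (fun _ => (6 * B) ^ 2) ?_
    (integrable_const _) ?_ ?_
  · intro n
    refine (hg.1.sub ?_).pow 2
    have : Continuous fun p => a n * mollify (ρ n) g (dilate (ρ n).rOut p) :=
      continuous_const.mul ((contDiff_mollify (ρ n) hg).continuous.comp
        (by unfold dilate; fun_prop))
    exact this.aestronglyMeasurable
  · intro n
    filter_upwards [hgB] with p hp
    rw [Real.norm_eq_abs, abs_pow]
    gcongr
    have h1 := abs_mollify_le (ρ n) hB hgB (dilate (ρ n).rOut p)
    calc _ ≤ |g p| + |a n| * |mollify (ρ n) g (dilate (ρ n).rOut p)| := by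
          rw [← abs_mul]; exact abs_sub _ _
      _ ≤ B + 5 * B := by gcongr; exact ha5 n
      _ = 6 * B := by ring
  · filter_upwards [hgc, ae_restrict_mem isOpen_unitSquare.measurableSet] with p hp hpU
    have hq : Filter.Tendsto (fun n => dilate (ρ n).rOut p) Filter.atTop (nhds p) := by
      have : Filter.Tendsto (fun n => dilate (ρ n).rOut p) Filter.atTop (nhds (dilate 0 p)) := by
        have hc : Continuous fun r => dilate r p := by unfold dilate; fun_prop
        exact (hc.tendsto 0).comp hρ
      simpa [dilate] using this
    have := (((tendsto_const_nhds (x := g p)).sub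
      (ha.mul (tendsto_mollify hρ hg hpU hp hq))).pow 2)
    simpa using this

/-- The possible discontinuities of the derivatives lie on the mesh lines. -/
lemma IsPieces.ae_continuousAt {f : Fin N × Fin N → ℝ × ℝ → ℝ} (hf : IsPieces k v f)
    (hN : 1 ≤ N) : ∀ᵐ p ∂(volume.restrict unitSquare),
      ContinuousAt v p ∧ ContinuousAt (partialX v) p ∧ ContinuousAt (partialY v) p := by
  filter_upwards [ae_exists_mem_openCell hN] with p ⟨e, he⟩
  have hmem := (isOpen_openSquare _ _).mem_nhds he
  refine ⟨((hf e).1.continuous.continuousAt).congr (hf.eventuallyEq he).symm,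
    ((hf e).1.partialX.continuous.continuousAt).congr ?_,
    ((hf e).1.partialY.continuous.continuousAt).congr ?_⟩
  · filter_upwards [hmem] with q hq using (hf.partialX_eq hq).symm
  · filter_upwards [hmem] with q hq using (hf.partialY_eq hq).symm

lemma IsTestFunction.isWeakDeriv {U : Set (ℝ × ℝ)} {φ : ℝ × ℝ → ℝ} (h : IsTestFunction U φ) :
    IsWeakDeriv U 1 0 φ (_root_.partialX φ) ∧ IsWeakDeriv U 0 1 φ (_root_.partialY φ) :=
  ⟨by simpa using h.1.isWeakDeriv (U := U) 1 0, by simpa using h.1.isWeakDeriv (U := U) 0 1⟩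

/-- Conforming finite element functions lie in `H₀¹`: the test functions are obtained by
mollification, after a dilation that pushes the support into the open square. -/
lemma MemVh0.memH10 (hv : MemVh0 k N v) (hN : 1 ≤ N) : MemH10 unitSquare v := by
  refine ⟨hv.memSobolev hN, fun ε hε => ?_⟩
  obtain ⟨f, hf⟩ := hv.1.exists_isPieces
  obtain ⟨B, hB⟩ := hf.exists_bound
  obtain ⟨m0, m1, m2⟩ := hv.memLp hN 2
  obtain ⟨d1, d2⟩ := hv.isWeakDeriv hN
  have i0 := MemLp.integrable_unitSquare m0
  have i1 := MemLp.integrable_unitSquare m1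
  have i2 := MemLp.integrable_unitSquare m2
  have hcont := hf.ae_continuousAt hN
  have hbd : ∀ᵐ p ∂(volume.restrict unitSquare),
      |v p| ≤ |B| ∧ |partialX v p| ≤ |B| ∧ |partialY v p| ≤ |B| := by
    filter_upwards [ae_exists_mem_openCell hN] with p ⟨e, he⟩
    have := hB e p he
    exact ⟨this.1.trans (le_abs_self B), this.2.1.trans (le_abs_self B),
      this.2.2.trans (le_abs_self B)⟩
  have hrpos : ∀ n : ℕ, (0 : ℝ) < 1 / ((n : ℝ) + 1) := fun n => by positivity
  let ρ : ℕ → ContDiffBump (0 : ℝ × ℝ) := fun n =>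
    ⟨1 / ((n : ℝ) + 1) / 2, 1 / ((n : ℝ) + 1), by linarith [hrpos n], by linarith [hrpos n]⟩
  have hρ : Filter.Tendsto (fun n => (ρ n).rOut) Filter.atTop (nhds 0) :=
    tendsto_one_div_add_atTop_nhds_zero_nat
  -- The factor that the dilation contributes to the derivatives.
  let a : ℕ → ℝ := fun n => 1 + 4 * (ρ n).rOut
  have ha : Filter.Tendsto a Filter.atTop (nhds 1) := by
    simpa using (hρ.const_mul 4).const_add 1
  have ha5 : ∀ n, |a n| ≤ 5 := by
    intro n
    have h1 : (ρ n).rOut ≤ 1 := by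
      change 1 / ((n : ℝ) + 1) ≤ 1
      rw [div_le_one (by positivity)]; linarith [(Nat.cast_nonneg n : (0 : ℝ) ≤ n)]
    have h2 := (ρ n).rOut_pos
    rw [abs_of_nonneg (by simp only [a]; linarith)]
    simp only [a]; linarith
  let φ : ℕ → ℝ × ℝ → ℝ := fun n p => mollify (ρ n) v (dilate (ρ n).rOut p)
  have hφ : ∀ n, IsTestFunction unitSquare (φ n) := fun n =>
    isTestFunction_mollify_dilate (ρ n) i0
  have hφx : ∀ n p, partialX (φ n) p =
      a n * mollify (ρ n) (partialX v) (dilate (ρ n).rOut p) := by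
    intro n p
    rw [← hv.partialX_mollify hN]
    exact partialX_comp_affine (contDiff_mollify (ρ n) i0) _ _ p
  have hφy : ∀ n p, partialY (φ n) p =
      a n * mollify (ρ n) (partialY v) (dilate (ρ n).rOut p) := by
    intro n p
    rw [← hv.partialY_mollify hN]
    exact partialY_comp_affine (contDiff_mollify (ρ n) i0) _ _ p
  have hnorm : ∀ n, sobolevNorm unitSquare 1 (v - φ n) ^ 2 =
      (∫ p in unitSquare, (v p - 1 * mollify (ρ n) v (dilate (ρ n).rOut p)) ^ 2) +
      (∫ p in unitSquare,
        (partialX v p - a n * mollify (ρ n) (partialX v) (dilate (ρ n).rOut p)) ^ 2) +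
      ∫ p in unitSquare,
        (partialY v p - a n * mollify (ρ n) (partialY v) (dilate (ρ n).rOut p)) ^ 2 := by
    intro n
    rw [sobolevNorm_one_sq isOpen_unitSquare (d1.sub (hφ n).isWeakDeriv.1)
      (d2.sub (hφ n).isWeakDeriv.2)]
    simp only [Pi.sub_apply, hφx, hφy, one_mul]
    rfl
  have hlim : Filter.Tendsto (fun n => sobolevNorm unitSquare 1 (v - φ n) ^ 2) Filter.atTop
      (nhds 0) := by
    simp only [hnorm]
    have t0 := tendsto_integral_mollify_sq hρ i0 (abs_nonneg B) (hbd.mono fun p h => h.1)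
      (hcont.mono fun p h => h.1) (a := fun _ => 1) tendsto_const_nhds (fun _ => by norm_num)
    have t1 := tendsto_integral_mollify_sq hρ i1 (abs_nonneg B) (hbd.mono fun p h => h.2.1)
      (hcont.mono fun p h => h.2.1) ha ha5
    have t2 := tendsto_integral_mollify_sq hρ i2 (abs_nonneg B) (hbd.mono fun p h => h.2.2)
      (hcont.mono fun p h => h.2.2) ha ha5
    simpa using (t0.add t1).add t2
  obtain ⟨n, hn⟩ := (hlim.eventually (gt_mem_nhds (show (0 : ℝ) < ε ^ 2 by positivity))).exists
  exact ⟨φ n, hφ n, lt_of_pow_lt_pow_left₀ 2 hε.le hn⟩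

end FiniteElementsH10

/-! ### Absolute continuity on lines -/

section Lines

/-- Lebesgue measure on the unit interval. -/
noncomputable def unitMeasure : Measure ℝ := volume.restrict (Set.Ioo 0 1)

instance : IsProbabilityMeasure unitMeasure := ⟨by simp [unitMeasure]⟩

lemma restrict_unitSquare : (volume.restrict unitSquare : Measure (ℝ × ℝ)) =
    unitMeasure.prod unitMeasure := by
  rw [unitMeasure, Measure.prod_restrict]; rfl

lemma integral_unitMeasure (f : ℝ → ℝ) : ∫ t, f t ∂unitMeasure = ∫ t in (0 : ℝ)..1, f t := by
  rw [intervalIntegral.integral_of_le zero_le_one, integral_Ioc_eq_integral_Ioo, unitMeasure]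

lemma integrable_unitMeasure_iff {f : ℝ → ℝ} :
    Integrable f unitMeasure ↔ IntervalIntegrable f volume 0 1 := by
  rw [intervalIntegrable_iff_integrableOn_Ioo_of_le zero_le_one]; rfl

lemma ae_unitMeasure_mem : ∀ᵐ x ∂unitMeasure, x ∈ Set.Ioo (0 : ℝ) 1 :=
  ae_restrict_mem measurableSet_Ioo

/-- The primitive in the second variable, `∫₀ʸ g(x,t) dt`. -/
noncomputable def primY (g : ℝ × ℝ → ℝ) (p : ℝ × ℝ) : ℝ := ∫ t in (0 : ℝ)..p.2, g (p.1, t)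

/-- The primitive in the first variable, `∫₀ˣ g(s,y) ds`. -/
noncomputable def primX (g : ℝ × ℝ → ℝ) (p : ℝ × ℝ) : ℝ := ∫ s in (0 : ℝ)..p.1, g (s, p.2)

lemma abs_intervalIntegral_le {f : ℝ → ℝ} (hf : IntervalIntegrable f volume 0 1) {y : ℝ}
    (hy : y ∈ Set.Icc (0 : ℝ) 1) : |∫ t in (0 : ℝ)..y, f t| ≤ ∫ t in (0 : ℝ)..1, |f t| := by
  refine (intervalIntegral.abs_integral_le_integral_abs hy.1).trans ?_
  exact intervalIntegral.integral_mono_interval le_rfl hy.1 hy.2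
    (Filter.Eventually.of_forall fun _ => abs_nonneg _) hf.abs

lemma aestronglyMeasurable_primY {g : ℝ × ℝ → ℝ} (hg : IntegrableOn g unitSquare) :
    AEStronglyMeasurable (primY g) (volume.restrict unitSquare) := by
  have hg' : AEStronglyMeasurable g (unitMeasure.prod unitMeasure) := by
    rw [← restrict_unitSquare]; exact hg.1
  have hq : Measure.QuasiMeasurePreserving (fun z : (ℝ × ℝ) × ℝ => (z.1.1, z.2))
      ((unitMeasure.prod unitMeasure).prod unitMeasure) (unitMeasure.prod unitMeasure) :=
    MeasureTheory.QuasiMeasurePreserving.prodMap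
      (Measure.quasiMeasurePreserving_fst (μ := unitMeasure) (ν := unitMeasure))
      (Measure.QuasiMeasurePreserving.id unitMeasure)
  have h1 := hg'.comp_quasiMeasurePreserving hq
  have hms : MeasurableSet {z : (ℝ × ℝ) × ℝ | z.2 ∈ Set.Ioc 0 z.1.2} := by
    have : {z : (ℝ × ℝ) × ℝ | z.2 ∈ Set.Ioc 0 z.1.2} = {z | 0 < z.2} ∩ {z | z.2 ≤ z.1.2} := rfl
    rw [this]
    exact (measurableSet_lt measurable_const measurable_snd).inter
      (measurableSet_le measurable_snd (measurable_snd.comp measurable_fst))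
  have h2 := (h1.indicator hms).integral_prod_right'
  rw [restrict_unitSquare]
  refine h2.congr ?_
  rw [← restrict_unitSquare]
  filter_upwards [ae_restrict_mem isOpen_unitSquare.measurableSet] with p hp
  rw [primY, intervalIntegral.integral_of_le hp.2.1.le, unitMeasure,
    ← integral_Ioc_eq_integral_Ioo, ← integral_indicator measurableSet_Ioc,
    ← integral_indicator measurableSet_Ioc]
  congr 1
  ext t
  by_cases ht : t ∈ Set.Ioc 0 p.2
  · have ht1 : t ∈ Set.Ioc (0 : ℝ) 1 := ⟨ht.1, ht.2.trans hp.2.2.le⟩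
    rw [Set.indicator_of_mem ht1, Set.indicator_of_mem ht,
      Set.indicator_of_mem (by exact ht)]
    rfl
  · rw [Set.indicator_of_notMem ht]
    by_cases ht1 : t ∈ Set.Ioc (0 : ℝ) 1
    · rw [Set.indicator_of_mem ht1, Set.indicator_of_notMem (by exact ht)]
    · rw [Set.indicator_of_notMem ht1]

lemma integrable_prod_unitMeasure {g : ℝ × ℝ → ℝ} (hg : IntegrableOn g unitSquare) :
    Integrable g (unitMeasure.prod unitMeasure) := by
  rw [← restrict_unitSquare]; exact hg

lemma setIntegral_unitSquare {g : ℝ × ℝ → ℝ} (hg : IntegrableOn g unitSquare) :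
    ∫ p in unitSquare, g p = ∫ x, ∫ y, g (x, y) ∂unitMeasure ∂unitMeasure := by
  rw [restrict_unitSquare, integral_prod _ (integrable_prod_unitMeasure hg)]

lemma ae_ae_of_ae_unitSquare {P : ℝ × ℝ → Prop} (h : ∀ᵐ p ∂(volume.restrict unitSquare), P p) :
    ∀ᵐ x ∂unitMeasure, ∀ᵐ y ∂unitMeasure, P (x, y) := by
  rw [restrict_unitSquare] at h
  exact Measure.ae_ae_of_ae_prod h

lemma integrableOn_primY {g : ℝ × ℝ → ℝ} (hg : IntegrableOn g unitSquare) :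
    IntegrableOn (primY g) unitSquare := by
  have hg' := integrable_prod_unitMeasure hg
  have hb : Integrable (fun p : ℝ × ℝ => ∫ t, |g (p.1, t)| ∂unitMeasure)
      (unitMeasure.prod unitMeasure) :=
    Integrable.comp_fst (f := fun x => ∫ t, |g (x, t)| ∂unitMeasure) hg'.abs.integral_prod_left _
  rw [← restrict_unitSquare] at hb
  refine hb.mono' (aestronglyMeasurable_primY hg) ?_
  have h1 : ∀ᵐ p ∂(unitMeasure.prod unitMeasure), Integrable (fun t => g (p.1, t)) unitMeasure :=
    Measure.quasiMeasurePreserving_fst.ae hg'.prod_right_ae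
  rw [← restrict_unitSquare] at h1
  filter_upwards [h1, ae_restrict_mem isOpen_unitSquare.measurableSet] with p hp hpU
  rw [integral_unitMeasure, Real.norm_eq_abs, primY]
  exact abs_intervalIntegral_le (integrable_unitMeasure_iff.1 hp) ⟨hpU.2.1.le, hpU.2.2.le⟩

/-- Integration by parts on the unit interval for the primitive of an integrable function. -/
lemma integral_primitive_mul_deriv {g Ψ : ℝ → ℝ} (hg : IntervalIntegrable g volume 0 1)
    (hΨ : ContDiff ℝ 1 Ψ) : ∫ y in (0 : ℝ)..1, (∫ t in (0 : ℝ)..y, g t) * deriv Ψ y =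
      (∫ t in (0 : ℝ)..1, g t) * Ψ 1 - ∫ y in (0 : ℝ)..1, g y * Ψ y := by
  have h1 := hg.absolutelyContinuousOnInterval_intervalIntegral (c := 0) (by simp)
  have h2 : AbsolutelyContinuousOnInterval Ψ 0 1 :=
    hΨ.contDiffOn.absolutelyContinuousOnInterval
  rw [h1.integral_mul_deriv_eq_deriv_mul h2]
  simp only [intervalIntegral.integral_same, zero_mul, sub_zero]
  congr 1
  refine intervalIntegral.integral_congr_ae ?_
  filter_upwards [hg.ae_hasDerivAt_integral] with y hy hy'
  rw [(hy (Set.uIoc_subset_uIcc hy') 0 (by simp)).deriv]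

lemma hasDerivAt_slice_Y {Ψ : ℝ × ℝ → ℝ} (hΨ : ContDiff ℝ ∞ Ψ) (x y : ℝ) :
    HasDerivAt (fun t => Ψ (x, t)) (partialY Ψ (x, y)) y :=
  (hΨ.differentiable (by simp) _).hasFDerivAt.comp_hasDerivAt y
    ((hasDerivAt_const y x).prodMk (hasDerivAt_id y))

lemma integrableOn_mul_continuous {g φ : ℝ × ℝ → ℝ} (hg : IntegrableOn g unitSquare)
    (hφ : Continuous φ) : IntegrableOn (fun p => g p * φ p) unitSquare := by
  have h : IntegrableOn g (closure unitSquare) := by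
    refine hg.congr_set_ae ?_
    rw [unitSquare_eq_openSquare]
    have : closure (openSquare (1 / 2, 1 / 2) (1 / 2)) = closedSquare (1 / 2, 1 / 2) (1 / 2) := by
      rw [← unitSquare_eq_openSquare, closure_unitSquare]; norm_num [closedSquare]
    rw [this]
    exact (openSquare_ae_eq_closedSquare _ _).symm
  exact (h.mul_continuousOn hφ.continuousOn isCompact_closure_unitSquare).mono_set subset_closure

/-- Integration by parts in the second variable; there is no contribution from the bottom side,
where the primitive vanishes. -/
lemma integral_primY_mul_partialY {g Ψ : ℝ × ℝ → ℝ} (hg : IntegrableOn g unitSquare)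
    (hΨ : ContDiff ℝ ∞ Ψ) : ∫ p in unitSquare, primY g p * partialY Ψ p =
      (∫ x, primY g (x, 1) * Ψ (x, 1) ∂unitMeasure) - ∫ p in unitSquare, g p * Ψ p := by
  have hg' := integrable_prod_unitMeasure hg
  rw [setIntegral_unitSquare (integrableOn_mul_continuous (integrableOn_primY hg)
      (partialY_contDiff hΨ).continuous),
    setIntegral_unitSquare (integrableOn_mul_continuous hg hΨ.continuous), ← integral_sub]
  · refine integral_congr_ae ?_
    filter_upwards [hg'.prod_right_ae] with x hx
    have hs : ContDiff ℝ 1 fun t => Ψ (x, t) := (hΨ.of_le (by simp)).comp (by fun_prop)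
    have h := integral_primitive_mul_deriv (integrable_unitMeasure_iff.1 hx) hs
    simp only [(hasDerivAt_slice_Y hΨ x _).deriv] at h
    simp only [integral_unitMeasure]
    exact h
  · have h1 : Integrable (fun x => primY g (x, 1)) unitMeasure := by
      refine hg'.integral_prod_left.congr (Filter.Eventually.of_forall fun x => ?_)
      simp only [integral_unitMeasure, primY]
    have hb : Continuous fun x => Ψ (x, 1) := hΨ.continuous.comp (by fun_prop)
    rw [integrable_unitMeasure_iff] at h1 ⊢
    exact h1.mul_continuousOn hb.continuousOn
  · exact (integrable_prod_unitMeasure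
      (integrableOn_mul_continuous hg hΨ.continuous)).integral_prod_left

/-- The closed square of half width `s` about the center of the unit square. -/
noncomputable def centralBox (s : ℝ) : Set (ℝ × ℝ) := Metric.closedBall squareCenter s

lemma mem_centralBox {s : ℝ} {p : ℝ × ℝ} :
    p ∈ centralBox s ↔ |p.1 - 1 / 2| ≤ s ∧ |p.2 - 1 / 2| ≤ s := by
  rw [centralBox, Metric.mem_closedBall, Prod.dist_eq, max_le_iff]
  rfl

/-- A smooth function is a test function on the unit square if and only if it vanishes off a smaller
concentric square. -/
lemma isTestFunction_unitSquare_iff {φ : ℝ × ℝ → ℝ} : IsTestFunction unitSquare φ ↔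
    ContDiff ℝ ∞ φ ∧ ∃ s < 1 / 2, ∀ p ∉ centralBox s, φ p = 0 := by
  constructor
  · rintro ⟨h1, h2, h3⟩
    refine ⟨h1, ?_⟩
    by_cases hne : (tsupport φ).Nonempty
    · have hc : Continuous fun p => dist p squareCenter := by fun_prop
      obtain ⟨q, hq, hmax⟩ := IsCompact.exists_isMaxOn (s := tsupport φ) h2 hne hc.continuousOn
      have hqU := h3 hq
      rw [unitSquare_eq_ball, Metric.mem_ball] at hqU
      refine ⟨dist q squareCenter, hqU, fun p hp => ?_⟩
      by_contra hc
      exact hp (hmax (subset_tsupport φ hc))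
    · refine ⟨0, by norm_num, fun p _ => ?_⟩
      by_contra hc
      exact hne ⟨p, subset_tsupport φ hc⟩
  · rintro ⟨h1, s, hs, h2⟩
    have hsub : tsupport φ ⊆ centralBox s := by
      refine closure_minimal (fun p hp => ?_) Metric.isClosed_closedBall
      by_contra hc
      exact hp (h2 p hc)
    refine ⟨h1, (isCompact_closedBall _ _).of_isClosed_subset (isClosed_tsupport _) hsub, ?_⟩
    rw [unitSquare_eq_ball]
    exact hsub.trans (Metric.closedBall_subset_ball hs)

open scoped Convolution in
/-- Primitives of test functions are smooth, as convolutions in the second variable with the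
indicator function of `[0, ∞)`. -/
lemma contDiff_primY {φ : ℝ × ℝ → ℝ} (hφ : IsTestFunction unitSquare φ) :
    ContDiff ℝ ∞ (primY φ) := by
  obtain ⟨h1, s, hs, h2⟩ := isTestFunction_unitSquare_iff.1 hφ
  have hz : ∀ x t : ℝ, t ∉ Set.Ioo (0 : ℝ) 1 → φ (x, t) = 0 := by
    intro x t ht
    refine h2 _ fun hc => ht ?_
    have := abs_le.1 (mem_centralBox.1 hc).2
    simp only at this
    constructor <;> linarith
  let f : ℝ → ℝ := (Set.Ici (0 : ℝ)).indicator fun _ => 1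
  have hf : LocallyIntegrable f :=
    (locallyIntegrable_const (1 : ℝ)).indicator measurableSet_Ici
  have h := contDiffOn_convolution_right_with_param_comp (𝕜 := ℝ) (n := ⊤) (μ := volume)
    (ContinuousLinearMap.mul ℝ ℝ)
    (s := (Set.univ : Set (ℝ × ℝ))) (v := Prod.snd) contDiff_snd.contDiffOn (f := f)
    (g := fun p t => φ (p.1, t)) (k := Set.Icc (0 : ℝ) 1) isOpen_univ isCompact_Icc
    (fun p t _ ht => hz p.1 t fun hc => ht ⟨hc.1.le, hc.2.le⟩) hf
    (h1.comp (by fun_prop)).contDiffOn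
  rw [contDiffOn_univ] at h
  convert h using 1
  ext p
  have e : (f ⋆[ContinuousLinearMap.mul ℝ ℝ, volume] fun t => φ (p.1, t)) p.2 =
      ∫ t in Set.Iic p.2, φ (p.1, t) := by
    rw [convolution_eq_swap, ← integral_indicator measurableSet_Iic]
    congr 1
    ext t
    by_cases ht : t ≤ p.2
    · rw [Set.indicator_of_mem (by exact ht)]
      simp [f, ht]
    · rw [Set.indicator_of_notMem (by exact ht)]
      simp [f, ht]
  rw [e, primY]
  have hc : Continuous fun t => φ (p.1, t) := h1.continuous.comp (by fun_prop)
  have hcs : HasCompactSupport fun t => φ (p.1, t) :=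
    HasCompactSupport.intro isCompact_Icc fun t ht => hz p.1 t fun hc => ht ⟨hc.1.le, hc.2.le⟩
  have hi : Integrable (fun t => φ (p.1, t)) := hc.integrable_of_hasCompactSupport hcs
  rw [← intervalIntegral.integral_Iic_sub_Iic hi.integrableOn hi.integrableOn]
  have : ∫ t in Set.Iic (0 : ℝ), φ (p.1, t) = 0 := by
    refine setIntegral_eq_zero_of_forall_eq_zero fun t ht => hz _ _ fun hc => ?_
    exact absurd hc.1 (not_lt.2 ht)
  rw [this, sub_zero]

lemma partialY_primY {φ : ℝ × ℝ → ℝ} (hφ : IsTestFunction unitSquare φ) (p : ℝ × ℝ) :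
    partialY (primY φ) p = φ p := by
  have h1 := hasDerivAt_slice_Y (contDiff_primY hφ) p.1 p.2
  have hc : Continuous fun t => φ (p.1, t) := hφ.continuous.comp (by fun_prop)
  have h2 : HasDerivAt (fun y => primY φ (p.1, y)) (φ (p.1, p.2)) p.2 :=
    intervalIntegral.integral_hasDerivAt_right (hc.intervalIntegrable _ _)
      hc.aestronglyMeasurable.stronglyMeasurableAtFilter hc.continuousAt
  exact h1.unique h2

end Lines

/-! ### Functions with integrable weak derivatives -/

section Representation

/-- The fundamental lemma of the calculus of variations on the unit interval. -/
lemma ae_eq_zero_of_integral_mul_smooth {c : ℝ → ℝ} (hc : Integrable c unitMeasure)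
    (h : ∀ η : ℝ → ℝ, ContDiff ℝ ∞ η → ∫ x, c x * η x ∂unitMeasure = 0) :
    ∀ᵐ x ∂unitMeasure, c x = 0 := by
  have hl : LocallyIntegrableOn c (Set.Ioo (0 : ℝ) 1) :=
    IntegrableOn.locallyIntegrableOn hc
  have := isOpen_Ioo.ae_eq_zero_of_integral_contDiff_smul_eq_zero hl fun η h1 h2 h3 => ?_
  · rw [unitMeasure, ae_restrict_iff' measurableSet_Ioo]
    exact this
  · rw [← h η h1, unitMeasure]
    symm
    simp only [smul_eq_mul, mul_comm]
    apply setIntegral_eq_integral_of_forall_compl_eq_zero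
    intro p hp
    simp [image_eq_zero_of_notMem_tsupport fun hc => hp (h3 hc)]

/-- An integrable function whose primitive is constant almost everywhere vanishes. -/
lemma ae_eq_zero_of_primitive_const {c : ℝ → ℝ} {D : ℝ} (hc : Integrable c unitMeasure)
    (h : ∀ᵐ x ∂unitMeasure, ∫ t in (0 : ℝ)..x, c t = D) : ∀ᵐ x ∂unitMeasure, c x = 0 := by
  have hi := integrable_unitMeasure_iff.1 hc
  have hcont : ContinuousOn (fun x => ∫ t in (0 : ℝ)..x, c t) (Set.uIcc 0 1) :=
    intervalIntegral.continuousOn_primitive_interval' hi (by simp)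
  rw [Set.uIcc_of_le zero_le_one] at hcont
  have heq : Set.EqOn (fun x => ∫ t in (0 : ℝ)..x, c t) (fun _ => D) (Set.Ioo 0 1) :=
    Measure.eqOn_open_of_ae_eq (μ := volume) h isOpen_Ioo (hcont.mono Set.Ioo_subset_Icc_self)
      continuousOn_const
  have hd := hi.ae_hasDerivAt_integral
  rw [unitMeasure, ae_restrict_iff' measurableSet_Ioo]
  filter_upwards [hd] with x hx hxI
  have h1 := hx (by rw [Set.uIcc_of_le zero_le_one]; exact Set.Ioo_subset_Icc_self hxI) 0 (by simp)
  have h2 : HasDerivAt (fun x => ∫ t in (0 : ℝ)..x, c t) 0 x :=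
    (hasDerivAt_const x D).congr_of_eventuallyEq
      (Filter.eventually_of_mem (isOpen_Ioo.mem_nhds hxI) heq)
  exact h1.unique h2

lemma integrableOn_comp_swap {u : ℝ × ℝ → ℝ} (hu : IntegrableOn u unitSquare) :
    IntegrableOn (u ∘ Prod.swap) unitSquare := by
  rw [IntegrableOn, restrict_unitSquare] at *
  exact hu.swap

lemma ae_unitSquare_swap {P : ℝ × ℝ → Prop} (h : ∀ᵐ p ∂(volume.restrict unitSquare), P p) :
    ∀ᵐ p ∂(volume.restrict unitSquare), P p.swap := by
  rw [restrict_unitSquare] at *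
  exact (Measure.measurePreserving_swap (μ := unitMeasure)
    (ν := unitMeasure)).quasiMeasurePreserving.ae h

lemma isTestFunction_comp_swap {φ : ℝ × ℝ → ℝ} (hφ : IsTestFunction unitSquare φ) :
    IsTestFunction unitSquare (φ ∘ Prod.swap) := by
  obtain ⟨h1, s, hs, h2⟩ := isTestFunction_unitSquare_iff.1 hφ
  refine isTestFunction_unitSquare_iff.2 ⟨h1.comp (contDiff_snd.prodMk contDiff_fst), s, hs,
    fun p hp => h2 _ fun hc => hp ?_⟩
  rw [mem_centralBox] at hc ⊢
  exact ⟨hc.2, hc.1⟩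

lemma IsWeakDeriv.comp_swap {u g : ℝ × ℝ → ℝ} (hu : IntegrableOn u unitSquare)
    (hg : IntegrableOn g unitSquare) (h : IsWeakDeriv unitSquare 1 0 u g) :
    IsWeakDeriv unitSquare 0 1 (u ∘ Prod.swap) (g ∘ Prod.swap) := by
  refine ⟨(integrableOn_comp_swap hu).locallyIntegrableOn,
    (integrableOn_comp_swap hg).locallyIntegrableOn, fun φ hφ => ?_⟩
  have h1 := h.2.2 _ (isTestFunction_comp_swap hφ)
  rw [← setIntegral_unitSquare_swap, ← setIntegral_unitSquare_swap (fun p => g p * _)] at h1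
  simpa [partialX_comp_swap] using h1

/-- The primitive of a test function with mean value zero on every vertical line is a test function,
for it vanishes above the support as well as below it. -/
lemma isTestFunction_primY {ψ : ℝ × ℝ → ℝ} (hψ : IsTestFunction unitSquare ψ)
    (h0 : ∀ x, primY ψ (x, 1) = 0) : IsTestFunction unitSquare (primY ψ) := by
  obtain ⟨h1, s, hs, h2⟩ := isTestFunction_unitSquare_iff.1 hψ
  refine isTestFunction_unitSquare_iff.2 ⟨contDiff_primY hψ, s, hs, fun p hp => ?_⟩
  have hc : Continuous fun t => ψ (p.1, t) := hψ.continuous.comp (by fun_prop)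
  rw [mem_centralBox, not_and_or, not_le, not_le] at hp
  have hp' : s < |p.1 - 1 / 2| ∨ s < p.2 - 1 / 2 ∨ s < -(p.2 - 1 / 2) := hp.imp id lt_abs.1
  rcases hp' with hp | hp | hp
  · refine intervalIntegral.integral_zero_ae (Filter.Eventually.of_forall fun t _ => h2 _ ?_)
    rw [mem_centralBox]
    exact fun h => absurd h.1 (not_le.2 hp)
  · rw [primY, ← intervalIntegral.integral_add_adjacent_intervals (b := 1)
      (hc.intervalIntegrable _ _) (hc.intervalIntegrable _ _)]
    have e : ∫ t in (0 : ℝ)..1, ψ (p.1, t) = 0 := h0 p.1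
    rw [e, zero_add]
    refine intervalIntegral.integral_zero_ae (Filter.Eventually.of_forall fun t ht => h2 _ ?_)
    rw [mem_centralBox]
    rintro ⟨-, h⟩
    have h3 := (abs_le.1 h).2
    rcases Set.mem_uIoc.1 ht with h4 | h4 <;> simp only at h3 <;> linarith [h4.1]
  · refine intervalIntegral.integral_zero_ae (Filter.Eventually.of_forall fun t ht => h2 _ ?_)
    rw [mem_centralBox]
    rintro ⟨-, h⟩
    have h3 := (abs_le.1 h).1
    rcases Set.mem_uIoc.1 ht with h4 | h4 <;> simp only at h3 <;> linarith [h4.2]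

/-- A function with an integrable weak `y`-derivative is absolutely continuous in `y`, after
modification on a null set. The proof tests with the primitives of those test functions that have
mean value zero on every vertical line. -/
lemma IsWeakDeriv.exists_eq_add_primY {u g : ℝ × ℝ → ℝ} (hu : IntegrableOn u unitSquare)
    (hg : IntegrableOn g unitSquare) (h : IsWeakDeriv unitSquare 0 1 u g) :
    ∃ c : ℝ → ℝ, Integrable c unitMeasure ∧
      ∀ᵐ p ∂(volume.restrict unitSquare), u p = c p.1 + primY g p := by
  have hP := integrableOn_primY hg
  set z : ℝ × ℝ → ℝ := fun p => u p - primY g p with hzdef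
  have hz : IntegrableOn z unitSquare := hu.sub hP
  have key : ∀ ψ, IsTestFunction unitSquare ψ → (∀ x, primY ψ (x, 1) = 0) →
      ∫ p in unitSquare, z p * ψ p = 0 := by
    intro ψ hψ h0
    have e1 := h.2.2 _ (isTestFunction_primY hψ h0)
    have e2 := integral_primY_mul_partialY hg (contDiff_primY hψ)
    simp only [h0, mul_zero, integral_zero, zero_sub, partialY_primY hψ] at e2
    simp only [Function.iterate_zero, Function.iterate_one, id, partialY_primY hψ, zero_add,
      pow_one, neg_one_mul] at e1
    simp only [hzdef, sub_mul]
    rw [integral_sub (integrableOn_mul_continuous hu hψ.continuous)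
      (integrableOn_mul_continuous hP hψ.continuous), e1, e2, sub_self]
  -- A test function `φ` is made admissible by subtracting `r(y) ∫ φ(x,t) dt`, where `r` is a bump
  -- with integral one. So `z` equals its average with weight `r` over vertical lines.
  let ρ : ContDiffBump (1 / 2 : ℝ) := ⟨1 / 8, 1 / 4, by norm_num, by norm_num⟩
  let r : ℝ → ℝ := ρ.normed volume
  have hr : ContDiff ℝ ∞ r := ρ.contDiff_normed
  have hr0 : ∀ t, 1 / 4 < |t - 1 / 2| → r t = 0 := by
    intro t ht
    refine Function.notMem_support.1 fun hc => ?_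
    rw [ρ.support_normed_eq, Metric.mem_ball, Real.dist_eq] at hc
    exact absurd hc (not_lt.2 ht.le)
  have hr1 : ∫ t in (0 : ℝ)..1, r t = 1 := by
    have h1 : ∫ t, r t = 1 := ρ.integral_normed
    rw [intervalIntegral.integral_of_le zero_le_one, ← h1]
    apply setIntegral_eq_integral_of_forall_compl_eq_zero
    intro t ht
    refine hr0 t ?_
    by_contra hc
    have := abs_le.1 (not_lt.1 hc)
    exact ht ⟨by linarith, by linarith⟩
  let c : ℝ → ℝ := fun x => ∫ y, z (x, y) * r y ∂unitMeasure
  have hci : Integrable c unitMeasure :=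
    (integrable_prod_unitMeasure (integrableOn_mul_continuous hz
      (φ := fun p => r p.2) (hr.continuous.comp continuous_snd))).integral_prod_left
  refine ⟨c, hci, ?_⟩
  have hcΩ : IntegrableOn (fun p : ℝ × ℝ => c p.1) unitSquare := by
    rw [IntegrableOn, restrict_unitSquare]
    exact hci.comp_fst _
  have hw : IsWeakDeriv unitSquare 0 0 z fun p => c p.1 := by
    refine ⟨hz.locallyIntegrableOn, hcΩ.locallyIntegrableOn, fun φ hφ => ?_⟩
    simp only [Function.iterate_zero, id, add_zero, pow_zero, one_mul]
    set m : ℝ → ℝ := fun x => primY φ (x, 1) with hm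
    have hms : ContDiff ℝ ∞ m := (contDiff_primY hφ).comp (by fun_prop)
    have hψ : IsTestFunction unitSquare fun p => φ p - r p.2 * m p.1 := by
      obtain ⟨h1, s, hs, h2⟩ := isTestFunction_unitSquare_iff.1 hφ
      refine isTestFunction_unitSquare_iff.2 ⟨h1.sub ((hr.comp contDiff_snd).mul
        (hms.comp contDiff_fst)), max s (1 / 4), max_lt hs (by norm_num), fun p hp => ?_⟩
      rw [mem_centralBox] at hp
      have e1 : φ p = 0 := h2 p fun hc => hp
        ⟨(mem_centralBox.1 hc).1.trans (le_max_left _ _),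
          (mem_centralBox.1 hc).2.trans (le_max_left _ _)⟩
      have e2 : r p.2 * m p.1 = 0 := by
        rcases not_and_or.1 hp with h3 | h3
        · have : m p.1 = 0 := by
            refine intervalIntegral.integral_zero_ae
              (Filter.Eventually.of_forall fun t _ => h2 _ fun hc => h3 ?_)
            exact (mem_centralBox.1 hc).1.trans (le_max_left _ _)
          rw [this, mul_zero]
        · rw [hr0 p.2 ((le_max_right _ _).trans_lt (not_le.1 h3)), zero_mul]
      rw [e1, e2, sub_zero]
    have h0 : ∀ x, primY (fun p => φ p - r p.2 * m p.1) (x, 1) = 0 := by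
      intro x
      have hc : Continuous fun t => φ (x, t) := hφ.continuous.comp (by fun_prop)
      have hc' : Continuous fun t => r t * m x := hr.continuous.mul continuous_const
      rw [primY]
      simp only
      rw [intervalIntegral.integral_sub (hc.intervalIntegrable _ _) (hc'.intervalIntegrable _ _),
        intervalIntegral.integral_mul_const, hr1, one_mul, sub_eq_zero]
      rfl
    have e := key _ hψ h0
    have iφ := integrableOn_mul_continuous hz hφ.continuous
    have ir := integrableOn_mul_continuous hz (φ := fun p => r p.2 * m p.1)
      ((hr.continuous.comp continuous_snd).mul (hms.continuous.comp continuous_fst))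
    simp only [mul_sub] at e
    rw [integral_sub iφ ir, sub_eq_zero] at e
    rw [e, setIntegral_unitSquare ir,
      setIntegral_unitSquare (integrableOn_mul_continuous hcΩ hφ.continuous)]
    refine integral_congr_ae (Filter.Eventually.of_forall fun x => ?_)
    simp only [← mul_assoc]
    rw [integral_mul_const, integral_const_mul]
    congr 1
    rw [integral_unitMeasure]
    rfl
  have := (isWeakDeriv_zero_zero hz.locallyIntegrableOn).ae_eq isOpen_unitSquare hw
  filter_upwards [this] with p hp
  rw [← hp, hzdef]; ring

lemma IsWeakDeriv.exists_eq_add_primX {u g : ℝ × ℝ → ℝ} (hu : IntegrableOn u unitSquare)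
    (hg : IntegrableOn g unitSquare) (h : IsWeakDeriv unitSquare 1 0 u g) :
    ∃ c : ℝ → ℝ, Integrable c unitMeasure ∧
      ∀ᵐ p ∂(volume.restrict unitSquare), u p = c p.2 + primX g p := by
  obtain ⟨c, hc, H⟩ := (h.comp_swap hu hg).exists_eq_add_primY (integrableOn_comp_swap hu)
    (integrableOn_comp_swap hg)
  exact ⟨c, hc, ae_unitSquare_swap H⟩

/-- If the integration by parts formula holds without boundary terms, then the primitive of the
derivative recovers the function, and it vanishes at the other end. -/
lemma eq_primY_of_integral_mul_partialY {u g : ℝ × ℝ → ℝ} (hu : IntegrableOn u unitSquare)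
    (hg : IntegrableOn g unitSquare) (H : ∀ Ψ : ℝ × ℝ → ℝ, ContDiff ℝ ∞ Ψ →
      ∫ p in unitSquare, u p * partialY Ψ p = - ∫ p in unitSquare, g p * Ψ p) :
    (∀ᵐ p ∂(volume.restrict unitSquare), u p = primY g p) ∧
      ∀ᵐ x ∂unitMeasure, primY g (x, 1) = 0 := by
  have hΓi : Integrable (fun x => primY g (x, 1)) unitMeasure := by
    refine (integrable_prod_unitMeasure hg).integral_prod_left.congr
      (Filter.Eventually.of_forall fun x => ?_)
    simp only [integral_unitMeasure, primY]
  -- Functions of `x` alone show that the integrals of `g` over vertical lines vanish.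
  have hΓ : ∀ᵐ x ∂unitMeasure, primY g (x, 1) = 0 := by
    refine ae_eq_zero_of_integral_mul_smooth hΓi fun η hη => ?_
    have hs : ContDiff ℝ ∞ fun p : ℝ × ℝ => η p.1 := hη.comp contDiff_fst
    have e := H _ hs
    have ez : ∀ p, partialY (fun p : ℝ × ℝ => η p.1) p = 0 := fun p =>
      (hasDerivAt_slice_Y hs p.1 p.2).unique (hasDerivAt_const p.2 (η p.1))
    simp only [ez, mul_zero, integral_zero] at e
    rw [eq_comm, neg_eq_zero, setIntegral_unitSquare
      (integrableOn_mul_continuous hg hs.continuous)] at e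
    rw [← e]
    refine integral_congr_ae (Filter.Eventually.of_forall fun x => ?_)
    simp only
    rw [integral_mul_const, integral_unitMeasure]
    rfl
  refine ⟨?_, hΓ⟩
  have hP := integrableOn_primY hg
  -- The primitive of a test function need not have compact support, but it is smooth.
  have hw : IsWeakDeriv unitSquare 0 0 u (primY g) := by
    refine ⟨hu.locallyIntegrableOn, hP.locallyIntegrableOn, fun φ hφ => ?_⟩
    simp only [Function.iterate_zero, id, add_zero, pow_zero, one_mul]
    have e1 := H _ (contDiff_primY hφ)
    have e2 := integral_primY_mul_partialY hg (contDiff_primY hφ)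
    simp only [partialY_primY hφ] at e1 e2
    rw [e1, e2]
    have : ∫ x, primY g (x, 1) * primY φ (x, 1) ∂unitMeasure = 0 := by
      refine integral_eq_zero_of_ae ?_
      filter_upwards [hΓ] with x hx
      rw [hx, zero_mul, Pi.zero_apply]
    rw [this, zero_sub]
  exact (isWeakDeriv_zero_zero hu.locallyIntegrableOn).ae_eq isOpen_unitSquare hw

lemma eq_primX_of_integral_mul_partialX {u g : ℝ × ℝ → ℝ} (hu : IntegrableOn u unitSquare)
    (hg : IntegrableOn g unitSquare) (H : ∀ Ψ : ℝ × ℝ → ℝ, ContDiff ℝ ∞ Ψ →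
      ∫ p in unitSquare, u p * partialX Ψ p = - ∫ p in unitSquare, g p * Ψ p) :
    (∀ᵐ p ∂(volume.restrict unitSquare), u p = primX g p) ∧
      ∀ᵐ y ∂unitMeasure, primX g (1, y) = 0 := by
  have h := eq_primY_of_integral_mul_partialY (integrableOn_comp_swap hu)
    (integrableOn_comp_swap hg) fun Ψ hΨ => by
      have e := H (Ψ ∘ Prod.swap) (hΨ.comp (contDiff_snd.prodMk contDiff_fst))
      rw [← setIntegral_unitSquare_swap, ← setIntegral_unitSquare_swap (fun p => g p * _)] at e
      simpa [partialX_comp_swap] using e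
  exact ⟨ae_unitSquare_swap h.1, h.2⟩

end Representation

/-! ### The space `H₀¹` and functions in `H² ∩ H₀¹` -/

section HOneZero

lemma abs_integral_mul_le {α : Type*} [MeasurableSpace α] {μ : Measure α} {f g : α → ℝ}
    (hf : MemLp f 2 μ) (hg : MemLp g 2 μ) :
    |∫ x, f x * g x ∂μ| ≤ √(∫ x, f x ^ 2 ∂μ) * √(∫ x, g x ^ 2 ∂μ) := by
  refine (abs_integral_le_integral_abs).trans ?_
  simp only [abs_mul]
  exact integral_abs_mul_le hf hg

lemma memLp_of_continuous {f : ℝ × ℝ → ℝ} (hf : ContinuousOn f (closure unitSquare)) (r : ℝ≥0∞) :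
    MemLp f r (volume.restrict unitSquare) := by
  obtain ⟨B, hB⟩ := isCompact_closure_unitSquare.exists_bound_of_continuousOn hf
  refine MemLp.of_bound ((hf.mono subset_closure).aestronglyMeasurable
    isOpen_unitSquare.measurableSet) B ?_
  filter_upwards [ae_restrict_mem isOpen_unitSquare.measurableSet] with p hp
  exact hB p (subset_closure hp)

variable {w : ℝ × ℝ → ℝ}

/-- The Sobolev seminorm terms are bounded by the norm. -/
lemma integral_sq_le_sobolevNorm_one_sq {u ux uy : ℝ × ℝ → ℝ} {U : Set (ℝ × ℝ)} (hU : IsOpen U)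
    (hx : IsWeakDeriv U 1 0 u ux) (hy : IsWeakDeriv U 0 1 u uy) :
    ∫ p in U, u p ^ 2 ≤ sobolevNorm U 1 u ^ 2 ∧ ∫ p in U, ux p ^ 2 ≤ sobolevNorm U 1 u ^ 2 ∧
      ∫ p in U, uy p ^ 2 ≤ sobolevNorm U 1 u ^ 2 := by
  have h0 : 0 ≤ ∫ p in U, u p ^ 2 := integral_nonneg fun _ => sq_nonneg _
  have h1 : 0 ≤ ∫ p in U, ux p ^ 2 := integral_nonneg fun _ => sq_nonneg _
  have h2 : 0 ≤ ∫ p in U, uy p ^ 2 := integral_nonneg fun _ => sq_nonneg _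
  rw [sobolevNorm_one_sq hU hx hy]
  exact ⟨by linarith, by linarith, by linarith⟩

lemma IsTestFunction.memSobolev {φ : ℝ × ℝ → ℝ} (h : IsTestFunction unitSquare φ) :
    MemSobolev unitSquare 1 2 φ :=
  memSobolev_one h.isWeakDeriv.1 h.isWeakDeriv.2 (memLp_of_continuous h.continuous.continuousOn 2)
    (memLp_of_continuous h.partialX.continuous.continuousOn 2)
    (memLp_of_continuous h.partialY.continuous.continuousOn 2)

lemma eq_zero_of_forall_abs_le {S K : ℝ} (hK : 0 ≤ K) (h : ∀ ε > 0, |S| ≤ ε * K) : S = 0 := by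
  by_contra hS
  have h1 : 0 < |S| := abs_pos.2 hS
  have h2 := h (|S| / (K + 1)) (by positivity)
  have h3 : |S| / (K + 1) * K < |S| := by
    rw [div_mul_eq_mul_div, div_lt_iff₀ (by positivity)]
    nlinarith
  linarith

/-- Integration by parts in `H₀¹` against functions that are smooth up to the boundary. It holds for
test functions, and both sides are continuous in the `H¹` norm. -/
lemma MemH10.integral_mul_partial (hw : MemH10 unitSquare w) {Ψ : ℝ × ℝ → ℝ}
    (hΨ : ContDiff ℝ ∞ Ψ) :
    (∫ p in unitSquare, w p * partialX Ψ p =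
      - ∫ p in unitSquare, weakDeriv unitSquare 1 0 w p * Ψ p) ∧
    ∫ p in unitSquare, w p * partialY Ψ p =
      - ∫ p in unitSquare, weakDeriv unitSquare 0 1 w p * Ψ p := by
  have hU := isOpen_unitSquare
  have m0 := hw.1.memLp hU
  have mx := hw.1.memLp_weakDeriv hU (i := 1) (j := 0) (by norm_num)
  have my := hw.1.memLp_weakDeriv hU (i := 0) (j := 1) (by norm_num)
  have dx := hw.1.isWeakDeriv (i := 1) (j := 0) (by norm_num)
  have dy := hw.1.isWeakDeriv (i := 0) (j := 1) (by norm_num)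
  -- The argument for both derivatives: `D` is the partial derivative, `g` the weak derivative of
  -- `w`, and `q` the partial derivative of `Ψ`.
  have main : ∀ (g q : ℝ × ℝ → ℝ) (D : (ℝ × ℝ → ℝ) → ℝ × ℝ → ℝ),
      MemLp g 2 (volume.restrict unitSquare) → ContDiff ℝ ∞ q →
      (∀ φ, IsTestFunction unitSquare φ → IsTestFunction unitSquare (D φ)) →
      (∀ φ, IsTestFunction unitSquare φ →
        ∫ p in unitSquare, φ p * q p + D φ p * Ψ p = 0) →
      (∀ φ, IsTestFunction unitSquare φ → ∫ p in unitSquare, (g p - D φ p) ^ 2 ≤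
        sobolevNorm unitSquare 1 (w - φ) ^ 2) →
      ∫ p in unitSquare, w p * q p = - ∫ p in unitSquare, g p * Ψ p := by
    intro g q D mg hq hD hz hn
    have mq := memLp_of_continuous hq.continuous.continuousOn 2
    have mΨ := memLp_of_continuous hΨ.continuous.continuousOn 2
    have i1 := integrableOn_mul_continuous (MemLp.integrable_unitSquare m0) hq.continuous
    have i2 := integrableOn_mul_continuous (MemLp.integrable_unitSquare mg) hΨ.continuous
    rw [eq_neg_iff_add_eq_zero, ← integral_add i1 i2]
    refine eq_zero_of_forall_abs_le (K := √(∫ p in unitSquare, q p ^ 2) +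
      √(∫ p in unitSquare, Ψ p ^ 2)) (by positivity) fun ε hε => ?_
    obtain ⟨φ, hφ, hlt⟩ := hw.2 ε hε
    have mφ := memLp_of_continuous hφ.continuous.continuousOn 2
    have mD := memLp_of_continuous (hD φ hφ).continuous.continuousOn 2
    have j1 := integrableOn_mul_continuous (MemLp.integrable_unitSquare (m0.sub mφ)) hq.continuous
    have j2 := integrableOn_mul_continuous (MemLp.integrable_unitSquare (mg.sub mD)) hΨ.continuous
    have e : ∫ p in unitSquare, (w p * q p + g p * Ψ p) =
        (∫ p in unitSquare, (w - φ) p * q p) + ∫ p in unitSquare, (g - D φ) p * Ψ p := by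
      have k1 : IntegrableOn (fun p => w p * q p + g p * Ψ p) unitSquare := i1.add i2
      have k2 : IntegrableOn (fun p => (w - φ) p * q p + (g - D φ) p * Ψ p) unitSquare :=
        j1.add j2
      rw [← integral_add j1 j2, ← sub_eq_zero, ← integral_sub k1 k2, ← hz φ hφ]
      congr 1; ext p; simp only [Pi.sub_apply]; ring
    have hs : √(∫ p in unitSquare, (w - φ) p ^ 2) ≤ ε := by
      rw [← Real.sqrt_sq hε.le]
      refine Real.sqrt_le_sqrt ?_
      have := (integral_sq_le_sobolevNorm_one_sq hU (dx.sub hφ.isWeakDeriv.1)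
        (dy.sub hφ.isWeakDeriv.2)).1
      exact this.trans (pow_le_pow_left₀ (sobolevNorm_nonneg _ _) hlt.le 2)
    have ht : √(∫ p in unitSquare, (g - D φ) p ^ 2) ≤ ε := by
      rw [← Real.sqrt_sq hε.le]
      refine Real.sqrt_le_sqrt ?_
      exact (hn φ hφ).trans (pow_le_pow_left₀ (sobolevNorm_nonneg _ _) hlt.le 2)
    rw [e]
    calc _ ≤ |∫ p in unitSquare, (w - φ) p * q p| + |∫ p in unitSquare, (g - D φ) p * Ψ p| :=
          abs_add_le _ _
      _ ≤ ε * √(∫ p in unitSquare, q p ^ 2) + ε * √(∫ p in unitSquare, Ψ p ^ 2) := by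
          refine add_le_add ((abs_integral_mul_le (m0.sub mφ) mq).trans ?_)
            ((abs_integral_mul_le (mg.sub mD) mΨ).trans ?_)
          · exact mul_le_mul_of_nonneg_right hs (Real.sqrt_nonneg _)
          · exact mul_le_mul_of_nonneg_right ht (Real.sqrt_nonneg _)
      _ = _ := by ring
  constructor
  · refine main _ _ partialX mx (partialX_contDiff hΨ) (fun φ h => h.partialX) (fun φ h => ?_)
      fun φ h => (integral_sq_le_sobolevNorm_one_sq hU (dx.sub h.isWeakDeriv.1)
        (dy.sub h.isWeakDeriv.2)).2.1
    have e := _root_.integral_mul_partialX hΨ h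
    rw [integral_add (integrableOn_mul_continuous (MemLp.integrable_unitSquare
      (memLp_of_continuous h.continuous.continuousOn 2)) (partialX_contDiff hΨ).continuous)
      (integrableOn_mul_continuous (MemLp.integrable_unitSquare
      (memLp_of_continuous h.partialX.continuous.continuousOn 2)) hΨ.continuous)]
    simp only [mul_comm (partialX φ _), mul_comm (φ _)]
    rw [e]; ring
  · refine main _ _ partialY my (partialY_contDiff hΨ) (fun φ h => h.partialY) (fun φ h => ?_)
      fun φ h => (integral_sq_le_sobolevNorm_one_sq hU (dx.sub h.isWeakDeriv.1)
        (dy.sub h.isWeakDeriv.2)).2.2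
    have e := _root_.integral_mul_partialY hΨ h
    rw [integral_add (integrableOn_mul_continuous (MemLp.integrable_unitSquare
      (memLp_of_continuous h.continuous.continuousOn 2)) (partialY_contDiff hΨ).continuous)
      (integrableOn_mul_continuous (MemLp.integrable_unitSquare
      (memLp_of_continuous h.partialY.continuous.continuousOn 2)) hΨ.continuous)]
    simp only [mul_comm (partialY φ _), mul_comm (φ _)]
    rw [e]; ring

lemma ae_memLp_slice {g : ℝ × ℝ → ℝ} (hg : MemLp g 2 (volume.restrict unitSquare)) :
    ∀ᵐ x ∂unitMeasure, MemLp (fun t => g (x, t)) 2 unitMeasure := by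
  have h1 := (integrable_prod_unitMeasure (MemLp.integrable_unitSquare hg)).prod_right_ae
  have h2 := (integrable_prod_unitMeasure hg.integrable_sq).prod_right_ae
  filter_upwards [h1, h2] with x a b
  exact (memLp_two_iff_integrable_sq a.1).2 b

/-- The Cauchy-Schwarz inequality against the constant one. -/
lemma sq_integral_abs_le {μ : Measure ℝ} [IsFiniteMeasure μ] {f : ℝ → ℝ} (hf : MemLp f 2 μ) :
    (∫ t, |f t| ∂μ) ^ 2 ≤ μ.real Set.univ * ∫ t, f t ^ 2 ∂μ := by
  have h := integral_abs_mul_le hf (memLp_const (1 : ℝ))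
  simp only [abs_one, mul_one, one_pow, integral_const, smul_eq_mul] at h
  have h0 : 0 ≤ ∫ t, |f t| ∂μ := integral_nonneg fun _ => abs_nonneg _
  calc _ ≤ (√(∫ t, f t ^ 2 ∂μ) * √(μ.real Set.univ)) ^ 2 := pow_le_pow_left₀ h0 h 2
    _ = _ := by
      rw [mul_pow, Real.sq_sqrt (integral_nonneg fun _ => sq_nonneg _),
        Real.sq_sqrt measureReal_nonneg, mul_comm]

/-- The primitive is bounded by the norm of the function on the same vertical line, which has unit
length. -/
lemma integral_primY_sq_le {g : ℝ × ℝ → ℝ} (hg : MemLp g 2 (volume.restrict unitSquare)) :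
    ∫ p in unitSquare, primY g p ^ 2 ≤ ∫ p in unitSquare, g p ^ 2 := by
  have hi := integrable_prod_unitMeasure hg.integrable_sq
  have h1 : ∀ᵐ p ∂(volume.restrict unitSquare), MemLp (fun t => g (p.1, t)) 2 unitMeasure := by
    rw [restrict_unitSquare]
    exact Measure.quasiMeasurePreserving_fst.ae (ae_memLp_slice hg)
  have hb : IntegrableOn (fun p : ℝ × ℝ => ∫ t, g (p.1, t) ^ 2 ∂unitMeasure) unitSquare := by
    rw [IntegrableOn, restrict_unitSquare]
    exact Integrable.comp_fst (f := fun x => ∫ t, g (x, t) ^ 2 ∂unitMeasure) hi.integral_prod_left _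
  have hle : ∀ᵐ p ∂(volume.restrict unitSquare),
      primY g p ^ 2 ≤ ∫ t, g (p.1, t) ^ 2 ∂unitMeasure := by
    filter_upwards [h1, ae_restrict_mem isOpen_unitSquare.measurableSet] with p hp hpU
    have h2 := abs_intervalIntegral_le (integrable_unitMeasure_iff.1 (hp.integrable (by norm_num)))
      (y := p.2) ⟨hpU.2.1.le, hpU.2.2.le⟩
    rw [← integral_unitMeasure] at h2
    have h3 := sq_integral_abs_le hp
    rw [probReal_univ, one_mul] at h3
    rw [primY, ← sq_abs]
    exact (pow_le_pow_left₀ (abs_nonneg _) h2 2).trans h3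
  calc _ ≤ ∫ p in unitSquare, ∫ t, g (p.1, t) ^ 2 ∂unitMeasure :=
        integral_mono_of_nonneg (Filter.Eventually.of_forall fun _ => sq_nonneg _) hb hle
    _ = _ := by
        rw [setIntegral_unitSquare hb, setIntegral_unitSquare hg.integrable_sq]
        simp

/-- The Poincaré inequality in `H₀¹`. -/
lemma MemH10.integral_sq_le (hw : MemH10 unitSquare w) :
    ∫ p in unitSquare, w p ^ 2 ≤ ∫ p in unitSquare, weakDeriv unitSquare 0 1 w p ^ 2 := by
  have hU := isOpen_unitSquare
  have m0 := hw.1.memLp hU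
  have my := hw.1.memLp_weakDeriv hU (i := 0) (j := 1) (by norm_num)
  have h := (eq_primY_of_integral_mul_partialY (MemLp.integrable_unitSquare m0)
    (MemLp.integrable_unitSquare my) fun Ψ hΨ => (hw.integral_mul_partial hΨ).2).1
  rw [integral_congr_ae (h.mono fun p hp => by simp only [hp] :
    (fun p => w p ^ 2) =ᵐ[volume.restrict unitSquare]
      fun p => primY (weakDeriv unitSquare 0 1 w) p ^ 2)]
  exact integral_primY_sq_le my

/-- Exchange of the primitives in the two variables. -/
lemma integral_primY_eq_integral_primX {g : ℝ × ℝ → ℝ} (hg : IntegrableOn g unitSquare) {x y : ℝ}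
    (hx : x ∈ Set.Icc (0 : ℝ) 1) (hy : y ∈ Set.Icc (0 : ℝ) 1) :
    ∫ s in (0 : ℝ)..x, primY g (s, y) = ∫ t in (0 : ℝ)..y, primX g (x, t) := by
  refine intervalIntegral_intervalIntegral_swap (F := fun s t => g (s, t)) ?_
  rw [Set.uIoc_of_le hx.1, Set.uIoc_of_le hy.1]
  have h : IntegrableOn g (Set.Ioc (0 : ℝ) 1 ×ˢ Set.Ioc (0 : ℝ) 1) := by
    refine hg.congr_set_ae ?_
    exact Measure.set_prod_ae_eq Ioo_ae_eq_Ioc.symm Ioo_ae_eq_Ioc.symm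
  exact h.mono_set (Set.prod_mono (Set.Ioc_subset_Ioc_right hx.2) (Set.Ioc_subset_Ioc_right hy.2))

lemma intervalIntegral_congr_ae_unit {f g : ℝ → ℝ} (h : ∀ᵐ t ∂unitMeasure, f t = g t) {y : ℝ}
    (hy : y ∈ Set.Icc (0 : ℝ) 1) : ∫ t in (0 : ℝ)..y, f t = ∫ t in (0 : ℝ)..y, g t := by
  rw [unitMeasure, Measure.restrict_congr_set Ioo_ae_eq_Ioc,
    ae_restrict_iff' measurableSet_Ioc] at h
  refine intervalIntegral.integral_congr_ae ?_
  filter_upwards [h] with t ht htI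
  rw [Set.uIoc_of_le hy.1] at htI
  exact ht ⟨htI.1, htI.2.trans hy.2⟩

lemma integral_add_unit {f g : ℝ → ℝ} (hf : Integrable f unitMeasure)
    (hg : Integrable g unitMeasure) {y : ℝ} (hy : y ∈ Set.Icc (0 : ℝ) 1) :
    ∫ t in (0 : ℝ)..y, (f t + g t) = (∫ t in (0 : ℝ)..y, f t) + ∫ t in (0 : ℝ)..y, g t := by
  have hsub : Set.uIcc 0 y ⊆ Set.uIcc (0 : ℝ) 1 := by
    rw [Set.uIcc_of_le hy.1, Set.uIcc_of_le zero_le_one]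
    exact Set.Icc_subset_Icc_right hy.2
  exact intervalIntegral.integral_add ((integrable_unitMeasure_iff.1 hf).mono_set hsub)
    ((integrable_unitMeasure_iff.1 hg).mono_set hsub)

lemma ae_ae_swap_of_ae_unitSquare {P : ℝ × ℝ → Prop} (h : ∀ᵐ p ∂(volume.restrict unitSquare), P p) :
    ∀ᵐ y ∂unitMeasure, ∀ᵐ x ∂unitMeasure, P (x, y) :=
  ae_ae_of_ae_unitSquare (P := fun p => P p.swap) (ae_unitSquare_swap h)

/-- For `w ∈ H² ∩ H₀¹` the derivatives `w_x` and `w_y` are primitives of `w_xy`, because they vanish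
on the horizontal and on the vertical sides, respectively. -/
lemma MemH10.weakDeriv_eq_prim (hw : MemH10 unitSquare w) (hw2 : MemSobolev unitSquare 2 2 w) :
    (∀ᵐ p ∂(volume.restrict unitSquare),
      weakDeriv unitSquare 1 0 w p = primY (weakDeriv unitSquare 1 1 w) p) ∧
    (∀ᵐ p ∂(volume.restrict unitSquare),
      weakDeriv unitSquare 0 1 w p = primX (weakDeriv unitSquare 1 1 w) p) ∧
    (∀ᵐ x ∂unitMeasure, primY (weakDeriv unitSquare 1 1 w) (x, 1) = 0) ∧
    ∀ᵐ y ∂unitMeasure, primX (weakDeriv unitSquare 1 1 w) (1, y) = 0 := by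
  have hU := isOpen_unitSquare
  have i0 := MemLp.integrable_unitSquare (hw.1.memLp hU)
  have ix := MemLp.integrable_unitSquare (hw.1.memLp_weakDeriv hU (i := 1) (j := 0) (by norm_num))
  have iy := MemLp.integrable_unitSquare (hw.1.memLp_weakDeriv hU (i := 0) (j := 1) (by norm_num))
  have ig := MemLp.integrable_unitSquare (hw2.memLp_weakDeriv hU (i := 1) (j := 1) (by norm_num))
  have dx := hw.1.isWeakDeriv (i := 1) (j := 0) (by norm_num)
  have dy := hw.1.isWeakDeriv (i := 0) (j := 1) (by norm_num)
  have dg := hw2.isWeakDeriv (i := 1) (j := 1) (by norm_num)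
  set wx := weakDeriv unitSquare 1 0 w
  set wy := weakDeriv unitSquare 0 1 w
  set g := weakDeriv unitSquare 1 1 w
  obtain ⟨hwy, hwy1⟩ := eq_primY_of_integral_mul_partialY i0 iy fun Ψ hΨ =>
    (hw.integral_mul_partial hΨ).2
  obtain ⟨hwx, hwx1⟩ := eq_primX_of_integral_mul_partialX i0 ix fun Ψ hΨ =>
    (hw.integral_mul_partial hΨ).1
  obtain ⟨c, hc, hcx⟩ := (dx.weak_partialY dg).exists_eq_add_primY ix ig
  obtain ⟨d, hd, hdy⟩ := (dy.weak_partialX dg fun φ hφ => by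
    simpa using partialX_partialY_comm hφ.1).exists_eq_add_primX iy ig
  have sX : ∀ᵐ y ∂unitMeasure, Integrable (fun s => primY g (s, y)) unitMeasure :=
    (integrable_prod_unitMeasure (integrableOn_primY ig)).prod_left_ae
  have iPX : IntegrableOn (primX g) unitSquare :=
    integrableOn_comp_swap (integrableOn_primY (integrableOn_comp_swap ig))
  have sY : ∀ᵐ x ∂unitMeasure, Integrable (fun t => primX g (x, t)) unitMeasure :=
    (integrable_prod_unitMeasure iPX).prod_right_ae
  -- With `w_x = c(x) + primY g` and `w_y = d(y) + primX g`, the primitives of `w_x` and of `w_y`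
  -- both recover `w`.
  have I1 : ∀ᵐ y ∂unitMeasure, ∀ x ∈ Set.Icc (0 : ℝ) 1, primX wx (x, y) =
      (∫ s in (0 : ℝ)..x, c s) + ∫ s in (0 : ℝ)..x, primY g (s, y) := by
    filter_upwards [ae_ae_swap_of_ae_unitSquare hcx, sX] with y h1 h2 x hx
    rw [← integral_add_unit hc h2 hx]
    exact intervalIntegral_congr_ae_unit h1 hx
  have I2 : ∀ᵐ x ∂unitMeasure, ∀ y ∈ Set.Icc (0 : ℝ) 1, primY wy (x, y) =
      (∫ t in (0 : ℝ)..y, d t) + ∫ t in (0 : ℝ)..y, primX g (x, t) := by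
    filter_upwards [ae_ae_of_ae_unitSquare hdy, sY] with x h1 h2 y hy
    rw [← integral_add_unit hd h2 hy]
    exact intervalIntegral_congr_ae_unit h1 hy
  have I1' : ∀ᵐ p ∂(volume.restrict unitSquare), ∀ x ∈ Set.Icc (0 : ℝ) 1, primX wx (x, p.2) =
      (∫ s in (0 : ℝ)..x, c s) + ∫ s in (0 : ℝ)..x, primY g (s, p.2) := by
    rw [restrict_unitSquare]
    exact Measure.quasiMeasurePreserving_snd.ae I1
  have I2' : ∀ᵐ p ∂(volume.restrict unitSquare), ∀ y ∈ Set.Icc (0 : ℝ) 1, primY wy (p.1, y) =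
      (∫ t in (0 : ℝ)..y, d t) + ∫ t in (0 : ℝ)..y, primX g (p.1, t) := by
    rw [restrict_unitSquare]
    exact Measure.quasiMeasurePreserving_fst.ae I2
  -- The double primitives of `g` cancel, so that a function of `x` equals a function of `y`.
  have hCD : ∀ᵐ p ∂(volume.restrict unitSquare),
      ∫ s in (0 : ℝ)..p.1, c s = ∫ t in (0 : ℝ)..p.2, d t := by
    filter_upwards [I1', I2', hwx, hwy, ae_restrict_mem hU.measurableSet] with p h1 h2 h3 h4 hp
    have hx : p.1 ∈ Set.Icc (0 : ℝ) 1 := ⟨hp.1.1.le, hp.1.2.le⟩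
    have hy : p.2 ∈ Set.Icc (0 : ℝ) 1 := ⟨hp.2.1.le, hp.2.2.le⟩
    have e1 := h1 p.1 hx
    have e2 := h2 p.2 hy
    have e3 := integral_primY_eq_integral_primX ig hx hy
    have e4 : primX wx (p.1, p.2) = primY wy (p.1, p.2) := h3.symm.trans h4
    linarith
  have hc0 : ∀ᵐ x ∂unitMeasure, c x = 0 := by
    obtain ⟨y, hy⟩ := (ae_ae_swap_of_ae_unitSquare hCD).exists
    exact ae_eq_zero_of_primitive_const (D := ∫ t in (0 : ℝ)..y, d t) hc hy
  have hd0 : ∀ᵐ y ∂unitMeasure, d y = 0 := by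
    obtain ⟨x, hx⟩ := (ae_ae_of_ae_unitSquare hCD).exists
    exact ae_eq_zero_of_primitive_const (D := ∫ s in (0 : ℝ)..x, c s) hd
      (hx.mono fun _ h => h.symm)
  have hcz : ∀ x ∈ Set.Icc (0 : ℝ) 1, ∫ s in (0 : ℝ)..x, c s = 0 := fun x hx => by
    rw [intervalIntegral_congr_ae_unit hc0 hx]; simp
  have hdz : ∀ y ∈ Set.Icc (0 : ℝ) 1, ∫ t in (0 : ℝ)..y, d t = 0 := fun y hy => by
    rw [intervalIntegral_congr_ae_unit hd0 hy]; simp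
  have h1mem : (1 : ℝ) ∈ Set.Icc (0 : ℝ) 1 := by simp
  refine ⟨?_, ?_, ?_, ?_⟩
  · have : ∀ᵐ p ∂(volume.restrict unitSquare), c p.1 = 0 := by
      rw [restrict_unitSquare]; exact Measure.quasiMeasurePreserving_fst.ae hc0
    filter_upwards [hcx, this] with p h1 h2
    rw [h1, h2, zero_add]
  · have : ∀ᵐ p ∂(volume.restrict unitSquare), d p.2 = 0 := by
      rw [restrict_unitSquare]; exact Measure.quasiMeasurePreserving_snd.ae hd0
    filter_upwards [hdy, this] with p h1 h2
    rw [h1, h2, zero_add]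
  · have hΓi : Integrable (fun x => primY g (x, 1)) unitMeasure := by
      refine (integrable_prod_unitMeasure ig).integral_prod_left.congr
        (Filter.Eventually.of_forall fun x => ?_)
      simp only [integral_unitMeasure, primY]
    refine ae_eq_zero_of_primitive_const (D := 0) hΓi ?_
    filter_upwards [I2, hwy1, ae_unitMeasure_mem] with x h1 h2 hx
    have e := h1 1 h1mem
    rw [h2, hdz 1 h1mem, zero_add] at e
    rw [integral_primY_eq_integral_primX ig ⟨hx.1.le, hx.2.le⟩ h1mem, ← e]
  · have hΓi : Integrable (fun y => primX g (1, y)) unitMeasure := by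
      refine (integrable_prod_unitMeasure (integrableOn_comp_swap ig)).integral_prod_left.congr
        (Filter.Eventually.of_forall fun x => ?_)
      simp only [integral_unitMeasure, primX]
      rfl
    refine ae_eq_zero_of_primitive_const (D := 0) hΓi ?_
    filter_upwards [I1, hwx1, ae_unitMeasure_mem] with y h1 h2 hy
    have e := h1 1 h1mem
    rw [h2, hcz 1 h1mem, zero_add] at e
    rw [← integral_primY_eq_integral_primX ig h1mem ⟨hy.1.le, hy.2.le⟩, ← e]

end HOneZero

/-! ### Interpolation with bilinear finite elements -/

section Interpolation

variable {k N : ℕ}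

/-- The primitive of the indicator function of the `i`-th mesh interval. -/
noncomputable def ramp (N : ℕ) (i : ℕ) (x : ℝ) : ℝ :=
  max 0 (min (2 * meshSize N) (x - i * (2 * meshSize N)))

/-- The mean value of `g` on the cell `e`. -/
noncomputable def cellAverage (g : ℝ × ℝ → ℝ) (e : Fin N × Fin N) : ℝ :=
  ((2 * meshSize N) ^ 2)⁻¹ * ∫ p in openSquare (cellCenter e) (meshSize N), g p

/-- The primitive in both variables of the piecewise constant function of the cell averages
of `g`. If `g = w_xy` and `w` vanishes on the boundary of the square, this is the interpolant of `w`
at the vertices of the mesh. -/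
noncomputable def bilinearInterpolant (N : ℕ) (g : ℝ × ℝ → ℝ) (p : ℝ × ℝ) : ℝ :=
  ∑ e : Fin N × Fin N, cellAverage g e * (ramp N e.1 p.1 * ramp N e.2 p.2)

open Polynomial in
/-- The polynomial that agrees with the `i'`-th ramp on the `i`-th mesh interval. -/
noncomputable def rampPoly (N i' i : ℕ) : ℝ[X] :=
  if i' < i then C (2 * meshSize N) else if i' = i then X - C (i * (2 * meshSize N)) else 0

lemma ramp_eq_eval (hN : 1 ≤ N) {i' i : ℕ} {x : ℝ}
    (hx : x ∈ Set.Icc ((i : ℝ) * (2 * meshSize N)) ((i + 1) * (2 * meshSize N))) :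
    ramp N i' x = (rampPoly N i' i).eval x := by
  have hh := meshSize_pos hN
  have h1 := hx.1
  have h2 := hx.2
  unfold ramp rampPoly
  split_ifs with h h'
  · have : ((i' : ℝ) + 1) * (2 * meshSize N) ≤ i * (2 * meshSize N) := by
      gcongr; exact_mod_cast h
    rw [Polynomial.eval_C, min_eq_left (by linarith), max_eq_right (by linarith)]
  · subst h'
    simp only [Polynomial.eval_sub, Polynomial.eval_X, Polynomial.eval_C]
    rw [min_eq_right (by linarith), max_eq_right (by linarith)]
  · have h3 : i + 1 ≤ i' := by omega
    have : ((i : ℝ) + 1) * (2 * meshSize N) ≤ i' * (2 * meshSize N) := by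
      gcongr; exact_mod_cast h3
    rw [Polynomial.eval_zero, max_eq_left]
    exact (min_le_right _ _).trans (by linarith)

lemma natDegree_rampPoly_le (N i' i : ℕ) : (rampPoly N i' i).natDegree ≤ 1 := by
  unfold rampPoly
  split_ifs
  · rw [Polynomial.natDegree_C]; exact zero_le_one
  · exact (Polynomial.natDegree_X_sub_C_le _)
  · simp

lemma eval_derivative_rampPoly (N i' i : ℕ) (x : ℝ) :
    (rampPoly N i' i).derivative.eval x = if i' = i then 1 else 0 := by
  unfold rampPoly
  split_ifs with h1 h2 h3
  · omega
  · simp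
  · simp
  · simp

lemma continuous_ramp (N i : ℕ) : Continuous (ramp N i) := by unfold ramp; fun_prop

/-- The piece of the interpolant on the cell `e`. -/
noncomputable def interpolantPiece (g : ℝ × ℝ → ℝ) (e : Fin N × Fin N) : ℝ × ℝ → ℝ :=
  ∑ e' : Fin N × Fin N, cellAverage g e' •
    fun p : ℝ × ℝ => (rampPoly N e'.1 e.1).eval p.1 * (rampPoly N e'.2 e.2).eval p.2

lemma isPieces_bilinearInterpolant (hk : 1 ≤ k) (hN : 1 ≤ N) (g : ℝ × ℝ → ℝ) :
    IsPieces k (bilinearInterpolant N g) (interpolantPiece (N := N) g) := by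
  intro e
  refine ⟨IsTensorPoly.sum fun e' _ => (isTensorPoly_eval_mul_eval
    ((natDegree_rampPoly_le _ _ _).trans hk) ((natDegree_rampPoly_le _ _ _).trans hk)).const_smul _,
    fun p hp => ?_⟩
  rw [meshCell_eq_prod] at hp
  simp only [bilinearInterpolant, interpolantPiece, Finset.sum_apply, Pi.smul_apply, smul_eq_mul]
  refine Finset.sum_congr rfl fun e' _ => ?_
  rw [ramp_eq_eval hN hp.1, ramp_eq_eval hN hp.2]

lemma eval_mul_eval_contDiff (P R : Polynomial ℝ) :
    ContDiff ℝ ∞ fun p : ℝ × ℝ => P.eval p.1 * R.eval p.2 :=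
  (isTensorPoly_eval_mul_eval (le_max_left _ _) (le_max_right _ _)).contDiff

lemma partialX_const_smul {f : ℝ × ℝ → ℝ} (hf : ContDiff ℝ ∞ f) (a : ℝ) :
    partialX (a • f) = a • partialX f := by
  ext p
  simp [partialX, fderiv_const_smul (hf.differentiable (by simp) p)]

lemma partialY_const_smul {f : ℝ × ℝ → ℝ} (hf : ContDiff ℝ ∞ f) (a : ℝ) :
    partialY (a • f) = a • partialY f := by
  ext p
  simp [partialY, fderiv_const_smul (hf.differentiable (by simp) p)]

lemma partialX_sum_smul_eval {ι : Type*} (s : Finset ι) (a : ι → ℝ) (P R : ι → Polynomial ℝ) :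
    partialX (∑ i ∈ s, a i • fun p : ℝ × ℝ => (P i).eval p.1 * (R i).eval p.2) =
      ∑ i ∈ s, a i • fun p : ℝ × ℝ => (P i).derivative.eval p.1 * (R i).eval p.2 := by
  have hc : ∀ i ∈ s, ContDiff ℝ ∞ (a i • fun p : ℝ × ℝ => (P i).eval p.1 * (R i).eval p.2) :=
    fun i _ => contDiff_const.smul (eval_mul_eval_contDiff _ _)
  rw [partialX_sum s hc]
  refine Finset.sum_congr rfl fun i _ => ?_
  rw [partialX_const_smul (eval_mul_eval_contDiff _ _), partialX_eval_mul_eval]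

lemma partialY_sum_smul_eval {ι : Type*} (s : Finset ι) (a : ι → ℝ) (P R : ι → Polynomial ℝ) :
    partialY (∑ i ∈ s, a i • fun p : ℝ × ℝ => (P i).eval p.1 * (R i).eval p.2) =
      ∑ i ∈ s, a i • fun p : ℝ × ℝ => (P i).eval p.1 * (R i).derivative.eval p.2 := by
  have hc : ∀ i ∈ s, ContDiff ℝ ∞ (a i • fun p : ℝ × ℝ => (P i).eval p.1 * (R i).eval p.2) :=
    fun i _ => contDiff_const.smul (eval_mul_eval_contDiff _ _)
  rw [partialY_sum s hc]
  refine Finset.sum_congr rfl fun i _ => ?_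
  rw [partialY_const_smul (eval_mul_eval_contDiff _ _), partialY_eval_mul_eval]

lemma iterate_derivative_rampPoly (N i' i : ℕ) :
    (rampPoly N i' i).derivative.derivative = 0 := by
  unfold rampPoly
  split_ifs <;> simp

lemma partialX_interpolantPiece (hN : 1 ≤ N) (g : ℝ × ℝ → ℝ) (e : Fin N × Fin N) {p : ℝ × ℝ}
    (hp : p ∈ meshCell e) : partialX (interpolantPiece g e) p =
      ∑ j : Fin N, cellAverage g (e.1, j) * ramp N j p.2 := by
  rw [meshCell_eq_prod] at hp
  rw [interpolantPiece, partialX_sum_smul_eval, Finset.sum_apply, Fintype.sum_prod_type,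
    Finset.sum_eq_single e.1]
  · refine Finset.sum_congr rfl fun j _ => ?_
    simp [eval_derivative_rampPoly, ramp_eq_eval hN hp.2]
  · intro i _ hi
    have : (i : ℕ) ≠ e.1 := fun h => hi (Fin.ext h)
    simp [eval_derivative_rampPoly, this]
  · simp

lemma partialY_interpolantPiece (hN : 1 ≤ N) (g : ℝ × ℝ → ℝ) (e : Fin N × Fin N) {p : ℝ × ℝ}
    (hp : p ∈ meshCell e) : partialY (interpolantPiece g e) p =
      ∑ i : Fin N, cellAverage g (i, e.2) * ramp N i p.1 := by
  rw [meshCell_eq_prod] at hp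
  rw [interpolantPiece, partialY_sum_smul_eval, Finset.sum_apply, Fintype.sum_prod_type_right,
    Finset.sum_eq_single e.2]
  · refine Finset.sum_congr rfl fun j _ => ?_
    simp [eval_derivative_rampPoly, ramp_eq_eval hN hp.1]
  · intro i _ hi
    have : (i : ℕ) ≠ e.2 := fun h => hi (Fin.ext h)
    simp [eval_derivative_rampPoly, this]
  · simp

lemma second_partials_interpolantPiece (g : ℝ × ℝ → ℝ) (e : Fin N × Fin N) (p : ℝ × ℝ) :
    partialX (partialX (interpolantPiece g e)) p = 0 ∧
      partialY (partialX (interpolantPiece g e)) p = cellAverage g e ∧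
      partialY (partialY (interpolantPiece g e)) p = 0 := by
  refine ⟨?_, ?_, ?_⟩
  · rw [interpolantPiece, partialX_sum_smul_eval, partialX_sum_smul_eval, Finset.sum_apply]
    simp [iterate_derivative_rampPoly]
  · rw [interpolantPiece, partialX_sum_smul_eval, partialY_sum_smul_eval, Finset.sum_apply,
      Finset.sum_eq_single e]
    · simp [eval_derivative_rampPoly]
    · intro e' _ he
      have : ¬ ((e'.1 : ℕ) = e.1 ∧ (e'.2 : ℕ) = e.2) := fun h =>
        he (Prod.ext (Fin.ext h.1) (Fin.ext h.2))
      by_cases h : (e'.1 : ℕ) = e.1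
      · simp [eval_derivative_rampPoly, show ¬ (e'.2 : ℕ) = e.2 from fun h2 => this ⟨h, h2⟩]
      · simp [eval_derivative_rampPoly, h]
    · simp
  · rw [interpolantPiece, partialY_sum_smul_eval, partialY_sum_smul_eval, Finset.sum_apply]
    simp [iterate_derivative_rampPoly]

/-- Integrals of `primY g` over mesh intervals are sums of integrals of `g` over parts of cells. -/
lemma setIntegral_primY_eq_sum (hN : 1 ≤ N) {g : ℝ × ℝ → ℝ} (hg : IntegrableOn g unitSquare)
    (i : Fin N) {y : ℝ} (hy : y ∈ Set.Icc (0 : ℝ) 1) :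
    ∫ s in Set.Ioo ((i : ℝ) * (2 * meshSize N)) ((i + 1) * (2 * meshSize N)), primY g (s, y) =
      ∑ j : Fin N, ∫ p in openSquare (cellCenter (i, j)) (meshSize N),
        {p : ℝ × ℝ | p.2 < y}.indicator g p := by
  have hm : MeasurableSet {p : ℝ × ℝ | p.2 < y} :=
    (isOpen_Iio.preimage continuous_snd).measurableSet
  set I := Set.Ioo ((i : ℝ) * (2 * meshSize N)) ((i + 1) * (2 * meshSize N)) with hI
  set G := {p : ℝ × ℝ | p.2 < y}.indicator g
  have hmI : MeasurableSet (Prod.fst ⁻¹' I : Set (ℝ × ℝ)) :=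
    (isOpen_Ioo.preimage continuous_fst).measurableSet
  have hG : IntegrableOn G unitSquare := hg.indicator hm
  have hGI : IntegrableOn ((Prod.fst ⁻¹' I).indicator G) unitSquare := hG.indicator hmI
  have hsub : I ⊆ Set.Ioo 0 1 := Set.Ioo_subset_Ioo (grid_nonneg hN _) (grid_le_one hN _)
  -- The integral over the strip `x ∈ I`, `t < y` is written by Fubini, and as a sum over the cells.
  have e1 := setIntegral_unitSquare_eq_sum hN hGI
  rw [setIntegral_unitSquare hGI, Fintype.sum_prod_type, Finset.sum_eq_single i] at e1
  · have e2 : ∀ j : Fin N, ∫ p in openSquare (cellCenter (i, j)) (meshSize N),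
        (Prod.fst ⁻¹' I).indicator G p =
        ∫ p in openSquare (cellCenter (i, j)) (meshSize N), G p := by
      intro j
      refine setIntegral_congr_fun (isOpen_openSquare _ _).measurableSet fun p hp => ?_
      rw [openCell_eq_prod] at hp
      exact Set.indicator_of_mem (show p ∈ Prod.fst ⁻¹' I from hp.1) _
    simp only [e2] at e1
    rw [← e1]
    have e3 : ∀ x, ∫ t, (Prod.fst ⁻¹' I).indicator G (x, t) ∂unitMeasure =
        I.indicator (fun s => primY g (s, y)) x := by
      intro x
      by_cases hx : x ∈ I
      · rw [Set.indicator_of_mem hx, primY, intervalIntegral.integral_of_le hy.1, unitMeasure]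
        have e4 : ∀ t, (Prod.fst ⁻¹' I).indicator G (x, t) =
            (Set.Iio y).indicator (fun t => g (x, t)) t := by
          intro t
          rw [Set.indicator_of_mem (show (x, t) ∈ Prod.fst ⁻¹' I from hx)]
          by_cases ht : t < y
          · rw [Set.indicator_of_mem (show t ∈ Set.Iio y from ht)]
            exact Set.indicator_of_mem (show (x, t) ∈ {p : ℝ × ℝ | p.2 < y} from ht) _
          · rw [Set.indicator_of_notMem (show t ∉ Set.Iio y from ht)]
            exact Set.indicator_of_notMem (show (x, t) ∉ {p : ℝ × ℝ | p.2 < y} from ht) _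
        simp only [e4]
        rw [integral_indicator measurableSet_Iio, Measure.restrict_restrict measurableSet_Iio,
          ← setIntegral_congr_set (Ioo_ae_eq_Ioc (a := (0 : ℝ)) (b := y) (μ := volume))]
        congr 2
        ext t
        simp only [Set.mem_inter_iff, Set.mem_Iio, Set.mem_Ioo]
        exact ⟨fun h => ⟨h.2.1, h.1⟩, fun h => ⟨h.2, h.1, h.2.trans_le hy.2⟩⟩
      · rw [Set.indicator_of_notMem hx]
        have e4 : ∀ t, (Prod.fst ⁻¹' I).indicator G (x, t) = 0 := fun t =>
          Set.indicator_of_notMem (show (x, t) ∉ Prod.fst ⁻¹' I from hx) _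
        simp [e4]
    simp only [e3]
    rw [integral_indicator measurableSet_Ioo, unitMeasure,
      Measure.restrict_restrict measurableSet_Ioo, Set.inter_eq_left.2 hsub]
  · intro i' _ hi
    refine Finset.sum_eq_zero fun j _ => ?_
    refine setIntegral_eq_zero_of_forall_eq_zero fun p hp => ?_
    rw [openCell_eq_prod] at hp
    refine Set.indicator_of_notMem (fun h => hi ?_) _
    exact grid_unique hN ⟨hp.1.1.le, hp.1.2⟩ ⟨(show p.1 ∈ I from h).1.le, (show p.1 ∈ I from h).2⟩
  · simp

lemma cellAverage_comp_swap (g : ℝ × ℝ → ℝ) (e : Fin N × Fin N) :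
    cellAverage (g ∘ Prod.swap) e = cellAverage g e.swap := by
  rw [cellAverage, cellAverage]
  congr 1
  exact setIntegral_comp_swap _ _ g

lemma bilinearInterpolant_comp_swap (g : ℝ × ℝ → ℝ) :
    bilinearInterpolant N (g ∘ Prod.swap) = bilinearInterpolant N g ∘ Prod.swap := by
  ext p
  simp only [bilinearInterpolant, Function.comp, Prod.fst_swap, Prod.snd_swap]
  rw [← Equiv.sum_comp (Equiv.prodComm (Fin N) (Fin N))]
  refine Finset.sum_congr rfl fun e _ => ?_
  rw [cellAverage_comp_swap g]
  simp only [Equiv.prodComm_apply, Prod.swap_swap, Prod.fst_swap, Prod.snd_swap]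
  ring

/-- If the integrals of `g` over vertical lines vanish, then the cell averages of a column of cells
have sum zero. -/
lemma sum_cellAverage_eq_zero (hN : 1 ≤ N) {g : ℝ × ℝ → ℝ} (hg : IntegrableOn g unitSquare)
    (h : ∀ᵐ x ∂unitMeasure, primY g (x, 1) = 0) (i : Fin N) :
    ∑ j : Fin N, cellAverage g (i, j) = 0 := by
  have e := setIntegral_primY_eq_sum hN hg i (y := 1) (by simp)
  have hsub : Set.Ioo ((i : ℝ) * (2 * meshSize N)) ((i + 1) * (2 * meshSize N)) ⊆ Set.Ioo 0 1 :=
    Set.Ioo_subset_Ioo (grid_nonneg hN _) (grid_le_one hN _)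
  rw [integral_eq_zero_of_ae (ae_restrict_of_ae_restrict_of_subset hsub h)] at e
  simp only [cellAverage, ← Finset.mul_sum]
  rw [mul_eq_zero]
  right
  rw [e]
  refine Finset.sum_congr rfl fun j _ =>
    setIntegral_congr_fun (isOpen_openSquare _ _).measurableSet fun p hp => ?_
  exact (Set.indicator_of_mem (show p ∈ {p : ℝ × ℝ | p.2 < 1} from
    (openCell_subset hN _ hp).2.2) g).symm

lemma ramp_zero (hN : 1 ≤ N) (i : ℕ) : ramp N i 0 = 0 := by
  have hh := meshSize_pos hN
  rw [ramp, max_eq_left]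
  refine (min_le_right _ _).trans ?_
  have : 0 ≤ (i : ℝ) * (2 * meshSize N) := by positivity
  linarith

lemma ramp_one (hN : 1 ≤ N) (i : Fin N) : ramp N i 1 = 2 * meshSize N := by
  have hh := meshSize_pos hN
  have := grid_le_one hN i
  rw [ramp, min_eq_left (by linarith), max_eq_right (by linarith)]

/-- The interpolant vanishes on the horizontal sides. -/
lemma bilinearInterpolant_eq_zero (hN : 1 ≤ N) {g : ℝ × ℝ → ℝ} (hg : IntegrableOn g unitSquare)
    (h : ∀ᵐ x ∂unitMeasure, primY g (x, 1) = 0) {p : ℝ × ℝ} (hp : p.2 = 0 ∨ p.2 = 1) :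
    bilinearInterpolant N g p = 0 := by
  rcases hp with hp | hp
  · refine Finset.sum_eq_zero fun e _ => ?_
    rw [hp, ramp_zero hN]; ring
  · rw [bilinearInterpolant, Fintype.sum_prod_type]
    refine Finset.sum_eq_zero fun i _ => ?_
    simp only [hp, ramp_one hN, ← Finset.sum_mul, sum_cellAverage_eq_zero hN hg h, zero_mul]

lemma memVh0_bilinearInterpolant (hk : 1 ≤ k) (hN : 1 ≤ N) {g : ℝ × ℝ → ℝ}
    (hg : IntegrableOn g unitSquare) (hy : ∀ᵐ x ∂unitMeasure, primY g (x, 1) = 0)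
    (hx : ∀ᵐ y ∂unitMeasure, primX g (1, y) = 0) : MemVh0 k N (bilinearInterpolant N g) := by
  refine ⟨⟨?_, fun e => ?_⟩, fun p hp => ?_⟩
  · refine Continuous.continuousOn ?_
    unfold bilinearInterpolant
    have := continuous_ramp N
    fun_prop
  · obtain ⟨⟨q, hq⟩, h⟩ := isPieces_bilinearInterpolant (k := k) hk hN g e
    exact ⟨q, fun p hp => by rw [h p hp, hq]; rfl⟩
  · rcases (mem_frontier_unitSquare.1 hp).2 with h | h | h | h
    · have := bilinearInterpolant_eq_zero hN (integrableOn_comp_swap hg) hx (p := p.swap) (.inl h)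
      rwa [bilinearInterpolant_comp_swap] at this
    · have := bilinearInterpolant_eq_zero hN (integrableOn_comp_swap hg) hx (p := p.swap) (.inr h)
      rwa [bilinearInterpolant_comp_swap] at this
    · exact bilinearInterpolant_eq_zero hN hg hy (.inl h)
    · exact bilinearInterpolant_eq_zero hN hg hy (.inr h)

end Interpolation

/-! ### Interpolation error -/

section InterpolationError

variable {k N : ℕ}

lemma integrableOn_sq_cell (hN : 1 ≤ N) {f : ℝ × ℝ → ℝ}
    (hf : MemLp f 2 (volume.restrict unitSquare)) (e : Fin N × Fin N) :
    IntegrableOn (fun p => f p ^ 2) (openSquare (cellCenter e) (meshSize N)) :=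
  IntegrableOn.mono_set (t := unitSquare) hf.integrable_sq (openCell_subset hN e)

lemma sq_setIntegral_abs_le {c : ℝ × ℝ} {h : ℝ} (hh : 0 ≤ h) {f : ℝ × ℝ → ℝ}
    (hf : MemLp f 2 (volume.restrict (openSquare c h))) :
    (∫ p in openSquare c h, |f p|) ^ 2 ≤ (2 * h) ^ 2 * ∫ p in openSquare c h, f p ^ 2 := by
  have : IsFiniteMeasure (volume.restrict (openSquare c h)) := ⟨by
    rw [Measure.restrict_apply_univ]; exact volume_openSquare_lt_top _ _⟩
  have h1 := integral_abs_mul_le hf (memLp_const (1 : ℝ))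
  simp only [abs_one, mul_one, one_pow, integral_const, smul_eq_mul] at h1
  rw [measureReal_restrict_apply_univ, volume_openSquare c hh] at h1
  have h0 : 0 ≤ ∫ p in openSquare c h, |f p| := integral_nonneg fun _ => abs_nonneg _
  calc _ ≤ _ := pow_le_pow_left₀ h0 h1 2
    _ = _ := by
      rw [mul_pow, Real.sq_sqrt (integral_nonneg fun _ => sq_nonneg _),
        Real.sq_sqrt (by positivity)]
      ring

/-- The mean value of `primY g` over a mesh interval differs from the derivative of the bilinear
interpolant only by the contribution of one cell. -/
lemma abs_mean_primY_sub_le (hN : 1 ≤ N) {g : ℝ × ℝ → ℝ} (hg : IntegrableOn g unitSquare)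
    (e : Fin N × Fin N) {y : ℝ}
    (hy : y ∈ Set.Ioo ((e.2 : ℝ) * (2 * meshSize N)) ((e.2 + 1) * (2 * meshSize N))) :
    |(∫ s in Set.Ioo ((e.1 : ℝ) * (2 * meshSize N)) ((e.1 + 1) * (2 * meshSize N)),
        primY g (s, y)) -
      2 * meshSize N * ∑ j : Fin N, cellAverage g (e.1, j) * ramp N j y| ≤
      2 * ∫ p in openSquare (cellCenter e) (meshSize N), |g p| := by
  have hh := meshSize_pos hN
  set H := 2 * meshSize N with hH
  have hHp : 0 < H := by positivity
  have hy1 : y ∈ Set.Icc (0 : ℝ) 1 :=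
    ⟨(grid_nonneg hN e.2).trans hy.1.le, hy.2.le.trans (grid_le_one hN e.2)⟩
  have hgi : ∀ e', IntegrableOn g (openSquare (cellCenter e') (meshSize N)) := fun e' =>
    hg.mono_set (openCell_subset hN e')
  have hm : MeasurableSet {p : ℝ × ℝ | p.2 < y} :=
    (isOpen_Iio.preimage continuous_snd).measurableSet
  rw [setIntegral_primY_eq_sum hN hg e.1 hy1, Finset.mul_sum, ← Finset.sum_sub_distrib,
    Finset.sum_eq_single e.2]
  · have hr : ramp N e.2 y ∈ Set.Icc 0 H := by
      refine ⟨le_max_left _ _, max_le hHp.le (min_le_left _ _)⟩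
    have h1 : |∫ p in openSquare (cellCenter (e.1, e.2)) (meshSize N),
        {p : ℝ × ℝ | p.2 < y}.indicator g p| ≤
        ∫ p in openSquare (cellCenter (e.1, e.2)) (meshSize N), |g p| := by
      refine abs_integral_le_integral_abs.trans ?_
      refine integral_mono ((hgi _).indicator hm).abs (hgi _).abs fun p => ?_
      by_cases hp : p ∈ {p : ℝ × ℝ | p.2 < y}
      · simp only [Set.indicator_of_mem hp, le_refl]
      · simp only [Set.indicator_of_notMem hp, abs_zero, abs_nonneg]
    have h2 : |H * (cellAverage g (e.1, e.2) * ramp N e.2 y)| ≤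
        ∫ p in openSquare (cellCenter (e.1, e.2)) (meshSize N), |g p| := by
      have h3 : |∫ p in openSquare (cellCenter (e.1, e.2)) (meshSize N), g p| ≤
        ∫ p in openSquare (cellCenter (e.1, e.2)) (meshSize N), |g p| :=
        abs_integral_le_integral_abs
      have e4 : H * (cellAverage g (e.1, e.2) * ramp N e.2 y) =
          (∫ p in openSquare (cellCenter (e.1, e.2)) (meshSize N), g p) * (ramp N e.2 y / H) := by
        rw [cellAverage, ← hH]
        field_simp
      have h5 : |ramp N e.2 y / H| ≤ 1 := by
        rw [abs_of_nonneg (div_nonneg hr.1 hHp.le)]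
        exact (div_le_one hHp).2 hr.2
      rw [e4, abs_mul]
      calc _ ≤ |∫ p in openSquare (cellCenter (e.1, e.2)) (meshSize N), g p| * 1 :=
            mul_le_mul_of_nonneg_left h5 (abs_nonneg _)
        _ ≤ _ := by rw [mul_one]; exact h3
    refine (abs_sub _ _).trans ?_
    rw [two_mul]
    exact add_le_add h1 h2
  · intro j _ hj
    have hyI : y ∈ Set.Icc ((e.2 : ℝ) * (2 * meshSize N)) ((e.2 + 1) * (2 * meshSize N)) :=
      ⟨hy.1.le, hy.2.le⟩
    rw [ramp_eq_eval hN hyI]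
    have hne : (j : ℕ) ≠ e.2 := fun h => hj (Fin.ext h)
    -- A cell below the height `y` contributes its integral to both terms, a cell above it nothing.
    rcases lt_or_gt_of_ne hne with hlt | hlt
    · rw [rampPoly, if_pos hlt, Polynomial.eval_C, cellAverage, ← hH]
      have : ∫ p in openSquare (cellCenter (e.1, j)) (meshSize N),
          {p : ℝ × ℝ | p.2 < y}.indicator g p =
          ∫ p in openSquare (cellCenter (e.1, j)) (meshSize N), g p := by
        refine setIntegral_congr_fun (isOpen_openSquare _ _).measurableSet fun p hp => ?_
        rw [openCell_eq_prod] at hp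
        refine Set.indicator_of_mem ?_ _
        have h3 : ((j : ℝ) + 1) * (2 * meshSize N) ≤ e.2 * (2 * meshSize N) := by
          gcongr; exact_mod_cast hlt
        exact (hp.2.2.trans_le h3).trans hy.1
      rw [this]
      field_simp
      ring
    · rw [rampPoly, if_neg (by omega), if_neg hne, Polynomial.eval_zero, mul_zero, mul_zero,
        sub_zero]
      refine setIntegral_eq_zero_of_forall_eq_zero fun p hp => ?_
      rw [openCell_eq_prod] at hp
      refine Set.indicator_of_notMem (fun h => ?_) _
      have h3 : ((e.2 : ℝ) + 1) * (2 * meshSize N) ≤ j * (2 * meshSize N) := by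
        gcongr; exact_mod_cast hlt
      have h4 : p.2 < y := h
      have h5 : (j : ℝ) * (2 * meshSize N) < p.2 := hp.2.1
      linarith [hy.2]
  · simp

lemma openCell_restrict (e : Fin N × Fin N) :
    (volume : Measure (ℝ × ℝ)).restrict (openSquare (cellCenter e) (meshSize N)) =
    (volume.restrict (Set.Ioo ((e.1 : ℝ) * (2 * meshSize N)) ((e.1 + 1) * (2 * meshSize N)))).prod
    (volume.restrict (Set.Ioo ((e.2 : ℝ) * (2 * meshSize N)) ((e.2 + 1) * (2 * meshSize N)))) := by
  rw [openCell_eq_prod, Measure.volume_eq_prod, Measure.prod_restrict]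

/-- The error of the derivative of the bilinear interpolant in the interior of a cell. In the
application `F = w_x`, `f = w_xx` and `g = w_xy`: the first term bounds the distance of `w_x` from
its mean value over a mesh interval, the second one the distance of this mean value from the
derivative of the interpolant. -/
lemma abs_sub_interpolant_le (hN : 1 ≤ N) {F g f : ℝ × ℝ → ℝ} {c : ℝ → ℝ}
    (hg : IntegrableOn g unitSquare) (hf : IntegrableOn f unitSquare)
    (h1 : ∀ᵐ p ∂(volume.restrict unitSquare), F p = primY g p)
    (h2 : ∀ᵐ p ∂(volume.restrict unitSquare), F p = c p.2 + primX f p) (e : Fin N × Fin N) :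
    ∀ᵐ p ∂(volume.restrict (openSquare (cellCenter e) (meshSize N))),
      |F p - ∑ j : Fin N, cellAverage g (e.1, j) * ramp N j p.2| ≤
        (∫ s in Set.Ioo ((e.1 : ℝ) * (2 * meshSize N)) ((e.1 + 1) * (2 * meshSize N)),
          |f (s, p.2)|) +
        2 * (2 * meshSize N)⁻¹ * ∫ p in openSquare (cellCenter e) (meshSize N), |g p| := by
  have hh := meshSize_pos hN
  set I := Set.Ioo ((e.1 : ℝ) * (2 * meshSize N)) ((e.1 + 1) * (2 * meshSize N)) with hI
  have hsub : I ⊆ Set.Ioo 0 1 := Set.Ioo_subset_Ioo (grid_nonneg hN _) (grid_le_one hN _)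
  have hvol : volume.real I = 2 * meshSize N := by
    rw [hI, Real.volume_real_Ioo_of_le (by nlinarith)]; ring
  have sliceY : ∀ᵐ y ∂unitMeasure, (∀ᵐ x ∂unitMeasure, primY g (x, y) = c y + primX f (x, y)) ∧
      Integrable (fun s => f (s, y)) unitMeasure ∧
      Integrable (fun s => primY g (s, y)) unitMeasure := by
    filter_upwards [ae_ae_swap_of_ae_unitSquare h1, ae_ae_swap_of_ae_unitSquare h2,
      (integrable_prod_unitMeasure hf).prod_left_ae,
      (integrable_prod_unitMeasure (integrableOn_primY hg)).prod_left_ae] with y a b i1 i2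
    refine ⟨?_, i1, i2⟩
    filter_upwards [a, b] with x a b
    exact a.symm.trans b
  have sliceP : ∀ᵐ p ∂(volume.restrict unitSquare),
      (∀ᵐ x ∂unitMeasure, primY g (x, p.2) = c p.2 + primX f (x, p.2)) ∧
      Integrable (fun s => f (s, p.2)) unitMeasure ∧
      Integrable (fun s => primY g (s, p.2)) unitMeasure := by
    rw [restrict_unitSquare]
    exact Measure.quasiMeasurePreserving_snd.ae sliceY
  have hall := h2.and sliceP
  filter_upwards [ae_restrict_of_ae_restrict_of_subset (openCell_subset hN e) hall,
    ae_restrict_mem (isOpen_openSquare _ _).measurableSet] with p ⟨hF, hs, i1, i2⟩ hp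
  rw [openCell_eq_prod] at hp
  have i1' : IntegrableOn (fun s => f (s, p.2)) I :=
    IntegrableOn.mono_set (t := Set.Ioo 0 1) i1 hsub
  have i2' : IntegrableOn (fun s => primY g (s, p.2)) I :=
    IntegrableOn.mono_set (t := Set.Ioo 0 1) i2 hsub
  have hx01 : p.1 ∈ Set.Ioo (0 : ℝ) 1 := hsub hp.1
  set A := ∫ s in I, |f (s, p.2)|
  -- the oscillation of `F` in the horizontal direction
  have hosc : ∀ᵐ s ∂(volume.restrict I), ‖F p - primY g (s, p.2)‖ ≤ A := by
    filter_upwards [ae_restrict_of_ae_restrict_of_subset hsub hs,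
      ae_restrict_mem measurableSet_Ioo] with s hs hsI
    have ii := integrable_unitMeasure_iff.1 i1
    have sub1 : ∀ t ∈ Set.Ioo (0 : ℝ) 1, IntervalIntegrable (fun s => f (s, p.2)) volume 0 t := by
      intro t ht
      refine ii.mono_set ?_
      rw [Set.uIcc_of_le ht.1.le, Set.uIcc_of_le zero_le_one]
      exact Set.Icc_subset_Icc_right ht.2.le
    have ed : F p - primY g (s, p.2) = ∫ t in s..p.1, f (t, p.2) := by
      rw [hF, hs, ← intervalIntegral.integral_interval_sub_left (sub1 _ hx01) (sub1 _ (hsub hsI))]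
      simp only [primX]; ring
    rw [ed]
    refine intervalIntegral.norm_integral_le_integral_norm_uIoc.trans ?_
    refine setIntegral_mono_set i1'.abs (Filter.Eventually.of_forall fun _ => abs_nonneg _) ?_
    refine Filter.Eventually.of_forall fun t ht => ?_
    have ht' : t ∈ Set.uIoc s p.1 := ht
    rw [Set.uIoc, Set.mem_Ioc] at ht'
    exact ⟨(lt_min hsI.1 hp.1.1).trans ht'.1, ht'.2.trans_lt (max_lt hsI.2 hp.1.2)⟩
  have hmean := norm_integral_le_of_norm_le_const hosc
  have hIc : IntegrableOn (fun _ => F p) I := integrableOn_const (by simp [hI])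
  rw [integral_sub hIc i2', setIntegral_const,
    measureReal_restrict_apply_univ, hvol, smul_eq_mul, Real.norm_eq_abs] at hmean
  have hcell := abs_mean_primY_sub_le hN hg e hp.2
  set B := ∫ s in I, primY g (s, p.2)
  set D := ∑ j : Fin N, cellAverage g (e.1, j) * ramp N j p.2
  set G := ∫ p in openSquare (cellCenter e) (meshSize N), |g p|
  have hH : 0 < 2 * meshSize N := by positivity
  have h3 : |2 * meshSize N * (F p - D)| ≤ A * (2 * meshSize N) + 2 * G := by
    have : 2 * meshSize N * (F p - D) = (2 * meshSize N * F p - B) + (B - 2 * meshSize N * D) := by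
      ring
    rw [this]
    exact (abs_add_le _ _).trans (add_le_add hmean hcell)
  rw [abs_mul, abs_of_pos hH, ← le_div_iff₀' hH] at h3
  refine h3.trans (le_of_eq ?_)
  field_simp

/-- The `L²` error of the derivative of the bilinear interpolant. -/
lemma integral_sub_interpolant_sq_le (hN : 1 ≤ N) {F g f D : ℝ × ℝ → ℝ} {c : ℝ → ℝ}
    (hF : MemLp F 2 (volume.restrict unitSquare)) (hg : MemLp g 2 (volume.restrict unitSquare))
    (hf : MemLp f 2 (volume.restrict unitSquare)) (hD : MemLp D 2 (volume.restrict unitSquare))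
    (h1 : ∀ᵐ p ∂(volume.restrict unitSquare), F p = primY g p)
    (h2 : ∀ᵐ p ∂(volume.restrict unitSquare), F p = c p.2 + primX f p)
    (hDe : ∀ e : Fin N × Fin N, ∀ p ∈ openSquare (cellCenter e) (meshSize N),
      D p = ∑ j : Fin N, cellAverage g (e.1, j) * ramp N j p.2) :
    ∫ p in unitSquare, (F p - D p) ^ 2 ≤
      2 * (2 * meshSize N) ^ 2 * (∫ p in unitSquare, f p ^ 2) +
        8 * (2 * meshSize N) ^ 2 * ∫ p in unitSquare, g p ^ 2 := by
  have hh := meshSize_pos hN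
  have hH : 0 < 2 * meshSize N := by positivity
  have hFD : IntegrableOn (fun p => (F p - D p) ^ 2) unitSquare := (hF.sub hD).integrable_sq
  rw [setIntegral_unitSquare_eq_sum hN hFD,
    setIntegral_unitSquare_eq_sum hN hf.integrable_sq,
    setIntegral_unitSquare_eq_sum hN hg.integrable_sq, Finset.mul_sum, Finset.mul_sum,
    ← Finset.sum_add_distrib]
  refine Finset.sum_le_sum fun e _ => ?_
  set c' := cellCenter e
  set I := Set.Ioo ((e.1 : ℝ) * (2 * meshSize N)) ((e.1 + 1) * (2 * meshSize N)) with hI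
  set J := Set.Ioo ((e.2 : ℝ) * (2 * meshSize N)) ((e.2 + 1) * (2 * meshSize N)) with hJ
  have hvolI : volume.real I = 2 * meshSize N := by
    rw [hI, Real.volume_real_Ioo_of_le (by nlinarith)]; ring
  have : IsFiniteMeasure (volume.restrict I) := ⟨by simp [hI]⟩
  have : IsFiniteMeasure (volume.restrict J) := ⟨by simp [hJ]⟩
  have hμ := openCell_restrict e
  rw [← hI, ← hJ] at hμ
  have hsq := integrableOn_sq_cell hN hf e
  have hsq' : Integrable (fun p => f p ^ 2) ((volume.restrict I).prod (volume.restrict J)) := by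
    rw [← hμ]; exact hsq
  set K : ℝ → ℝ := fun y => ∫ s in I, f (s, y) ^ 2 with hK
  have hKi : Integrable (fun p : ℝ × ℝ => K p.2)
      (volume.restrict (openSquare c' (meshSize N))) := by
    rw [hμ]
    exact Integrable.comp_snd (f := K) hsq'.integral_prod_right _
  -- `K` does not depend on `x`, so its integral over the cell gains the factor `2h`.
  have hKint : ∫ p in openSquare c' (meshSize N), K p.2 =
      2 * meshSize N * ∫ p in openSquare c' (meshSize N), f p ^ 2 := by
    rw [hμ, integral_prod_symm _ hsq', integral_prod _ (by rw [← hμ]; exact hKi)]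
    simp only [integral_const, measureReal_restrict_apply_univ, hvolI, smul_eq_mul, hK]
  set Γ := ∫ p in openSquare c' (meshSize N), g p ^ 2
  have hΓ := sq_setIntegral_abs_le (c := c') hh.le
    (hg.mono_measure (Measure.restrict_mono (openCell_subset hN e) le_rfl))
  set G := ∫ p in openSquare c' (meshSize N), |g p|
  have hslice : ∀ᵐ p ∂(volume.restrict (openSquare c' (meshSize N))),
      (∫ s in I, |f (s, p.2)|) ^ 2 ≤ 2 * meshSize N * K p.2 := by
    have hf2 : Integrable f ((volume.restrict I).prod (volume.restrict J)) := by
      rw [← hμ]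
      exact IntegrableOn.mono_set (t := unitSquare) (MemLp.integrable_unitSquare hf)
        (openCell_subset hN e)
    rw [hμ]
    refine Measure.quasiMeasurePreserving_snd.ae (p := fun y =>
      (∫ s in I, |f (s, y)|) ^ 2 ≤ 2 * meshSize N * K y) ?_
    filter_upwards [hf2.prod_left_ae, hsq'.prod_left_ae] with y a b
    have := sq_integral_abs_le ((memLp_two_iff_integrable_sq a.1).2 b)
    rwa [measureReal_restrict_apply_univ, hvolI] at this
  have hpt : ∀ᵐ p ∂(volume.restrict (openSquare c' (meshSize N))),
      (F p - D p) ^ 2 ≤ 2 * (2 * meshSize N) * K p.2 + 8 * Γ := by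
    filter_upwards [abs_sub_interpolant_le hN (MemLp.integrable_unitSquare hg)
      (MemLp.integrable_unitSquare hf) h1 h2 e, hslice,
      ae_restrict_mem (isOpen_openSquare _ _).measurableSet] with p a b hp
    rw [← hDe e p hp] at a
    have h3 : (F p - D p) ^ 2 ≤ ((∫ s in I, |f (s, p.2)|) + 2 * (2 * meshSize N)⁻¹ * G) ^ 2 := by
      rw [← sq_abs]; exact pow_le_pow_left₀ (abs_nonneg _) a 2
    have h4 : (2 * (2 * meshSize N)⁻¹ * G) ^ 2 ≤ 4 * Γ := by
      rw [mul_pow, mul_pow, inv_pow]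
      calc _ = 4 * (((2 * meshSize N) ^ 2)⁻¹ * G ^ 2) := by ring
        _ ≤ 4 * (((2 * meshSize N) ^ 2)⁻¹ * ((2 * meshSize N) ^ 2 * Γ)) := by gcongr
        _ = 4 * Γ := by rw [inv_mul_cancel_left₀ (by positivity)]
    nlinarith [sq_nonneg ((∫ s in I, |f (s, p.2)|) - 2 * (2 * meshSize N)⁻¹ * G)]
  have hconst : Integrable (fun _ : ℝ × ℝ => 8 * Γ)
      (volume.restrict (openSquare c' (meshSize N))) :=
    integrableOn_const (volume_openSquare_lt_top _ _).ne
  have hfin := integral_mono_of_nonneg (Filter.Eventually.of_forall fun _ => sq_nonneg _)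
    ((hKi.const_mul (2 * (2 * meshSize N))).add hconst) hpt
  refine hfin.trans (le_of_eq ?_)
  simp only [Pi.add_apply]
  rw [integral_add (hKi.const_mul _) hconst, integral_const_mul, hKint, setIntegral_const,
    volume_openSquare _ hh.le, smul_eq_mul]
  ring

end InterpolationError

/-! ### Sobolev norms of differences -/

section SobolevSub

variable {U : Set (ℝ × ℝ)} {m : ℕ} {u v : ℝ × ℝ → ℝ}

lemma MemSobolev.sub {p : ℝ≥0∞} (hu : MemSobolev U m p u) (hv : MemSobolev U m p v) :
    MemSobolev U m p (u - v) := by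
  intro i j hij
  obtain ⟨g, hg, hgp⟩ := hu i j hij
  obtain ⟨g', hg', hgp'⟩ := hv i j hij
  exact ⟨g - g', hg.sub hg', hgp.sub hgp'⟩

lemma sobolevNorm_sub_sq_le (hU : IsOpen U) (hu : MemSobolev U m 2 u) (hv : MemSobolev U m 2 v) :
    sobolevNorm U m (u - v) ^ 2 ≤ 2 * sobolevNorm U m u ^ 2 + 2 * sobolevNorm U m v ^ 2 := by
  simp only [sobolevNorm_sq, Finset.mul_sum, ← Finset.sum_add_distrib]
  refine Finset.sum_le_sum fun r hr => Finset.sum_le_sum fun ij hij => ?_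
  have h : ij.1 + ij.2 ≤ m := by
    rw [Finset.HasAntidiagonal.mem_antidiagonal.1 hij]
    exact Nat.lt_succ_iff.1 (Finset.mem_range.1 hr)
  rw [integral_weakDeriv_sq hU ((hu.isWeakDeriv h).sub (hv.isWeakDeriv h))]
  exact integral_sub_sq_le (hu.memLp_weakDeriv hU h) (hv.memLp_weakDeriv hU h)

lemma IsTestFunction.sub (hu : IsTestFunction U u) (hv : IsTestFunction U v) :
    IsTestFunction U (u - v) :=
  ⟨hu.1.sub hv.1, hu.2.1.sub hv.2.1,
    (tsupport_sub u v).trans (Set.union_subset hu.2.2 hv.2.2)⟩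

lemma MemH10.sub (hu : MemH10 unitSquare u) (hv : MemH10 unitSquare v) :
    MemH10 unitSquare (u - v) := by
  refine ⟨hu.1.sub hv.1, fun ε hε => ?_⟩
  obtain ⟨φ, hφ, h1⟩ := hu.2 (ε / 2) (by positivity)
  obtain ⟨ψ, hψ, h2⟩ := hv.2 (ε / 2) (by positivity)
  refine ⟨φ - ψ, hφ.sub hψ, ?_⟩
  have h := sobolevNorm_sub_sq_le isOpen_unitSquare (hu.1.sub hφ.memSobolev)
    (hv.1.sub hψ.memSobolev)
  rw [show u - v - (φ - ψ) = u - φ - (v - ψ) by ring]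
  refine lt_of_pow_lt_pow_left₀ 2 hε.le (h.trans_lt ?_)
  have a := pow_lt_pow_left₀ h1 (sobolevNorm_nonneg _ _) two_ne_zero
  have b := pow_lt_pow_left₀ h2 (sobolevNorm_nonneg _ _) two_ne_zero
  nlinarith

lemma sobolevNorm_mono_order {n : ℕ} (hnm : n ≤ m) : sobolevNorm U n u ≤ sobolevNorm U m u := by
  refine Real.sqrt_le_sqrt (Finset.sum_le_sum_of_subset_of_nonneg ?_ fun _ _ _ => ?_)
  · exact Finset.range_mono (by omega)
  · exact Finset.sum_nonneg fun _ _ => integral_nonneg fun _ => sq_nonneg _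

end SobolevSub

/-! ### Broken norms and the inverse inequality -/

section BrokenNorm

variable {k N : ℕ} {u v : ℝ × ℝ → ℝ} {f : Fin N × Fin N → ℝ × ℝ → ℝ}

lemma IsPieces.isWeakDeriv (hf : IsPieces k v f) (e : Fin N × Fin N) (i j : ℕ) :
    IsWeakDeriv (openSquare (cellCenter e) (meshSize N)) i j v
      (partialY^[j] (partialX^[i] (f e))) := by
  refine ((hf e).1.contDiff.isWeakDeriv i j).congr ?_ (Filter.EventuallyEq.refl _ _)
  filter_upwards [ae_restrict_mem (isOpen_openSquare _ _).measurableSet] with p hp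
  exact ((hf e).2 p (openSquare_subset_closedSquare _ _ hp)).symm

lemma memLp_openSquare {c : ℝ × ℝ} {h : ℝ} {g : ℝ × ℝ → ℝ} (hg : Continuous g) (r : ℝ≥0∞) :
    MemLp g r (volume.restrict (openSquare c h)) := by
  have : IsFiniteMeasure (volume.restrict (openSquare c h)) := ⟨by
    rw [Measure.restrict_apply_univ]; exact volume_openSquare_lt_top _ _⟩
  obtain ⟨B, hB⟩ := (isCompact_closedSquare c h).exists_bound_of_continuousOn hg.continuousOn
  refine MemLp.of_bound hg.aestronglyMeasurable B ?_
  filter_upwards [ae_restrict_mem (isOpen_openSquare _ _).measurableSet] with p hp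
  exact hB p (openSquare_subset_closedSquare _ _ hp)

lemma IsPieces.memSobolev (hf : IsPieces k v f) (e : Fin N × Fin N) (m : ℕ) :
    MemSobolev (openSquare (cellCenter e) (meshSize N)) m 2 v := fun i j _ =>
  ⟨_, hf.isWeakDeriv e i j, memLp_openSquare
    (partialY_iterate_contDiff (partialX_iterate_contDiff (hf e).1.contDiff i) j).continuous _⟩

lemma IsPieces.sobolevNorm_cell_sq (hf : IsPieces k v f) (e : Fin N × Fin N) :
    sobolevNorm (interior (meshCell e)) 2 v ^ 2 =
      (∫ p in openSquare (cellCenter e) (meshSize N), f e p ^ 2) +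
      (∫ p in openSquare (cellCenter e) (meshSize N), partialX (f e) p ^ 2) +
      (∫ p in openSquare (cellCenter e) (meshSize N), partialY (f e) p ^ 2) +
      (∫ p in openSquare (cellCenter e) (meshSize N), partialX (partialX (f e)) p ^ 2) +
      (∫ p in openSquare (cellCenter e) (meshSize N), partialY (partialX (f e)) p ^ 2) +
      ∫ p in openSquare (cellCenter e) (meshSize N), partialY (partialY (f e)) p ^ 2 := by
  rw [interior_meshCell, sobolevNorm_two_sq (isOpen_openSquare _ _) (hf.isWeakDeriv e 1 0)
    (hf.isWeakDeriv e 0 1) (hf.isWeakDeriv e 2 0) (hf.isWeakDeriv e 1 1) (hf.isWeakDeriv e 0 2)]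
  have : ∫ p in openSquare (cellCenter e) (meshSize N), v p ^ 2 =
      ∫ p in openSquare (cellCenter e) (meshSize N), f e p ^ 2 :=
    setIntegral_congr_fun (isOpen_openSquare _ _).measurableSet fun p hp => by
      simp only [(hf e).2 p (openSquare_subset_closedSquare _ _ hp)]
  rw [this]
  rfl

lemma brokenNorm_nonneg (m : ℕ) (v : ℝ × ℝ → ℝ) : 0 ≤ brokenNorm N m v := Real.sqrt_nonneg _

lemma brokenNorm_sq (m : ℕ) (v : ℝ × ℝ → ℝ) : brokenNorm N m v ^ 2 =
    ∑ e : Fin N × Fin N, sobolevNorm (interior (meshCell e)) m v ^ 2 :=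
  Real.sq_sqrt (Finset.sum_nonneg fun _ _ => sq_nonneg _)

/-- The energy of a polynomial piece on a cell, i.e. the square of its `H¹` norm. -/
noncomputable def cellEnergy (f : Fin N × Fin N → ℝ × ℝ → ℝ) (e : Fin N × Fin N) : ℝ :=
  (∫ p in openSquare (cellCenter e) (meshSize N), f e p ^ 2) +
    (∫ p in openSquare (cellCenter e) (meshSize N), partialX (f e) p ^ 2) +
    ∫ p in openSquare (cellCenter e) (meshSize N), partialY (f e) p ^ 2

lemma MemVh0.sobolevNorm_one_sq_eq_sum (hv : MemVh0 k N v) (hf : IsPieces k v f) (hN : 1 ≤ N) :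
    sobolevNorm unitSquare 1 v ^ 2 = ∑ e : Fin N × Fin N, cellEnergy f e := by
  obtain ⟨d1, d2⟩ := hv.isWeakDeriv hN
  obtain ⟨m0, m1, m2⟩ := hv.memLp hN 2
  rw [sobolevNorm_one_sq isOpen_unitSquare d1 d2,
    setIntegral_unitSquare_eq_sum hN m0.integrable_sq,
    setIntegral_unitSquare_eq_sum hN m1.integrable_sq,
    setIntegral_unitSquare_eq_sum hN m2.integrable_sq, ← Finset.sum_add_distrib,
    ← Finset.sum_add_distrib]
  refine Finset.sum_congr rfl fun e _ => ?_
  have hm := (isOpen_openSquare (cellCenter e) (meshSize N)).measurableSet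
  have e0 : Set.EqOn (fun p => v p ^ 2) (fun p => f e p ^ 2)
      (openSquare (cellCenter e) (meshSize N)) := fun p hp => by
    simp only [(hf e).2 p (openSquare_subset_closedSquare _ _ hp)]
  have e1 : Set.EqOn (fun p => partialX v p ^ 2) (fun p => partialX (f e) p ^ 2)
      (openSquare (cellCenter e) (meshSize N)) := fun p hp => by
    simp only [hf.partialX_eq hp]
  have e2 : Set.EqOn (fun p => partialY v p ^ 2) (fun p => partialY (f e) p ^ 2)
      (openSquare (cellCenter e) (meshSize N)) := fun p hp => by
    simp only [hf.partialY_eq hp]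
  rw [cellEnergy, setIntegral_congr_fun hm e0, setIntegral_congr_fun hm e1,
    setIntegral_congr_fun hm e2]

lemma MemVh0.sub (hu : MemVh0 k N u) (hv : MemVh0 k N v) : MemVh0 k N (u - v) := by
  refine ⟨⟨hu.1.1.sub hv.1.1, fun e => ?_⟩, fun p hp => by simp [hu.2 p hp, hv.2 p hp]⟩
  obtain ⟨q, hq⟩ := hu.1.2 e
  obtain ⟨q', hq'⟩ := hv.1.2 e
  refine ⟨q - q', fun p hp => ?_⟩
  simp only [Pi.sub_apply, hq p hp, hq' p hp, sub_mul, Finset.sum_sub_distrib]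

lemma brokenNorm_sub_sq_le (hu : MemVh0 k N u) (hv : MemVh0 k N v) :
    brokenNorm N 2 (u - v) ^ 2 ≤ 2 * brokenNorm N 2 u ^ 2 + 2 * brokenNorm N 2 v ^ 2 := by
  obtain ⟨f, hf⟩ := hu.1.exists_isPieces
  obtain ⟨g, hg⟩ := hv.1.exists_isPieces
  simp only [brokenNorm_sq, Finset.mul_sum, ← Finset.sum_add_distrib]
  refine Finset.sum_le_sum fun e _ => ?_
  rw [interior_meshCell]
  exact sobolevNorm_sub_sq_le (isOpen_openSquare _ _) (hf.memSobolev e 2) (hg.memSobolev e 2)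

/-- The global inverse inequality: the broken `H²` norm is at most of order `1/h` times the `H¹`
norm. -/
lemma exists_brokenNorm_le (k : ℕ) : ∃ C > 0, ∀ N, 1 ≤ N → ∀ v, MemVh0 k N v →
    brokenNorm N 2 v * meshSize N ≤ C * sobolevNorm unitSquare 1 v := by
  obtain ⟨K, hK, H⟩ := exists_inverse_bound k
  refine ⟨1 + 4 * K, by positivity, fun N hN v hv => ?_⟩
  obtain ⟨f, hf⟩ := hv.1.exists_isPieces
  have hh := meshSize_pos hN
  have hh1 : meshSize N ≤ 1 := by
    have := natCast_mul_two_meshSize hN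
    have h1 : (1 : ℝ) ≤ N := by exact_mod_cast hN
    nlinarith
  -- the inverse inequality for the integrals of the squares over a single cell
  have hinv : ∀ (e : Fin N × Fin N) (r : ℝ × ℝ → ℝ), IsTensorPoly k r →
      meshSize N ^ 2 * (∫ p in openSquare (cellCenter e) (meshSize N), partialX r p ^ 2) ≤
        4 * K ^ 2 * ∫ p in openSquare (cellCenter e) (meshSize N), r p ^ 2 ∧
      meshSize N ^ 2 * (∫ p in openSquare (cellCenter e) (meshSize N), partialY r p ^ 2) ≤
        4 * K ^ 2 * ∫ p in openSquare (cellCenter e) (meshSize N), r p ^ 2 := by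
    intro e r hr
    set S := openSquare (cellCenter e) (meshSize N)
    have hI : 0 ≤ ∫ p in S, r p ^ 2 := integral_nonneg fun _ => sq_nonneg _
    have key : ∀ d : ℝ × ℝ → ℝ, (∀ p ∈ S, |d p| ≤ K / meshSize N ^ 2 * √(∫ p in S, r p ^ 2)) →
        meshSize N ^ 2 * (∫ p in S, d p ^ 2) ≤ 4 * K ^ 2 * ∫ p in S, r p ^ 2 := by
      intro d hd
      have h1 := norm_setIntegral_le_of_norm_le_const (μ := volume) (s := S)
        (f := fun p => d p ^ 2) (C := (K / meshSize N ^ 2 * √(∫ p in S, r p ^ 2)) ^ 2)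
        (volume_openSquare_lt_top _ _) fun p hp => by
          rw [Real.norm_eq_abs, abs_pow]
          exact pow_le_pow_left₀ (abs_nonneg _) (hd p hp) 2
      rw [volume_openSquare _ hh.le] at h1
      have h2 := (le_abs_self _).trans h1
      rw [mul_pow, Real.sq_sqrt hI] at h2
      calc _ ≤ meshSize N ^ 2 * ((K / meshSize N ^ 2) ^ 2 * (∫ p in S, r p ^ 2) *
            (4 * meshSize N ^ 2)) := by gcongr
        _ = _ := by field_simp
    exact ⟨key _ fun p hp => (H r hr _ _ hh p (openSquare_subset_closedSquare _ _ hp)).2.1,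
      key _ fun p hp => (H r hr _ _ hh p (openSquare_subset_closedSquare _ _ hp)).2.2⟩
  refine le_of_sq_le_sq ?_ (mul_nonneg (by positivity) (sobolevNorm_nonneg _ _))
  rw [mul_pow, mul_pow, brokenNorm_sq, hv.sobolevNorm_one_sq_eq_sum hf hN, Finset.sum_mul,
    Finset.mul_sum]
  refine Finset.sum_le_sum fun e _ => ?_
  rw [hf.sobolevNorm_cell_sq, cellEnergy]
  have a := (hinv e _ (hf e).1.partialX).1
  have b := (hinv e _ (hf e).1.partialX).2
  have c := (hinv e _ (hf e).1.partialY).2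
  set S := openSquare (cellCenter e) (meshSize N)
  have h0 : 0 ≤ ∫ p in S, f e p ^ 2 := integral_nonneg fun _ => sq_nonneg _
  have h1 : 0 ≤ ∫ p in S, partialX (f e) p ^ 2 := integral_nonneg fun _ => sq_nonneg _
  have h2 : 0 ≤ ∫ p in S, partialY (f e) p ^ 2 := integral_nonneg fun _ => sq_nonneg _
  have hs : meshSize N ^ 2 ≤ 1 := pow_le_one₀ hh.le hh1
  have hE : meshSize N ^ 2 * ((∫ p in S, f e p ^ 2) + (∫ p in S, partialX (f e) p ^ 2) +
      ∫ p in S, partialY (f e) p ^ 2) ≤ 1 * ((∫ p in S, f e p ^ 2) +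
      (∫ p in S, partialX (f e) p ^ 2) + ∫ p in S, partialY (f e) p ^ 2) := by gcongr
  nlinarith [mul_nonneg (sq_nonneg K) h0, mul_nonneg (sq_nonneg K) h1,
    mul_nonneg (sq_nonneg K) h2, mul_nonneg hK.le h0, mul_nonneg hK.le h1, mul_nonneg hK.le h2]

end BrokenNorm

/-! ### The interpolation estimate -/

section InterpolationTheorem

variable {k N : ℕ} {w : ℝ × ℝ → ℝ}

/-- Approximation of `H² ∩ H₀¹` by finite element functions, with the bilinear interpolant. The
errors of the two derivatives determine the error in `H¹` by the Poincaré inequality. The second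
derivatives of the interpolant on a cell are zero, except for the mixed one, which is the average
of `w_xy`. -/
lemma exists_interpolant (hk : 1 ≤ k) (hN : 1 ≤ N) (hw : MemH10 unitSquare w)
    (hw2 : MemSobolev unitSquare 2 2 w) :
    ∃ v, MemVh0 k N v ∧
      sobolevNorm unitSquare 1 (w - v) ^ 2 ≤ 200 * meshSize N ^ 2 * sobolevNorm unitSquare 2 w ^ 2 ∧
      brokenNorm N 2 v ^ 2 ≤ 200 * sobolevNorm unitSquare 2 w ^ 2 := by
  have hU := isOpen_unitSquare
  have hh := meshSize_pos hN
  have hh1 : meshSize N ≤ 1 / 2 := by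
    have := natCast_mul_two_meshSize hN
    have h1 : (1 : ℝ) ≤ N := by exact_mod_cast hN
    nlinarith
  have mx := hw2.memLp_weakDeriv hU (i := 1) (j := 0) (by norm_num)
  have my := hw2.memLp_weakDeriv hU (i := 0) (j := 1) (by norm_num)
  have mxx := hw2.memLp_weakDeriv hU (i := 2) (j := 0) (by norm_num)
  have mxy := hw2.memLp_weakDeriv hU (i := 1) (j := 1) (by norm_num)
  have myy := hw2.memLp_weakDeriv hU (i := 0) (j := 2) (by norm_num)
  have dx := hw2.isWeakDeriv (i := 1) (j := 0) (by norm_num)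
  have dy := hw2.isWeakDeriv (i := 0) (j := 1) (by norm_num)
  have dxx := hw2.isWeakDeriv (i := 2) (j := 0) (by norm_num)
  have dxy := hw2.isWeakDeriv (i := 1) (j := 1) (by norm_num)
  have dyy := hw2.isWeakDeriv (i := 0) (j := 2) (by norm_num)
  obtain ⟨ex, ey, bx, bY⟩ := hw.weakDeriv_eq_prim hw2
  have hnorm := sobolevNorm_two_sq hU dx dy dxx dxy dyy
  set wx := weakDeriv unitSquare 1 0 w
  set wy := weakDeriv unitSquare 0 1 w
  set wxx := weakDeriv unitSquare 2 0 w
  set g := weakDeriv unitSquare 1 1 w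
  set wyy := weakDeriv unitSquare 0 2 w
  set v := bilinearInterpolant N g with hv
  have hvm : MemVh0 k N v :=
    memVh0_bilinearInterpolant hk hN (MemLp.integrable_unitSquare mxy) bx bY
  have hp : IsPieces k v (interpolantPiece (N := N) g) := isPieces_bilinearInterpolant hk hN g
  obtain ⟨v0, v1, v2⟩ := hvm.memLp hN 2
  obtain ⟨dv1, dv2⟩ := hvm.isWeakDeriv hN
  obtain ⟨c, -, hc⟩ := (dx.weak_partialX dxx fun _ _ => rfl).exists_eq_add_primX
    (MemLp.integrable_unitSquare mx) (MemLp.integrable_unitSquare mxx)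
  obtain ⟨d, -, hd⟩ := (dy.weak_partialY dyy).exists_eq_add_primY
    (MemLp.integrable_unitSquare my) (MemLp.integrable_unitSquare myy)
  have errX := integral_sub_interpolant_sq_le hN mx mxy mxx v1 ex hc fun e p hpe => by
    rw [hp.partialX_eq hpe,
      partialX_interpolantPiece hN g e (openSquare_subset_closedSquare _ _ hpe)]
  have memSwap : ∀ {q : ℝ × ℝ → ℝ}, MemLp q 2 (volume.restrict unitSquare) →
      MemLp (q ∘ Prod.swap) 2 (volume.restrict unitSquare) := by
    intro q hq
    refine hq.comp_measurePreserving ?_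
    rw [restrict_unitSquare]
    exact Measure.measurePreserving_swap
  -- The error of the other derivative, with the variables exchanged.
  have errY := integral_sub_interpolant_sq_le (N := N) (F := wy ∘ Prod.swap) (g := g ∘ Prod.swap)
    (f := wyy ∘ Prod.swap) (D := partialY v ∘ Prod.swap) (c := d) hN (memSwap my) (memSwap mxy)
    (memSwap myy) (memSwap v2) (ae_unitSquare_swap ey) (ae_unitSquare_swap hd) fun e p hpe => by
      have hpe' : p.swap ∈ openSquare (cellCenter e.swap) (meshSize N) := ⟨hpe.2, hpe.1⟩
      rw [Function.comp, hp.partialY_eq hpe',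
        partialY_interpolantPiece hN g e.swap (openSquare_subset_closedSquare _ _ hpe')]
      refine Finset.sum_congr rfl fun i _ => ?_
      rw [cellAverage_comp_swap]
      rfl
  have s1 := setIntegral_unitSquare_swap fun p => (wy p - partialY v p) ^ 2
  have s2 := setIntegral_unitSquare_swap fun p => wyy p ^ 2
  have s3 := setIntegral_unitSquare_swap fun p => g p ^ 2
  simp only [Function.comp] at errY
  rw [s1, s2, s3] at errY
  -- The Poincaré inequality for the interpolation error.
  have poin := (hw.sub (hvm.memH10 hN)).integral_sq_le
  rw [integral_weakDeriv_sq hU (dy.sub dv2)] at poin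
  have hone := sobolevNorm_one_sq hU (dx.sub dv1) (dy.sub dv2)
  simp only [Pi.sub_apply] at poin hone
  have p0 : 0 ≤ ∫ p in unitSquare, w p ^ 2 := integral_nonneg fun _ => sq_nonneg _
  have p1 : 0 ≤ ∫ p in unitSquare, wx p ^ 2 := integral_nonneg fun _ => sq_nonneg _
  have p2 : 0 ≤ ∫ p in unitSquare, wy p ^ 2 := integral_nonneg fun _ => sq_nonneg _
  have p3 : 0 ≤ ∫ p in unitSquare, wxx p ^ 2 := integral_nonneg fun _ => sq_nonneg _
  have p4 : 0 ≤ ∫ p in unitSquare, g p ^ 2 := integral_nonneg fun _ => sq_nonneg _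
  have p5 : 0 ≤ ∫ p in unitSquare, wyy p ^ 2 := integral_nonneg fun _ => sq_nonneg _
  have herr : sobolevNorm unitSquare 1 (w - v) ^ 2 ≤
      96 * meshSize N ^ 2 * sobolevNorm unitSquare 2 w ^ 2 := by
    set E := (∫ p in unitSquare, wxx p ^ 2) + (∫ p in unitSquare, g p ^ 2) +
      ∫ p in unitSquare, wyy p ^ 2 with hE
    have hEle : E ≤ sobolevNorm unitSquare 2 w ^ 2 := by rw [hnorm]; linarith
    have hx : ∫ p in unitSquare, (wx p - partialX v p) ^ 2 ≤ 8 * (2 * meshSize N) ^ 2 * E := by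
      refine errX.trans ?_
      rw [hE]
      nlinarith [mul_nonneg (sq_nonneg (2 * meshSize N)) p3,
        mul_nonneg (sq_nonneg (2 * meshSize N)) p5]
    have hy : ∫ p in unitSquare, (wy p - partialY v p) ^ 2 ≤ 8 * (2 * meshSize N) ^ 2 * E := by
      refine errY.trans ?_
      rw [hE]
      nlinarith [mul_nonneg (sq_nonneg (2 * meshSize N)) p3,
        mul_nonneg (sq_nonneg (2 * meshSize N)) p5]
    calc _ ≤ 96 * meshSize N ^ 2 * E := by rw [hone]; linarith
      _ ≤ _ := by gcongr
  have hsq : meshSize N ^ 2 ≤ 1 / 4 := by nlinarith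
  have hW : 0 ≤ sobolevNorm unitSquare 2 w ^ 2 := sq_nonneg _
  refine ⟨v, hvm, by nlinarith [mul_nonneg (sq_nonneg (meshSize N)) hW], ?_⟩
  have hv1 : sobolevNorm unitSquare 1 v ^ 2 ≤ 50 * sobolevNorm unitSquare 2 w ^ 2 := by
    have h1 := sobolevNorm_sub_sq_le hU hw.1 (hw.1.sub (hvm.memSobolev hN))
    rw [sub_sub_cancel] at h1
    have h2 : sobolevNorm unitSquare 1 w ^ 2 ≤ sobolevNorm unitSquare 2 w ^ 2 :=
      pow_le_pow_left₀ (sobolevNorm_nonneg _ _) (sobolevNorm_mono_order (by norm_num)) 2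
    nlinarith [mul_le_mul_of_nonneg_right hsq hW]
  have hcell : ∀ e : Fin N × Fin N, sobolevNorm (interior (meshCell e)) 2 v ^ 2 ≤
      cellEnergy (interpolantPiece g) e +
        ∫ p in openSquare (cellCenter e) (meshSize N), g p ^ 2 := by
    intro e
    rw [hp.sobolevNorm_cell_sq, cellEnergy]
    simp only [second_partials_interpolantPiece]
    have h1 := sq_setIntegral_abs_le (c := cellCenter e) hh.le
      (mxy.mono_measure (Measure.restrict_mono (openCell_subset hN e) le_rfl))
    have h2 : ∫ p in openSquare (cellCenter e) (meshSize N), cellAverage g e ^ 2 ≤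
        ∫ p in openSquare (cellCenter e) (meshSize N), g p ^ 2 := by
      rw [setIntegral_const, volume_openSquare _ hh.le, smul_eq_mul, cellAverage, mul_pow]
      have h3 : (∫ p in openSquare (cellCenter e) (meshSize N), g p) ^ 2 ≤
          (∫ p in openSquare (cellCenter e) (meshSize N), |g p|) ^ 2 := by
        rw [← sq_abs]
        exact pow_le_pow_left₀ (abs_nonneg _) abs_integral_le_integral_abs 2
      calc _ ≤ 4 * meshSize N ^ 2 * ((((2 * meshSize N) ^ 2)⁻¹) ^ 2 * ((2 * meshSize N) ^ 2 *
            ∫ p in openSquare (cellCenter e) (meshSize N), g p ^ 2)) := by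
            gcongr; exact h3.trans h1
        _ = _ := by field_simp; ring
    simp only [ne_eq, OfNat.ofNat_ne_zero, not_false_eq_true, zero_pow, integral_zero]
    linarith
  rw [brokenNorm_sq]
  calc _ ≤ ∑ e : Fin N × Fin N, (cellEnergy (interpolantPiece g) e +
        ∫ p in openSquare (cellCenter e) (meshSize N), g p ^ 2) :=
        Finset.sum_le_sum fun e _ => hcell e
    _ = sobolevNorm unitSquare 1 v ^ 2 + ∫ p in unitSquare, g p ^ 2 := by
        rw [Finset.sum_add_distrib, ← hvm.sobolevNorm_one_sq_eq_sum hp hN,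
          ← setIntegral_unitSquare_eq_sum hN mxy.integrable_sq]
    _ ≤ _ := by
        have : ∫ p in unitSquare, g p ^ 2 ≤ sobolevNorm unitSquare 2 w ^ 2 := by
          rw [hnorm]; linarith
        linarith

end InterpolationTheorem

/-! ### Coefficients -/

section Coefficients

variable {a g : ℝ × ℝ → ℝ} {B : ℝ}

/-- A continuous function with a bounded weak derivative in the horizontal direction is Lipschitz
continuous on horizontal lines. -/
lemma abs_sub_le_of_isWeakDeriv (ha : ContinuousOn a (closure unitSquare))
    (h : IsWeakDeriv unitSquare 1 0 a g) (hg : IntegrableOn g unitSquare)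
    (hB : ∀ᵐ p ∂(volume.restrict unitSquare), |g p| ≤ B) {x x' y : ℝ} (hx : x ∈ Set.Ioo (0 : ℝ) 1)
    (hx' : x' ∈ Set.Ioo (0 : ℝ) 1) (hy : y ∈ Set.Ioo (0 : ℝ) 1) :
    |a (x, y) - a (x', y)| ≤ B * |x - x'| := by
  have hac : ContinuousOn a unitSquare := ha.mono subset_closure
  obtain ⟨c, -, hc⟩ := h.exists_eq_add_primX
    (MemLp.integrable_unitSquare (memLp_of_continuous ha 2)) hg
  have hX : ∀ t ∈ Set.Ioo (0 : ℝ) 1, ContinuousOn (fun s => a (s, t)) (Set.Ioo 0 1) := fun t ht =>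
    hac.comp (by fun_prop) fun s hs => ⟨hs, ht⟩
  have hY : ∀ s ∈ Set.Ioo (0 : ℝ) 1, ContinuousOn (fun t => a (s, t)) (Set.Ioo 0 1) := fun s hs =>
    hac.comp (by fun_prop) fun t ht => ⟨hs, ht⟩
  -- The estimate holds on almost every horizontal line, hence on all of them by continuity. It is
  -- written as an equation in order to extend it from almost all lines.
  have hgood : ∀ᵐ t ∂unitMeasure, max (|a (x, t) - a (x', t)| - B * |x - x'|) 0 = 0 := by
    filter_upwards [ae_ae_swap_of_ae_unitSquare hc, ae_ae_swap_of_ae_unitSquare hB,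
      (integrable_prod_unitMeasure hg).prod_left_ae, ae_unitMeasure_mem] with t h1 h2 h3 ht
    have ii := integrable_unitMeasure_iff.1 h3
    have sub1 : ∀ s ∈ Set.Ioo (0 : ℝ) 1, IntervalIntegrable (fun s => g (s, t)) volume 0 s := by
      intro s hs
      refine ii.mono_set ?_
      rw [Set.uIcc_of_le hs.1.le, Set.uIcc_of_le zero_le_one]
      exact Set.Icc_subset_Icc_right hs.2.le
    have hcont : ContinuousOn (fun s => ∫ σ in (0 : ℝ)..s, g (σ, t)) (Set.uIcc 0 1) :=
      intervalIntegral.continuousOn_primitive_interval' ii (by simp)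
    rw [Set.uIcc_of_le zero_le_one] at hcont
    have heq : Set.EqOn (fun s => a (s, t)) (fun s => c t + ∫ σ in (0 : ℝ)..s, g (σ, t))
        (Set.Ioo 0 1) :=
      Measure.eqOn_open_of_ae_eq (μ := volume) h1 isOpen_Ioo (hX t ht)
        (continuousOn_const.add (hcont.mono Set.Ioo_subset_Icc_self))
    have e : a (x, t) - a (x', t) = ∫ σ in x'..x, g (σ, t) := by
      have e1 := heq hx
      have e2 := heq hx'
      simp only at e1 e2
      rw [e1, e2, ← intervalIntegral.integral_interval_sub_left (sub1 _ hx) (sub1 _ hx')]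
      ring
    refine max_eq_right (sub_nonpos.2 ?_)
    rw [e]
    refine intervalIntegral.norm_integral_le_of_norm_le_const_ae (f := fun σ => g (σ, t)) ?_
    rw [unitMeasure, ae_restrict_iff' measurableSet_Ioo] at h2
    filter_upwards [h2] with σ hσ hσI
    rw [Set.uIoc, Set.mem_Ioc] at hσI
    exact hσ ⟨(lt_min hx'.1 hx.1).trans hσI.1, hσI.2.trans_lt (max_lt hx'.2 hx.2)⟩
  have hall : Set.EqOn (fun t => max (|a (x, t) - a (x', t)| - B * |x - x'|) 0) (fun _ => 0)
      (Set.Ioo 0 1) :=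
    Measure.eqOn_open_of_ae_eq (μ := volume) hgood isOpen_Ioo
      (((((hY x hx).sub (hY x' hx')).abs).sub continuousOn_const).sup continuousOn_const)
      continuousOn_const
  have := hall hy
  simp only [sup_eq_right] at this
  linarith

/-- Coefficients in `W^{2,∞}` are bounded and Lipschitz continuous. Only their first derivatives
matter, and the Lipschitz estimate is needed on the cells of the mesh, which may touch the boundary
of the unit square. -/
lemma IsW2Infty.exists_bound (ha : IsW2Infty a) : ∃ M, (∀ p ∈ closure unitSquare, |a p| ≤ M) ∧
    ∀ N : ℕ, 1 ≤ N → ∀ e : Fin N × Fin N, ∀ p ∈ meshCell e,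
      |a p - a (cellCenter e)| ≤ M * meshSize N := by
  have hU := isOpen_unitSquare
  obtain ⟨hc, hs⟩ := ha
  have dx := hs.isWeakDeriv (i := 1) (j := 0) (by norm_num)
  have dy := hs.isWeakDeriv (i := 0) (j := 1) (by norm_num)
  have mx := hs.memLp_weakDeriv hU (i := 1) (j := 0) (by norm_num)
  have my := hs.memLp_weakDeriv hU (i := 0) (j := 1) (by norm_num)
  have ix : IntegrableOn _ unitSquare := mx.integrable le_top
  have iy : IntegrableOn _ unitSquare := my.integrable le_top
  have bound : ∀ {q : ℝ × ℝ → ℝ}, MemLp q ∞ (volume.restrict unitSquare) →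
      ∃ B, ∀ᵐ p ∂(volume.restrict unitSquare), |q p| ≤ B := by
    intro q hq
    refine ⟨(eLpNormEssSup q (volume.restrict unitSquare)).toReal, ?_⟩
    have hfin := hq.2
    rw [eLpNorm_exponent_top] at hfin
    filter_upwards [ae_le_eLpNormEssSup (f := q) (μ := volume.restrict unitSquare)] with p hp
    have := ENNReal.toReal_mono hfin.ne hp
    simpa using this
  obtain ⟨Bx, hBx⟩ := bound mx
  obtain ⟨By, hBy⟩ := bound my
  obtain ⟨M0, hM0⟩ := isCompact_closure_unitSquare.exists_bound_of_continuousOn hc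
  have icc : IntegrableOn a unitSquare :=
    MemLp.integrable_unitSquare (memLp_of_continuous hc 2)
  have hcs : ContinuousOn (a ∘ Prod.swap) (closure unitSquare) := by
    refine hc.comp continuous_swap.continuousOn fun p hp => ?_
    rw [closure_unitSquare] at hp ⊢
    exact ⟨hp.2, hp.1⟩
  have dys : IsWeakDeriv unitSquare 1 0 (a ∘ Prod.swap)
      (weakDeriv unitSquare 0 1 a ∘ Prod.swap) := by
    refine ⟨(integrableOn_comp_swap icc).locallyIntegrableOn,
      (integrableOn_comp_swap iy).locallyIntegrableOn, fun φ hφ => ?_⟩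
    have e := dy.2.2 _ (isTestFunction_comp_swap hφ)
    rw [← setIntegral_unitSquare_swap, ← setIntegral_unitSquare_swap
      (fun p => weakDeriv unitSquare 0 1 a p * _)] at e
    simpa [partialY_comp_swap] using e
  have hBys : ∀ᵐ p ∂(volume.restrict unitSquare),
      |(weakDeriv unitSquare 0 1 a ∘ Prod.swap) p| ≤ By := ae_unitSquare_swap hBy
  have hlip : ∀ p ∈ unitSquare, ∀ q ∈ unitSquare,
      |a p - a q| ≤ Bx * |p.1 - q.1| + By * |p.2 - q.2| := by
    intro p hp q hq
    have h1 := abs_sub_le_of_isWeakDeriv hc dx ix hBx hp.1 hq.1 hp.2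
    have h2 := abs_sub_le_of_isWeakDeriv hcs dys (integrableOn_comp_swap iy) hBys hp.2 hq.2 hq.1
    simp only [Function.comp, Prod.swap_prod_mk] at h2
    calc |a p - a q| ≤ |a (p.1, p.2) - a (q.1, p.2)| + |a (q.1, p.2) - a (q.1, q.2)| :=
          abs_sub_le _ _ _
      _ ≤ _ := add_le_add h1 h2
  refine ⟨max M0 (|Bx| + |By|), fun p hp => (hM0 p hp).trans (le_max_left _ _),
    fun N hN e p hp => ?_⟩
  have hh := meshSize_pos hN
  have hcen : cellCenter e ∈ unitSquare := openCell_subset hN e (by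
    simp only [openSquare, Set.mem_prod, Set.mem_Ioo]
    refine ⟨⟨?_, ?_⟩, ?_, ?_⟩ <;> linarith)
  have h1 : |a p - a (cellCenter e)| ≤
      Bx * |p.1 - (cellCenter e).1| + By * |p.2 - (cellCenter e).2| := by
    -- Extension to the closed square by continuity.
    refine le_on_closure (f := fun p => |a p - a (cellCenter e)|)
      (g := fun p => Bx * |p.1 - (cellCenter e).1| + By * |p.2 - (cellCenter e).2|)
      (fun q hq => hlip q hq _ hcen) (hc.sub continuousOn_const).abs ?_ (meshCell_subset hN e hp)
    exact Continuous.continuousOn (by fun_prop)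
  have h2 : |p.1 - (cellCenter e).1| ≤ meshSize N := by
    rw [abs_le]; constructor <;> linarith [hp.1.1, hp.1.2]
  have h3 : |p.2 - (cellCenter e).2| ≤ meshSize N := by
    rw [abs_le]; constructor <;> linarith [hp.2.1, hp.2.2]
  calc _ ≤ _ := h1
    _ ≤ |Bx| * meshSize N + |By| * meshSize N := by
      gcongr <;> exact le_abs_self _
    _ = (|Bx| + |By|) * meshSize N := by ring
    _ ≤ _ := by gcongr; exact le_max_right _ _

end Coefficients

/-! ### The bilinear forms -/

section Forms

variable {k N : ℕ} {κ : EllipticCoeffs}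

/-- The coefficients of the bilinear form, as the matrix of a bilinear form in the values and the
first derivatives of the second and of the first argument. -/
def EllipticCoeffs.coef (κ : EllipticCoeffs) (m n : Fin 3) (p : ℝ × ℝ) : ℝ :=
  (!![κ.c p, κ.b p 0, κ.b p 1; 0, κ.a p 0 0, κ.a p 0 1; 0, κ.a p 1 0, κ.a p 1 1] :
    Matrix (Fin 3) (Fin 3) ℝ) m n

lemma EllipticCoeffs.integrand_eq_sum (κ : EllipticCoeffs) (p : ℝ × ℝ) (y z : ℝ)
    (gy gz : Fin 2 → ℝ) : κ.integrand p y z gy gz =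
      ∑ mn : Fin 3 × Fin 3, κ.coef mn.1 mn.2 p * (![z, gz 0, gz 1] : Fin 3 → ℝ) mn.1 *
        (![y, gy 0, gy 1] : Fin 3 → ℝ) mn.2 := by
  simp only [EllipticCoeffs.integrand, EllipticCoeffs.coef, Fintype.sum_prod_type,
    Fin.sum_univ_three, dotProduct, Matrix.mulVec, Fin.sum_univ_two]
  simp
  ring

/-- The entries of the coefficient matrix are bounded and Lipschitz continuous on the cells, with a
common constant. -/
lemma EllipticCoeffs.InW2Infty.exists_bound (hκ : κ.InW2Infty) : ∃ M > 0, ∀ m n,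
    ContinuousOn (κ.coef m n) (closure unitSquare) ∧
    (∀ p ∈ closure unitSquare, |κ.coef m n p| ≤ M) ∧
    ∀ N : ℕ, 1 ≤ N → ∀ e : Fin N × Fin N, ∀ p ∈ meshCell e,
      |κ.coef m n p - κ.coef m n (cellCenter e)| ≤ M * meshSize N := by
  obtain ⟨ha, hb, hc⟩ := hκ
  have each : ∀ m n, ContinuousOn (κ.coef m n) (closure unitSquare) ∧ ∃ M,
      (∀ p ∈ closure unitSquare, |κ.coef m n p| ≤ M) ∧
      ∀ N : ℕ, 1 ≤ N → ∀ e : Fin N × Fin N, ∀ p ∈ meshCell e,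
        |κ.coef m n p - κ.coef m n (cellCenter e)| ≤ M * meshSize N := by
    have zero : ContinuousOn (fun _ : ℝ × ℝ => (0 : ℝ)) (closure unitSquare) ∧ ∃ M,
        (∀ p ∈ closure unitSquare, |(fun _ : ℝ × ℝ => (0 : ℝ)) p| ≤ M) ∧
        ∀ N : ℕ, 1 ≤ N → ∀ e : Fin N × Fin N, ∀ p ∈ meshCell e,
          |(fun _ : ℝ × ℝ => (0 : ℝ)) p - (fun _ : ℝ × ℝ => (0 : ℝ)) (cellCenter e)| ≤
            M * meshSize N :=
      ⟨continuousOn_const, 0, by simp, by simp⟩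
    intro m n
    fin_cases m <;> fin_cases n
    · exact ⟨hc.1, hc.exists_bound⟩
    · exact ⟨(hb 0).1, (hb 0).exists_bound⟩
    · exact ⟨(hb 1).1, (hb 1).exists_bound⟩
    · exact zero
    · exact ⟨(ha 0 0).1, (ha 0 0).exists_bound⟩
    · exact ⟨(ha 0 1).1, (ha 0 1).exists_bound⟩
    · exact zero
    · exact ⟨(ha 1 0).1, (ha 1 0).exists_bound⟩
    · exact ⟨(ha 1 1).1, (ha 1 1).exists_bound⟩
  choose hcont M h1 h2 using each
  have hle : ∀ m n, M m n ≤ 1 + ∑ m, ∑ n, |M m n| := by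
    intro m n
    have a := Finset.single_le_sum (f := fun n => |M m n|) (fun _ _ => abs_nonneg _)
      (Finset.mem_univ n)
    have b := Finset.single_le_sum (f := fun m => ∑ n, |M m n|)
      (fun _ _ => Finset.sum_nonneg fun _ _ => abs_nonneg _) (Finset.mem_univ m)
    linarith [le_abs_self (M m n)]
  refine ⟨1 + ∑ m, ∑ n, |M m n|, by positivity, fun m n => ⟨hcont m n, fun p hp =>
    (h1 m n p hp).trans (hle m n), fun N hN e p hp => (h2 m n N hN e p hp).trans ?_⟩⟩
  have := meshSize_pos hN
  gcongr
  exact hle m n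

/-- The value and the weak derivatives of first order. -/
noncomputable def weakJet (u : ℝ × ℝ → ℝ) (m : Fin 3) : ℝ × ℝ → ℝ :=
  (![u, weakDeriv unitSquare 1 0 u, weakDeriv unitSquare 0 1 u] : Fin 3 → ℝ × ℝ → ℝ) m

/-- The value and the classical derivatives of first order. -/
noncomputable def jet (u : ℝ × ℝ → ℝ) (m : Fin 3) : ℝ × ℝ → ℝ :=
  (![u, partialX u, partialY u] : Fin 3 → ℝ × ℝ → ℝ) m

variable {u v w χ : ℝ × ℝ → ℝ}

lemma MemSobolev.memLp_weakJet (hu : MemSobolev unitSquare 1 2 u) (m : Fin 3) :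
    MemLp (weakJet u m) 2 (volume.restrict unitSquare) := by
  fin_cases m
  · exact hu.memLp isOpen_unitSquare
  · exact hu.memLp_weakDeriv isOpen_unitSquare (by norm_num)
  · exact hu.memLp_weakDeriv isOpen_unitSquare (by norm_num)

lemma MemSobolev.sqrt_integral_weakJet_le (hu : MemSobolev unitSquare 1 2 u) (m : Fin 3) :
    √(∫ p in unitSquare, weakJet u m p ^ 2) ≤ sobolevNorm unitSquare 1 u := by
  refine Real.sqrt_le_iff.2 ⟨sobolevNorm_nonneg _ _, ?_⟩
  obtain ⟨h1, h2, h3⟩ := integral_sq_le_sobolevNorm_one_sq isOpen_unitSquare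
    (hu.isWeakDeriv (i := 1) (j := 0) (by norm_num))
    (hu.isWeakDeriv (i := 0) (j := 1) (by norm_num))
  fin_cases m
  · exact h1
  · exact h2
  · exact h3

lemma EllipticCoeffs.integrand_weakGrad (κ : EllipticCoeffs) (p : ℝ × ℝ) (u v : ℝ × ℝ → ℝ) :
    κ.integrand p (u p) (v p) (weakGrad u p) (weakGrad v p) =
      ∑ mn : Fin 3 × Fin 3, κ.coef mn.1 mn.2 p * weakJet v mn.1 p * weakJet u mn.2 p := by
  rw [EllipticCoeffs.integrand_eq_sum]
  refine Finset.sum_congr rfl fun mn _ => ?_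
  have e : ∀ (u : ℝ × ℝ → ℝ) (m : Fin 3),
      (![u p, weakGrad u p 0, weakGrad u p 1] : Fin 3 → ℝ) m = weakJet u m p := by
    intro u m
    fin_cases m <;> rfl
  rw [e, e]

lemma integrable_coef_mul_mul {a r s : ℝ × ℝ → ℝ} (ha : ContinuousOn a (closure unitSquare))
    (hr : MemLp r 2 (volume.restrict unitSquare)) (hs : MemLp s 2 (volume.restrict unitSquare)) :
    IntegrableOn (fun p => a p * r p * s p) unitSquare := by
  obtain ⟨B, hB⟩ := isCompact_closure_unitSquare.exists_bound_of_continuousOn ha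
  have h : IntegrableOn (fun p => r p * s p) unitSquare := hr.integrable_mul hs
  have := Integrable.bdd_mul (c := B) h ((ha.mono subset_closure).aestronglyMeasurable
    isOpen_unitSquare.measurableSet) (by
      filter_upwards [ae_restrict_mem isOpen_unitSquare.measurableSet] with p hp
      exact hB p (subset_closure hp))
  refine this.congr (Filter.Eventually.of_forall fun p => ?_)
  simp only [mul_assoc]

lemma EllipticCoeffs.form_eq_sum (hκ : κ.InW2Infty) (hu : MemSobolev unitSquare 1 2 u)
    (hv : MemSobolev unitSquare 1 2 v) : κ.form u v =
      ∑ mn : Fin 3 × Fin 3,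
        ∫ p in unitSquare, κ.coef mn.1 mn.2 p * weakJet v mn.1 p * weakJet u mn.2 p := by
  obtain ⟨M, -, hM⟩ := hκ.exists_bound
  simp only [EllipticCoeffs.form, EllipticCoeffs.integrand_weakGrad]
  exact integral_finsetSum _ fun mn _ =>
    integrable_coef_mul_mul (hM _ _).1 (hv.memLp_weakJet _) (hu.memLp_weakJet _)

lemma weakJet_sub_ae_eq (hv : MemSobolev unitSquare 1 2 v) (hw : MemSobolev unitSquare 1 2 w)
    (m : Fin 3) : weakJet (v - w) m =ᵐ[volume.restrict unitSquare] weakJet v m - weakJet w m := by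
  fin_cases m
  · exact Filter.EventuallyEq.refl _ _
  · exact ((hv.isWeakDeriv (by norm_num)).sub
      (hw.isWeakDeriv (by norm_num))).weakDeriv_ae_eq isOpen_unitSquare
  · exact ((hv.isWeakDeriv (by norm_num)).sub
      (hw.isWeakDeriv (by norm_num))).weakDeriv_ae_eq isOpen_unitSquare

lemma EllipticCoeffs.form_sub (hκ : κ.InW2Infty) (hu : MemSobolev unitSquare 1 2 u)
    (hv : MemSobolev unitSquare 1 2 v) (hw : MemSobolev unitSquare 1 2 w) :
    κ.form u (v - w) = κ.form u v - κ.form u w := by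
  obtain ⟨M, -, hM⟩ := hκ.exists_bound
  rw [form_eq_sum hκ hu hv, form_eq_sum hκ hu hw, form_eq_sum hκ hu (hv.sub hw),
    ← Finset.sum_sub_distrib]
  refine Finset.sum_congr rfl fun mn _ => ?_
  rw [← integral_sub (integrable_coef_mul_mul (hM _ _).1 (hv.memLp_weakJet _) (hu.memLp_weakJet _))
    (integrable_coef_mul_mul (hM _ _).1 (hw.memLp_weakJet _) (hu.memLp_weakJet _))]
  refine integral_congr_ae ?_
  filter_upwards [weakJet_sub_ae_eq hv hw mn.1] with p hp
  rw [hp, Pi.sub_apply]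
  ring

/-- The bilinear form is bounded on `H¹`. -/
lemma EllipticCoeffs.exists_form_bound (hκ : κ.InW2Infty) : ∃ C > 0, ∀ u v,
    MemSobolev unitSquare 1 2 u → MemSobolev unitSquare 1 2 v →
      |κ.form u v| ≤ C * sobolevNorm unitSquare 1 v * sobolevNorm unitSquare 1 u := by
  obtain ⟨M, hM0, hM⟩ := hκ.exists_bound
  refine ⟨9 * M, by positivity, fun u v hu hv => ?_⟩
  rw [form_eq_sum hκ hu hv]
  have each : ∀ mn : Fin 3 × Fin 3,
      |∫ p in unitSquare, κ.coef mn.1 mn.2 p * weakJet v mn.1 p * weakJet u mn.2 p| ≤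
        M * (sobolevNorm unitSquare 1 v * sobolevNorm unitSquare 1 u) := by
    intro mn
    have mv := hv.memLp_weakJet mn.1
    have mu := hu.memLp_weakJet mn.2
    have hi : IntegrableOn (fun p => |weakJet v mn.1 p| * |weakJet u mn.2 p|) unitSquare :=
      mv.abs.integrable_mul mu.abs
    calc _ ≤ ∫ p in unitSquare, |κ.coef mn.1 mn.2 p * weakJet v mn.1 p * weakJet u mn.2 p| :=
          abs_integral_le_integral_abs
      _ ≤ ∫ p in unitSquare, M * (|weakJet v mn.1 p| * |weakJet u mn.2 p|) := by
          refine integral_mono_of_nonneg (Filter.Eventually.of_forall fun _ => abs_nonneg _)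
            (hi.const_mul M) ?_
          filter_upwards [ae_restrict_mem isOpen_unitSquare.measurableSet] with p hp
          rw [abs_mul, abs_mul, mul_assoc]
          gcongr
          exact (hM _ _).2.1 p (subset_closure hp)
      _ = M * ∫ p in unitSquare, |weakJet v mn.1 p| * |weakJet u mn.2 p| := integral_const_mul _ _
      _ ≤ _ := by
          gcongr
          exact (integral_abs_mul_le mv mu).trans (mul_le_mul (hv.sqrt_integral_weakJet_le _)
            (hu.sqrt_integral_weakJet_le _) (Real.sqrt_nonneg _) (sobolevNorm_nonneg _ _))
  calc _ ≤ ∑ mn : Fin 3 × Fin 3,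
        |∫ p in unitSquare, κ.coef mn.1 mn.2 p * weakJet v mn.1 p * weakJet u mn.2 p| :=
        Finset.abs_sum_le_sum_abs _ _
    _ ≤ ∑ _mn : Fin 3 × Fin 3, M * (sobolevNorm unitSquare 1 v * sobolevNorm unitSquare 1 u) :=
        Finset.sum_le_sum fun mn _ => each mn
    _ = _ := by
        simp only [Finset.sum_const, Finset.card_univ, Fintype.card_prod, Fintype.card_fin,
          nsmul_eq_mul]
        push_cast
        ring

variable {f g : Fin N × Fin N → ℝ × ℝ → ℝ}

/-- The gradient from inside the cell is the gradient of the polynomial piece, on the boundary of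
the cell too. -/
lemma IsPieces.cellGrad_eq (hf : IsPieces k v f) (hN : 1 ≤ N) (e : Fin N × Fin N) {p : ℝ × ℝ}
    (hp : p ∈ meshCell e) : cellGrad e v p = ![partialX (f e) p, partialY (f e) p] := by
  have hh := meshSize_pos hN
  have hne : (interior (meshCell e)).Nonempty := by
    rw [interior_meshCell]
    refine ⟨cellCenter e, ⟨?_, ?_⟩, ?_, ?_⟩ <;> linarith
  have hu : UniqueDiffWithinAt ℝ (meshCell e) p :=
    uniqueDiffOn_convex (convex_closedSquare _ _) hne p hp
  have h : fderivWithin ℝ v (meshCell e) p = fderiv ℝ (f e) p := by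
    rw [fderivWithin_congr (fun q hq => (hf e).2 q hq) ((hf e).2 p hp)]
    exact ((hf e).1.contDiff.differentiable (by simp) p).fderivWithin hu
  rw [cellGrad, h]
  rfl

lemma IsTensorPoly.jet {r : ℝ × ℝ → ℝ} (hr : IsTensorPoly k r) (m : Fin 3) :
    IsTensorPoly k (jet r m) := by
  fin_cases m
  · exact hr
  · exact hr.partialX
  · exact hr.partialY

lemma IsPieces.integrand_cellGrad (hu : IsPieces k u f) (hv : IsPieces k v g) (hN : 1 ≤ N)
    (e : Fin N × Fin N) {p : ℝ × ℝ} (hp : p ∈ meshCell e) :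
    κ.integrand p (u p) (v p) (cellGrad e u p) (cellGrad e v p) =
      ∑ mn : Fin 3 × Fin 3, κ.coef mn.1 mn.2 p * jet (g e) mn.1 p * jet (f e) mn.2 p := by
  rw [EllipticCoeffs.integrand_eq_sum, hu.cellGrad_eq hN e hp, hv.cellGrad_eq hN e hp,
    (hu e).2 p hp, (hv e).2 p hp]
  refine Finset.sum_congr rfl fun mn _ => ?_
  have e : ∀ (r : ℝ × ℝ → ℝ) (m : Fin 3),
      (![r p, (![_root_.partialX r p, _root_.partialY r p] : Fin 2 → ℝ) 0,
        (![_root_.partialX r p, _root_.partialY r p] : Fin 2 → ℝ) 1] : Fin 3 → ℝ) m =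
        _root_.jet r m p := by
    intro r m
    fin_cases m <;> rfl
  rw [e, e]

lemma IsPieces.discreteForm_eq_sum (hk : 1 ≤ k) (hN : 1 ≤ N) (hu : IsPieces k u f)
    (hv : IsPieces k v g) : κ.discreteForm k N u v = ∑ e : Fin N × Fin N, ∑ mn : Fin 3 × Fin 3,
      squareQuadrature k (cellCenter e) (meshSize N) fun p =>
        κ.coef mn.1 mn.2 p * jet (g e) mn.1 p * jet (f e) mn.2 p := by
  refine Finset.sum_congr rfl fun e _ => ?_
  rw [← squareQuadrature_sum]
  exact squareQuadrature_congr hk (meshSize_pos hN).le fun p hp => hu.integrand_cellGrad hv hN e hp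

lemma EllipticCoeffs.discreteForm_sub (hk : 1 ≤ k) (hN : 1 ≤ N) (hu : MemVh0 k N u)
    (hv : MemVh0 k N v) (hw : MemVh0 k N w) :
    κ.discreteForm k N u (v - w) = κ.discreteForm k N u v - κ.discreteForm k N u w := by
  obtain ⟨f, hf⟩ := hu.1.exists_isPieces
  obtain ⟨g, hg⟩ := hv.1.exists_isPieces
  obtain ⟨r, hr⟩ := hw.1.exists_isPieces
  have hd : IsPieces k (v - w) (g - r) := fun e =>
    ⟨(hg e).1.sub (hr e).1, fun p hp => by simp [(hg e).2 p hp, (hr e).2 p hp]⟩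
  rw [hf.discreteForm_eq_sum hk hN hg, hf.discreteForm_eq_sum hk hN hr,
    hf.discreteForm_eq_sum hk hN hd, ← Finset.sum_sub_distrib]
  refine Finset.sum_congr rfl fun e _ => ?_
  rw [← Finset.sum_sub_distrib]
  refine Finset.sum_congr rfl fun mn _ => ?_
  rw [← squareQuadrature_sub]
  have ej : jet ((g - r) e) mn.1 = jet (g e) mn.1 - jet (r e) mn.1 := by
    obtain ⟨m, n⟩ := mn
    fin_cases m
    · rfl
    · exact partialX_sub (hg e).1.contDiff (hr e).1.contDiff
    · exact partialY_sub (hg e).1.contDiff (hr e).1.contDiff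
  rw [ej]
  congr 1
  ext p
  simp only [Pi.sub_apply]
  ring

lemma MemVh0.weakJet_ae_eq (hv : MemVh0 k N v) (hN : 1 ≤ N) (m : Fin 3) :
    weakJet v m =ᵐ[volume.restrict unitSquare] jet v m := by
  obtain ⟨d1, d2⟩ := hv.isWeakDeriv hN
  fin_cases m
  · exact Filter.EventuallyEq.refl _ _
  · exact d1.weakDeriv_ae_eq isOpen_unitSquare
  · exact d2.weakDeriv_ae_eq isOpen_unitSquare

lemma IsPieces.jet_eq (hf : IsPieces k v f) {e : Fin N × Fin N} {p : ℝ × ℝ}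
    (hp : p ∈ openSquare (cellCenter e) (meshSize N)) (m : Fin 3) : jet v m p = jet (f e) m p := by
  fin_cases m
  · exact (hf e).2 p (openSquare_subset_closedSquare _ _ hp)
  · exact hf.partialX_eq hp
  · exact hf.partialY_eq hp

lemma MemVh0.form_eq_sum (hκ : κ.InW2Infty) (hN : 1 ≤ N) (hu : MemVh0 k N u) (hv : MemVh0 k N v)
    (hf : IsPieces k u f) (hg : IsPieces k v g) :
    κ.form u v = ∑ e : Fin N × Fin N, ∑ mn : Fin 3 × Fin 3,
      ∫ p in openSquare (cellCenter e) (meshSize N),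
        κ.coef mn.1 mn.2 p * jet (g e) mn.1 p * jet (f e) mn.2 p := by
  obtain ⟨M, -, hM⟩ := hκ.exists_bound
  rw [EllipticCoeffs.form_eq_sum hκ (hu.memSobolev hN) (hv.memSobolev hN), Finset.sum_comm]
  refine Finset.sum_congr rfl fun mn _ => ?_
  rw [setIntegral_unitSquare_eq_sum hN (integrable_coef_mul_mul (hM _ _).1
    ((hv.memSobolev hN).memLp_weakJet _) ((hu.memSobolev hN).memLp_weakJet _))]
  refine Finset.sum_congr rfl fun e _ => integral_congr_ae ?_
  filter_upwards [ae_restrict_of_ae_restrict_of_subset (openCell_subset hN e)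
    (hv.weakJet_ae_eq hN mn.1), ae_restrict_of_ae_restrict_of_subset (openCell_subset hN e)
    (hu.weakJet_ae_eq hN mn.2), ae_restrict_mem (isOpen_openSquare _ _).measurableSet] with p a b hp
  rw [a, b, hg.jet_eq hp, hf.jet_eq hp]

/-- The contributions of one cell to the right side of the quadrature error bound. -/
lemma IsPieces.sqrt_integral_jet_le (hf : IsPieces k v f) (e : Fin N × Fin N) (m : Fin 3) :
    √(∫ p in openSquare (cellCenter e) (meshSize N), jet (f e) m p ^ 2) ≤ √(cellEnergy f e) ∧
    √(∫ p in openSquare (cellCenter e) (meshSize N), jet (f e) m p ^ 2) +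
      √(∫ p in openSquare (cellCenter e) (meshSize N), partialX (jet (f e) m) p ^ 2) +
      √(∫ p in openSquare (cellCenter e) (meshSize N), partialY (jet (f e) m) p ^ 2) ≤
      3 * sobolevNorm (interior (meshCell e)) 2 v := by
  have hs := hf.sobolevNorm_cell_sq e
  have hnn := sobolevNorm_nonneg (U := interior (meshCell e)) 2 v
  set S := openSquare (cellCenter e) (meshSize N)
  have hcomm := partialX_partialY_comm (hf e).1.contDiff
  have h0 : 0 ≤ ∫ p in S, f e p ^ 2 := integral_nonneg fun _ => sq_nonneg _
  have h1 : 0 ≤ ∫ p in S, partialX (f e) p ^ 2 := integral_nonneg fun _ => sq_nonneg _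
  have h2 : 0 ≤ ∫ p in S, partialY (f e) p ^ 2 := integral_nonneg fun _ => sq_nonneg _
  have h3 : 0 ≤ ∫ p in S, partialX (partialX (f e)) p ^ 2 := integral_nonneg fun _ => sq_nonneg _
  have h4 : 0 ≤ ∫ p in S, partialY (partialX (f e)) p ^ 2 := integral_nonneg fun _ => sq_nonneg _
  have h5 : 0 ≤ ∫ p in S, partialY (partialY (f e)) p ^ 2 := integral_nonneg fun _ => sq_nonneg _
  have key : ∀ {x : ℝ}, x ≤ sobolevNorm (interior (meshCell e)) 2 v ^ 2 →
      √x ≤ sobolevNorm (interior (meshCell e)) 2 v := fun hx => Real.sqrt_le_iff.2 ⟨hnn, hx⟩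
  have add3 : ∀ {x y z : ℝ}, x ≤ sobolevNorm (interior (meshCell e)) 2 v ^ 2 →
      y ≤ sobolevNorm (interior (meshCell e)) 2 v ^ 2 →
      z ≤ sobolevNorm (interior (meshCell e)) 2 v ^ 2 →
      √x + √y + √z ≤ 3 * sobolevNorm (interior (meshCell e)) 2 v := fun hx hy hz => by
    linarith [key hx, key hy, key hz]
  fin_cases m
  · refine ⟨Real.sqrt_le_sqrt ?_, add3 ?_ ?_ ?_⟩
    · change ∫ p in S, f e p ^ 2 ≤ cellEnergy f e
      rw [cellEnergy]; linarith
    · change ∫ p in S, f e p ^ 2 ≤ _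
      linarith
    · change ∫ p in S, partialX (f e) p ^ 2 ≤ _
      linarith
    · change ∫ p in S, partialY (f e) p ^ 2 ≤ _
      linarith
  · refine ⟨Real.sqrt_le_sqrt ?_, add3 ?_ ?_ ?_⟩
    · change ∫ p in S, partialX (f e) p ^ 2 ≤ cellEnergy f e
      rw [cellEnergy]; linarith
    · change ∫ p in S, partialX (f e) p ^ 2 ≤ _
      linarith
    · change ∫ p in S, partialX (partialX (f e)) p ^ 2 ≤ _
      linarith
    · change ∫ p in S, partialY (partialX (f e)) p ^ 2 ≤ _
      linarith
  · refine ⟨Real.sqrt_le_sqrt ?_, add3 ?_ ?_ ?_⟩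
    · change ∫ p in S, partialY (f e) p ^ 2 ≤ cellEnergy f e
      rw [cellEnergy]; linarith
    · change ∫ p in S, partialY (f e) p ^ 2 ≤ _
      linarith
    · change ∫ p in S, partialX (partialY (f e)) p ^ 2 ≤ _
      rw [← hcomm]
      linarith
    · change ∫ p in S, partialY (partialY (f e)) p ^ 2 ≤ _
      linarith

/-- Consistency: the quadrature perturbs the bilinear form only by a term of order `h`, if the
second argument is measured in the broken `H²` norm. -/
lemma EllipticCoeffs.exists_consistency_bound (hk : 1 ≤ k) (hκ : κ.InW2Infty) : ∃ C > 0,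
    ∀ N, 1 ≤ N → ∀ u v, MemVh0 k N u → MemVh0 k N v →
      |κ.form u v - κ.discreteForm k N u v| ≤
        C * meshSize N * (brokenNorm N 2 v * sobolevNorm unitSquare 1 u) := by
  obtain ⟨M, hM0, hM⟩ := hκ.exists_bound
  obtain ⟨C, hC, H⟩ := exists_quadrature_error_bound hk
  refine ⟨27 * (C * M), by positivity, fun N hN u v hu hv => ?_⟩
  obtain ⟨f, hf⟩ := hu.1.exists_isPieces
  obtain ⟨g, hg⟩ := hv.1.exists_isPieces
  have hh := meshSize_pos hN
  rw [hu.form_eq_sum hκ hN hv hf hg, hf.discreteForm_eq_sum hk hN hg, ← Finset.sum_sub_distrib]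
  have hcell : ∀ e : Fin N × Fin N,
      |(∑ mn : Fin 3 × Fin 3, ∫ p in openSquare (cellCenter e) (meshSize N),
        κ.coef mn.1 mn.2 p * jet (g e) mn.1 p * jet (f e) mn.2 p) -
      ∑ mn : Fin 3 × Fin 3, squareQuadrature k (cellCenter e) (meshSize N) fun p =>
        κ.coef mn.1 mn.2 p * jet (g e) mn.1 p * jet (f e) mn.2 p| ≤
      27 * (C * M) * meshSize N *
        (sobolevNorm (interior (meshCell e)) 2 v * √(cellEnergy f e)) := by
    intro e
    rw [← Finset.sum_sub_distrib]
    refine (Finset.abs_sum_le_sum_abs _ _).trans ?_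
    calc _ ≤ ∑ _mn : Fin 3 × Fin 3, C * M * meshSize N *
          (3 * sobolevNorm (interior (meshCell e)) 2 v) * √(cellEnergy f e) := by
          refine Finset.sum_le_sum fun mn _ => ?_
          refine (H (cellCenter e) (meshSize N) hh _ _ _ M
            ((hM _ _).1.mono (meshCell_subset hN e))
            (fun p hp => (hM _ _).2.1 p (meshCell_subset hN e hp)) ((hM _ _).2.2 N hN e)
            ((hg e).1.jet _) ((hf e).1.jet _)).trans ?_
          have hnn := sobolevNorm_nonneg (U := interior (meshCell e)) 2 v
          refine mul_le_mul ?_ (hf.sqrt_integral_jet_le e mn.2).1 (Real.sqrt_nonneg _)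
            (by positivity)
          exact mul_le_mul_of_nonneg_left (hg.sqrt_integral_jet_le e mn.1).2 (by positivity)
      _ = _ := by
          simp only [Finset.sum_const, Finset.card_univ, Fintype.card_prod, Fintype.card_fin,
            nsmul_eq_mul]
          push_cast
          ring
  refine (Finset.abs_sum_le_sum_abs _ _).trans ((Finset.sum_le_sum fun e _ => hcell e).trans ?_)
  rw [← Finset.mul_sum]
  gcongr
  have hE : ∀ e, 0 ≤ cellEnergy f e := fun e =>
    add_nonneg (add_nonneg (integral_nonneg fun _ => sq_nonneg _)
      (integral_nonneg fun _ => sq_nonneg _)) (integral_nonneg fun _ => sq_nonneg _)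
  -- The Cauchy-Schwarz inequality for the sum over the cells.
  refine (Real.sum_mul_le_sqrt_mul_sqrt _ _ _).trans (le_of_eq ?_)
  rw [brokenNorm]
  congr 1
  simp only [Real.sq_sqrt (hE _)]
  rw [← hu.sobolevNorm_one_sq_eq_sum hf hN, Real.sqrt_sq (sobolevNorm_nonneg _ _)]

end Forms

/-! ### The error estimate -/

lemma sobolevNorm_sub_comm {U : Set (ℝ × ℝ)} (hU : IsOpen U) {m : ℕ} {u v : ℝ × ℝ → ℝ}
    (hu : MemSobolev U m 2 u) (hv : MemSobolev U m 2 v) :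
    sobolevNorm U m (u - v) = sobolevNorm U m (v - u) := by
  rw [← sq_eq_sq₀ (sobolevNorm_nonneg _ _) (sobolevNorm_nonneg _ _), sobolevNorm_sq, sobolevNorm_sq]
  refine Finset.sum_congr rfl fun r hr => Finset.sum_congr rfl fun ij hij => ?_
  have h : ij.1 + ij.2 ≤ m := by
    rw [Finset.HasAntidiagonal.mem_antidiagonal.1 hij]
    exact Nat.lt_succ_iff.1 (Finset.mem_range.1 hr)
  rw [integral_weakDeriv_sq hU ((hu.isWeakDeriv h).sub (hv.isWeakDeriv h)),
    integral_weakDeriv_sq hU ((hv.isWeakDeriv h).sub (hu.isWeakDeriv h))]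
  congr 1
  ext p
  simp only [Pi.sub_apply]
  ring

lemma sub_le_of_sq_sub_le {x a b : ℝ} (ha : 0 ≤ a) (hb : 0 ≤ b)
    (h : x ^ 2 ≤ 2 * a ^ 2 + 2 * b ^ 2) : x ≤ 2 * a + 2 * b := by
  refine le_of_sq_le_sq (h.trans ?_) (by positivity)
  nlinarith [mul_nonneg ha hb]

theorem mainTheorem6 (k : ℕ) (hk : 1 ≤ k) (κ : EllipticCoeffs) (hκ : κ.InW2Infty)
    (hreg : κ.EllipticRegularity) (hell : κ.VhElliptic k) :
    ∃ C : ℝ, ∀ N : ℕ, 1 ≤ N → ∀ θ w wh : ℝ × ℝ → ℝ, MemVh0 k N θ →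
      κ.IsDualSolution θ w → κ.IsDiscreteDualSolution k N θ wh →
        sobolevNorm unitSquare 1 (w - wh) ≤ C * meshSize N * sobolevNorm unitSquare 2 w ∧
        brokenNorm N 2 wh ≤ C * sobolevNorm unitSquare 0 θ := by
  obtain ⟨CR, hR⟩ := hreg
  obtain ⟨C1, hC1, hE⟩ := hell
  obtain ⟨C2, hC2, hcons⟩ := EllipticCoeffs.exists_consistency_bound hk hκ
  obtain ⟨C3, hC3, hform⟩ := EllipticCoeffs.exists_form_bound hκ
  obtain ⟨C4, hC4, hinv⟩ := exists_brokenNorm_le k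
  have hU := isOpen_unitSquare
  -- the constant for the distance between the discrete solution and the interpolant
  set D := 15 * (C2 + C3) / C1 with hD
  have hDpos : 0 < D := by positivity
  refine ⟨max (30 + 2 * D) ((30 + 2 * (C4 * D)) * |CR|), fun N hN θ w wh hθ hw hwh => ?_⟩
  have hh := meshSize_pos hN
  obtain ⟨hw2, hwR⟩ := hR θ w (memLp_of_continuous hθ.1.1 2) hw
  obtain ⟨v, hv, hv1, hv2⟩ := exists_interpolant hk hN hw.1 hw2
  set W := sobolevNorm unitSquare 2 w with hW
  have hW0 : 0 ≤ W := sobolevNorm_nonneg _ _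
  have hv1' : sobolevNorm unitSquare 1 (w - v) ≤ 15 * meshSize N * W := by
    refine le_of_sq_le_sq (hv1.trans ?_) (by positivity)
    nlinarith [mul_nonneg (sq_nonneg (meshSize N)) (sq_nonneg W)]
  have hv2' : brokenNorm N 2 v ≤ 15 * W := by
    refine le_of_sq_le_sq (hv2.trans ?_) (by positivity)
    nlinarith [sq_nonneg W]
  -- the discrete solution is compared with the interpolant by means of `V^h`-ellipticity
  set χ := v - wh with hχ
  have hχm : MemVh0 k N χ := hv.sub hwh.1
  set x := sobolevNorm unitSquare 1 χ with hx
  have hx0 : 0 ≤ x := sobolevNorm_nonneg _ _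
  have key : C1 * x ^ 2 ≤ 15 * (C2 + C3) * meshSize N * W * x := by
    have e1 : κ.discreteForm k N χ χ = κ.discreteForm k N χ v - κ.discreteForm k N χ wh :=
      EllipticCoeffs.discreteForm_sub hk hN hχm hv hwh.1
    -- Both dual problems have the same right side, and `χ` is admissible in both.
    have e2 : κ.discreteForm k N χ wh = κ.form χ w :=
      (hwh.2 χ hχm).trans (hw.2 χ (hχm.memH10 hN)).symm
    have e3 : κ.form χ (w - v) = κ.form χ w - κ.form χ v :=
      EllipticCoeffs.form_sub hκ (hχm.memSobolev hN) hw.1.1 (hv.memSobolev hN)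
    have b1 := (abs_le.1 (hcons N hN χ v hχm hv)).1
    have b2 := (abs_le.1 (hform χ (w - v) (hχm.memSobolev hN)
      (hw.1.1.sub (hv.memSobolev hN)))).1
    have b3 : C2 * meshSize N * (brokenNorm N 2 v * x) ≤ C2 * meshSize N * (15 * W * x) := by
      gcongr
    have b4 : C3 * sobolevNorm unitSquare 1 (w - v) * x ≤ C3 * (15 * meshSize N * W) * x := by
      gcongr
    have b5 := hE N hN χ hχm
    rw [e1, e2] at b5
    nlinarith
  have hxle : x ≤ D * meshSize N * W := by
    rcases hx0.eq_or_lt with h0 | hpos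
    · rw [← h0]; positivity
    · have : C1 * x ≤ 15 * (C2 + C3) * meshSize N * W := by
        refine le_of_mul_le_mul_right ?_ hpos
        rw [mul_assoc, ← sq]
        exact key
      rw [hD, div_mul_eq_mul_div, div_mul_eq_mul_div, le_div_iff₀ hC1]
      linarith
  constructor
  · have h1 := sobolevNorm_sub_sq_le hU (hw.1.1.sub (hv.memSobolev hN))
      ((hwh.1.memSobolev hN).sub (hv.memSobolev hN))
    rw [sub_sub_sub_cancel_right, sobolevNorm_sub_comm hU (hwh.1.memSobolev hN)
      (hv.memSobolev hN)] at h1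
    calc _ ≤ 2 * sobolevNorm unitSquare 1 (w - v) + 2 * x :=
          sub_le_of_sq_sub_le (sobolevNorm_nonneg _ _) hx0 h1
      _ ≤ 2 * (15 * meshSize N * W) + 2 * (D * meshSize N * W) := by gcongr
      _ = (30 + 2 * D) * meshSize N * W := by ring
      _ ≤ _ := by gcongr; exact le_max_left _ _
  -- The inverse inequality loses a factor `h`, which the bound for `χ` provides.
  · have h1 : brokenNorm N 2 χ ≤ C4 * D * W := by
      refine le_of_mul_le_mul_right ((hinv N hN χ hχm).trans ?_) hh
      calc C4 * x ≤ C4 * (D * meshSize N * W) := by gcongr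
        _ = _ := by ring
    have h2 := brokenNorm_sub_sq_le hv hχm
    rw [hχ, sub_sub_cancel, ← hχ] at h2
    have hWθ : W ≤ |CR| * sobolevNorm unitSquare 0 θ :=
      hwR.trans (mul_le_mul_of_nonneg_right (le_abs_self _) (sobolevNorm_nonneg _ _))
    have hθ0 := sobolevNorm_nonneg (U := unitSquare) 0 θ
    calc _ ≤ 2 * brokenNorm N 2 v + 2 * brokenNorm N 2 χ :=
          sub_le_of_sq_sub_le (brokenNorm_nonneg _ _) (brokenNorm_nonneg _ _) h2
      _ ≤ 2 * (15 * W) + 2 * (C4 * D * W) := by gcongr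
      _ = (30 + 2 * (C4 * D)) * W := by ring
      _ ≤ (30 + 2 * (C4 * D)) * (|CR| * sobolevNorm unitSquare 0 θ) := by gcongr
      _ = (30 + 2 * (C4 * D)) * |CR| * sobolevNorm unitSquare 0 θ := by ring
      _ ≤ _ := by gcongr; exact le_max_right _ _
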